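/- **Setting.** Let $X_0=\mathbb P^1\times\mathbb P^1\times\mathbb P^1$ over $\mathbb Q$ with coordinate pairs $(a_0:a_1),(b_0:b_1),(c_0:c_1)$, and let $\pi\colon X\to X_0$ be the smooth toric threefold obtained by blowing up the line $l_1=V(a_1,b_1)$ and then (the strict transform of) the line $l_2=V(a_1,c_1)$. Let $E_1,E_2$ be the exceptional divisors, $M=\pi^{-1}(V(a_0))$, $D=E_1+E_2+M$, $U=X\setminus D$, and let $T\subset X$ be the open torus. In Cox coordinates, points of $X$ are $(a_0:a_1:b_0:b_1:c_0:c_1:x:y)$, with $E_1=V(x)$, $E_2=V(y)$, $M=V(a_0)$ and $\pi$ given by $((a_0:a_1xy),(b_0:b_1x),(c_0:c_1y))$. Let $\mathfrak U=(\mathbb P^1_{\mathbb Z})^3\setminus\overline{V(a_0)\cup l_1\cup l_2}$, an integral model of $U\cong X_0\setminus(V(a_0)\cup l_1\cup l_2)$. The bundle $\omega_X(D)^\vee$ is isomorphic to $\mathcal L_1\otimes\mathcal L_2^\vee$, where $\mathcal L_1,\mathcal L_2$ are the base point free bundles with sections $\{a_1^2b_0^2c_0^2,\ a_1^2b_1^2c_0^2x^2,\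 a_1^2b_0^2c_1^2y^2,\ a_1^2b_1^2c_1^2x^2y^2,\ a_0^2b_1^2c_1^2\}$ and $\{a_0,\ a_1xy\}$, respectively. Put $a=a_0/(a_1xy)$, $b=b_0/(b_1x)$, $c=c_0/(c_1y)$ and let $1_D$ be the canonical section of $\mathcal O_X(D)$; the isomorphism is normalized so that $1_D\otimes da\wedge db\wedge dc$ corresponds to $a_0a_1^{-2}b_1^{-2}c_1^{-2}x^{-2}y^{-2}$. Equip each $\mathcal L_i$ at each place $v$ with the metric $\|s\|_v=\min_j|s/s_j|_v$, with $s_j$ running through its sections above, and $\omega_X(D)$ and $\omega_X(D)^\vee$ with the induced metrics. Let $H$ be the resulting height $H(P)=\prod_v\|s(P)\|_v^{-1}$ on $T(\mathbb Q)$, with $s$ a section of $\omega_X(D)^\vee$ not vanishing at $P$, and let $$N(B)=\#\{P\in\mathfrak U(\mathbb Z)\cap T(\mathbb Q)\mid H(P)\le B\}.$$ For a face $A$ of the real analytic Clemens complex of $D$ (a set of components of $D$ with a common real point, of dimension $\#A-1$), let $U_A$ be the complement in $X$ of the components of $D$ not in $A$. If $A$ is maximal, let $$b_A=\operatorname{rk}\operatorname{Pic}U-\operatorname{rk}\big(\mathcal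 O(U)^\times/\mathbb Q^\times\big)+\#A,\qquad b_A'=\operatorname{rk}\operatorname{Pic}(U_A),$$ $$\alpha_A=\frac1{(b_A'-1)!}\int_{\mathrm{Eff}_A^\vee}e^{-\langle\omega_X(D)^\vee|_{U_A},\,t\rangle}\,dt,$$ where $\mathrm{Eff}_A\subset\operatorname{Pic}(U_A)_{\mathbb R}$ is the cone generated by effective divisors and $dt$ is the Haar measure for which the lattice dual to $\operatorname{Pic}(U_A)$ has covolume $1$. For a prime $p$, let $\tau_{U,p}=da\,db\,dc/\|1_D\otimes da\wedge db\wedge dc\|_p$ be the Tamagawa measure on $U(\mathbb Q_p)$, where $\mathbb Z_p$ has measure $1$. Let $\tau_{M,\infty}=2\,db\,dc/\|1_{E_1}1_{E_2}\otimes db\wedge dc\|$ be the residue measure on $M(\mathbb R)$, with the norm on $\omega_M(E_1+E_2)$ induced from $\omega_X(D)$ by adjunction. **Theorem.** The face $M$ (that is, $\{M\}$) is a maximal, but not maximal-dimensional, face of the real analytic Clemens complex of $D$. If $P\in\mathfrak U(\mathbb Z)\cap T(\mathbb Q)$ is represented by integers $a_0=\pm1,a_1,b_0,b_1,c_0,c_1$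 with $\gcd(b_0,b_1)=\gcd(c_0,c_1)=\gcd(a_1,b_1)=\gcd(a_1,c_1)=1$, then $H(P)=|a_1|\max\{|b_0|,|b_1|\}^2\max\{|c_0|,|c_1|\}^2$. As $B\to\infty$, $$N(B)=c_\infty\,c_{\mathrm{fin}}\,B(\log B)^{b_M-1}(1+o(1)),$$ $$c_\infty=\alpha_M\,\tau_{M,\infty}(M(\mathbb R)),\qquad c_{\mathrm{fin}}=\prod_p\Big(1-\frac1p\Big)^{\operatorname{rk}\operatorname{Pic}U}\tau_{U,p}(\mathfrak U(\mathbb Z_p)),$$ with a convergent product. More explicitly, $b_M=3$, $c_\infty c_{\mathrm{fin}}=c$ and $$N(B)=c\,B(\log B)^2+O\big(B\log B(\log\log B)^3\big),\qquad c=4\prod_p\Big(\Big(1-\frac1p\Big)^2\Big(1+\frac2p-\frac1{p^2}-\frac1{p^3}\Big)\Big).$$ -/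

import Mathlib

open Filter Topology MeasureTheory Asymptotics
open scoped ENNReal TensorProduct LinearAlgebra.Projectivization

noncomputable section

namespace ToricThreefold

/-! ## The fan of `X` -/

/-- The eight rays of the fan of `X`; each is named after the corresponding generator of the
Cox ring `ℚ[a₀, a₁, b₀, b₁, c₀, c₁, x, y]`. The rays `x` and `y` belong to the exceptional
divisors `E₁` and `E₂`, and the ray `a0` belongs to the divisor `M`. -/
inductive Ray : Type
  | a0 | a1 | b0 | b1 | c0 | c1 | x | y
  deriving DecidableEq

instance : Fintype Ray where
  elems := {.a0, .a1, .b0, .b1, .c0, .c1, .x, .y}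
  complete := by intro ρ; cases ρ <;> decide

/-- The primitive generator of a ray in the cocharacter lattice `ℤ³`. -/
def gen : Ray → Fin 3 → ℤ
  | .a0 => ![1, 0, 0]
  | .a1 => ![-1, 0, 0]
  | .b0 => ![0, 1, 0]
  | .b1 => ![0, -1, 0]
  | .c0 => ![0, 0, 1]
  | .c1 => ![0, 0, -1]
  | .x => ![-1, -1, 0]
  | .y => ![-1, 0, -1]

/-- The pairing of a character `m` of the torus with the generator of the ray `ρ`, that is, the
order of vanishing of the character along the torus-invariant prime divisor of `ρ`. -/
def pair (m : Fin 3 → ℤ) (ρ : Ray) : ℤ := ∑ i, m i * gen ρ i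

/-- The maximal cones of the fan of `X₀ = ℙ¹ × ℙ¹ × ℙ¹`, as sets of rays. -/
def cubeFan : Finset (Finset Ray) :=
  (({.a0, .a1} : Finset Ray) ×ˢ ({.b0, .b1} : Finset Ray) ×ˢ ({.c0, .c1} : Finset Ray)).image
    fun t => {t.1, t.2.1, t.2.2}

/-- The maximal cones after the star subdivision along the cone `τ`, with new ray `r` (generated by
the sum of the generators of `τ`): this is the fan of the blow-up in the closure of the orbit
of `τ`. -/
def starSubdivision (τ : Finset Ray) (r : Ray) (S : Finset (Finset Ray)) : Finset (Finset Ray) :=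
  S.filter (fun σ => ¬ τ ⊆ σ) ∪
    (S.filter (fun σ => τ ⊆ σ)).biUnion fun σ => τ.image fun t => insert r (σ.erase t)

/-- The maximal cones of the fan of `X`: first blow up `ℙ¹ × ℙ¹ × ℙ¹` in `l₁ = V(a₁, b₁)`, then blow
up the resulting variety in (the strict transform of) `l₂ = V(a₁, c₁)`. -/
def fan : Finset (Finset Ray) :=
  starSubdivision {.a1, .c1} .y (starSubdivision {.a1, .b1} .x cubeFan)

/-- The components of the boundary divisor `D = M + E₁ + E₂`. -/
def boundary : Finset Ray := {.a0, .x, .y}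

/-- The face `{M}` of the Clemens complex. -/
def faceM : Finset Ray := {.a0}

/-! ## Points in Cox coordinates -/

section Points

variable (K : Type*) [Field K]

/-- The `K`-points of the universal torsor `Y`, the complement of the irrelevant locus in `𝔸⁸`. -/
abbrev TorsorPoint : Type _ := {z : Ray → K // ∃ σ ∈ fan, ∀ ρ, ρ ∉ σ → z ρ ≠ 0}

/-- Two points of the torsor are equivalent if they differ by an element of the
Néron--Severi torus `Hom(Pic X, Gₘ)`. -/
def coxSetoid : Setoid (TorsorPoint K) where
  r z w := ∃ l : Ray → Kˣ, (∀ m : Fin 3 → ℤ, ∏ ρ, l ρ ^ pair m ρ = 1) ∧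
    ∀ ρ, w.1 ρ = l ρ * z.1 ρ
  iseqv :=
    { refl := fun z => ⟨1, by simp, by simp⟩
      symm := by
        rintro z w ⟨l, hl, h⟩
        refine ⟨l⁻¹, fun m => ?_, fun ρ => ?_⟩
        · simp [hl m]
        · simp [h ρ]
      trans := by
        rintro z w v ⟨l, hl, h⟩ ⟨k, hk, h'⟩
        refine ⟨k * l, fun m => ?_, fun ρ => ?_⟩
        · simp [mul_zpow, Finset.prod_mul_distrib, hl m, hk m]
        · simp [h ρ, h' ρ, mul_assoc] }

/-- The set `X(K)`. -/
def Points : Type _ := Quotient (coxSetoid K)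

instance [TopologicalSpace K] : TopologicalSpace (Points K) :=
  inferInstanceAs (TopologicalSpace (Quotient (coxSetoid K)))

/-- `X(K)` carries its Borel `σ`-algebra. -/
instance [TopologicalSpace K] : MeasurableSpace (Points K) := borel _

instance [TopologicalSpace K] : BorelSpace (Points K) := ⟨rfl⟩

variable {K}

/-- The point `(a₀ : a₁ : b₀ : b₁ : c₀ : c₁ : x : y)` of `X(K)`. -/
def Points.mk (z : TorsorPoint K) : Points K := Quotient.mk (coxSetoid K) z

/-- A choice of Cox coordinates of a point. -/
def Points.coord (P : Points K) : Ray → K := (Quotient.out P).1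

variable (K) in
/-- The points of the open torus `T`. -/
def torus : Set (Points K) := {P | ∃ z : TorsorPoint K, Points.mk z = P ∧ ∀ ρ, z.1 ρ ≠ 0}

variable (K) in
/-- The set `Z_A(K)` of common `K`-points of the divisors belonging to the rays in `A`. -/
def stratum (A : Finset Ray) : Set (Points K) :=
  {P | ∃ z : TorsorPoint K, Points.mk z = P ∧ ∀ ρ ∈ A, z.1 ρ = 0}

set_option maxRecDepth 10000 in
theorem fan_disjoint :
    ∀ σ ∈ fan, ¬ (Ray.a0 ∈ σ ∧ (Ray.a1 ∈ σ ∨ Ray.x ∈ σ ∨ Ray.y ∈ σ)) ∧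
      ¬ (Ray.b0 ∈ σ ∧ (Ray.b1 ∈ σ ∨ Ray.x ∈ σ)) ∧
      ¬ (Ray.c0 ∈ σ ∧ (Ray.c1 ∈ σ ∨ Ray.y ∈ σ)) := by decide

theorem blowDown_ne_zero (z : TorsorPoint K) :
    (![z.1 .a0, z.1 .a1 * z.1 .x * z.1 .y] : Fin 2 → K) ≠ 0 ∧
    (![z.1 .b0, z.1 .b1 * z.1 .x] : Fin 2 → K) ≠ 0 ∧
    (![z.1 .c0, z.1 .c1 * z.1 .y] : Fin 2 → K) ≠ 0 := by
  obtain ⟨z, σ, hσ, hz⟩ := z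
  obtain ⟨h1, h2, h3⟩ := fan_disjoint σ hσ
  have key : ∀ ρ, z ρ = 0 → ρ ∈ σ := fun ρ h => by
    by_contra hn
    exact hz ρ hn h
  refine ⟨fun h => h1 ?_, fun h => h2 ?_, fun h => h3 ?_⟩
  · have e0 := congrFun h 0
    have e1 := congrFun h 1
    simp only [Matrix.cons_val_zero, Matrix.cons_val_one, Pi.zero_apply, mul_eq_zero] at e0 e1
    refine ⟨key _ e0, ?_⟩
    rcases e1 with (e | e) | e
    · exact Or.inl (key _ e)
    · exact Or.inr (Or.inl (key _ e))
    · exact Or.inr (Or.inr (key _ e))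
  · have e0 := congrFun h 0
    have e1 := congrFun h 1
    simp only [Matrix.cons_val_zero, Matrix.cons_val_one, Pi.zero_apply, mul_eq_zero] at e0 e1
    exact ⟨key _ e0, e1.imp (key _) (key _)⟩
  · have e0 := congrFun h 0
    have e1 := congrFun h 1
    simp only [Matrix.cons_val_zero, Matrix.cons_val_one, Pi.zero_apply, mul_eq_zero] at e0 e1
    exact ⟨key _ e0, e1.imp (key _) (key _)⟩

theorem prod_zpow_pair (l : Ray → Kˣ) (m : Fin 3 → ℤ) :
    ∏ ρ, l ρ ^ pair m ρ = l .a0 ^ pair m .a0 * l .a1 ^ pair m .a1 * l .b0 ^ pair m .b0 *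
      l .b1 ^ pair m .b1 * l .c0 ^ pair m .c0 * l .c1 ^ pair m .c1 * l .x ^ pair m .x *
      l .y ^ pair m .y := by
  have : (Finset.univ : Finset Ray) = {.a0, .a1, .b0, .b1, .c0, .c1, .x, .y} := rfl
  rw [this]
  simp [mul_assoc]

/-- The blow-up morphism `π : X → X₀ = ℙ¹ × ℙ¹ × ℙ¹` on `K`-points, given in Cox coordinates by
`((a₀ : a₁xy), (b₀ : b₁x), (c₀ : c₁y))`. -/
def blowDown (P : Points K) : ℙ K (Fin 2 → K) × ℙ K (Fin 2 → K) × ℙ K (Fin 2 → K) :=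
  Quotient.lift (s := coxSetoid K)
    (fun z : TorsorPoint K =>
      (Projectivization.mk K _ (blowDown_ne_zero z).1,
        Projectivization.mk K _ (blowDown_ne_zero z).2.1,
        Projectivization.mk K _ (blowDown_ne_zero z).2.2))
    (by
      rintro z w ⟨l, hl, h⟩
      have ha : l .a0 = l .a1 * l .x * l .y := by
        have := hl ![1, 0, 0]
        rw [prod_zpow_pair] at this
        simp [pair, gen, Fin.sum_univ_three] at this
        rw [mul_inv_eq_one.symm]
        simpa [mul_assoc, mul_comm, mul_left_comm] using this
      have hb : l .b0 = l .b1 * l .x := by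
        have := hl ![0, 1, 0]
        rw [prod_zpow_pair] at this
        simp [pair, gen, Fin.sum_univ_three] at this
        rw [mul_inv_eq_one.symm]
        simpa [mul_assoc, mul_comm, mul_left_comm] using this
      have hc : l .c0 = l .c1 * l .y := by
        have := hl ![0, 0, 1]
        rw [prod_zpow_pair] at this
        simp [pair, gen, Fin.sum_univ_three] at this
        rw [mul_inv_eq_one.symm]
        simpa [mul_assoc, mul_comm, mul_left_comm] using this
      refine Prod.ext ?_ (Prod.ext ?_ ?_)
      · refine (Projectivization.mk_eq_mk_iff _ _ _ _ _).2 ⟨(l .a0)⁻¹, ?_⟩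
        funext i
        fin_cases i
        · simp [h, Units.smul_def]
        · simp only [h, ha, Units.smul_def]
          simp
          field_simp
      · refine (Projectivization.mk_eq_mk_iff _ _ _ _ _).2 ⟨(l .b0)⁻¹, ?_⟩
        funext i
        fin_cases i
        · simp [h, Units.smul_def]
        · simp only [h, hb, Units.smul_def]
          simp
          field_simp
      · refine (Projectivization.mk_eq_mk_iff _ _ _ _ _).2 ⟨(l .c0)⁻¹, ?_⟩
        funext i
        fin_cases i
        · simp [h, Units.smul_def]
        · simp only [h, hc, Units.smul_def]
          simp
          field_simp)
    P

/-- For a ring `R` with fraction field `K` (a principal ideal domain in all uses below):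
`((a₀ : a₁), (b₀ : b₁), (c₀ : c₁))`, with entries in `R`, represents the image in `X₀(K)` of the point
`P` and lies in `𝔘(R)`, where `𝔘` is the complement in `ℙ¹ × ℙ¹ × ℙ¹` over `ℤ` of the closure
of `V(a₀) ∪ l₁ ∪ l₂`. This means that the three pairs are coprime and that neither `a₀`, nor `a₁`
and `b₁` simultaneously, nor `a₁` and `c₁` simultaneously, vanish modulo a maximal ideal
of `R`. -/
def IsIntegralRep {R : Type*} [CommRing R] [Algebra R K] (P : Points K) (a b c : Fin 2 → R) :
    Prop :=
  IsCoprime (a 0) (a 1) ∧ IsCoprime (b 0) (b 1) ∧ IsCoprime (c 0) (c 1) ∧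
  IsUnit (a 0) ∧ IsCoprime (a 1) (b 1) ∧ IsCoprime (a 1) (c 1) ∧
  ∃ (ha : (fun i => algebraMap R K (a i)) ≠ 0) (hb : (fun i => algebraMap R K (b i)) ≠ 0)
    (hc : (fun i => algebraMap R K (c i)) ≠ 0),
    blowDown P = (Projectivization.mk K _ ha, Projectivization.mk K _ hb, Projectivization.mk K _ hc)

variable (K) in
/-- The set `𝔘(R)`, as a subset of `U(K) ⊆ X(K)`. -/
def integralPoints (R : Type*) [CommRing R] [Algebra R K] : Set (Points K) :=
  {P | ∃ a b c : Fin 2 → R, IsIntegralRep P a b c}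

end Points

/-! ## The metric on `ω_X(D)` and the height -/

section Metric

variable {K : Type*} [NormedField K]

/-- The base point free set of global sections of `𝓛₁`, of degree `(2, 2, 2, -2, -2)`. -/
def sectionsL1 (z : Ray → K) : Fin 5 → K :=
  ![z .a1 ^ 2 * z .b0 ^ 2 * z .c0 ^ 2,
    z .a1 ^ 2 * z .b1 ^ 2 * z .c0 ^ 2 * z .x ^ 2,
    z .a1 ^ 2 * z .b0 ^ 2 * z .c1 ^ 2 * z .y ^ 2,
    z .a1 ^ 2 * z .b1 ^ 2 * z .c1 ^ 2 * z .x ^ 2 * z .y ^ 2,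
    z .a0 ^ 2 * z .b1 ^ 2 * z .c1 ^ 2]

/-- The base point free set of global sections of `𝓛₂`, of degree `(1, 0, 0, 0, 0)`. -/
def sectionsL2 (z : Ray → K) : Fin 2 → K := ![z .a0, z .a1 * z .x * z .y]

/-- The norm at the point with Cox coordinates `z` of the section of `ω_X(D) ≅ 𝓛₁^∨ ⊗ 𝓛₂` given
by the Laurent monomial with exponents `e` in the Cox coordinates, for `e` of the degree of
`ω_X(D)`. On each `𝓛ᵢ`, the norm of a section `s` is `min_j |s / s_j|` over the chosen set of
sections `s_j`, and `ω_X(D)` carries the induced metric. (The norm on `Fin n → K` is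
the maximum norm.) -/
def sectionNorm (e : Ray → ℤ) (z : Ray → K) : ℝ :=
  ‖∏ ρ, z ρ ^ e ρ‖ * ‖sectionsL1 z‖ / ‖sectionsL2 z‖

end Metric

/-- The exponents of the Laurent monomial `a₀ a₁⁻² b₁⁻² c₁⁻² x⁻² y⁻²` in the Cox coordinates
corresponding to the rational section `1_D ⊗ da ∧ db ∧ dc` of `ω_X(D)`, where `a = a₀ / (a₁xy)`,
`b = b₀ / (b₁x)`, `c = c₀ / (c₁y)`. The exponents are the orders of vanishing of this section: the
form `da ∧ db ∧ dc` is `abc` times `da/a ∧ db/b ∧ dc/c`, the latter has a simple pole along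
all torus-invariant divisors, and `1_D` vanishes to order one along the components of `D`. -/
def formExp (ρ : Ray) : ℤ := pair ![1, 1, 1] ρ - 1 + if ρ ∈ boundary then 1 else 0

/-- The exponents corresponding to the section `a⁻¹ · (1_D ⊗ da ∧ db ∧ dc)`, which generates
`ω_X(D)` along the part of `M` parametrized by `(b, c)`. Under the adjunction isomorphism
`ω_X(D)|_M ≅ ω_M(E₁ + E₂)`, it restricts to `1_{E₁} 1_{E₂} ⊗ db ∧ dc`. -/
def residueExp (ρ : Ray) : ℤ := formExp ρ - pair ![1, 0, 0] ρ

instance factPrime (p : Nat.Primes) : Fact (p : ℕ).Prime := ⟨p.2⟩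

/-- The log anticanonical height `∏_v ‖s(P)‖_v⁻¹`, computed (for points of the torus) using the
section `s` of `ω_X(D)^∨` dual to `1_D ⊗ da ∧ db ∧ dc`. -/
def height (P : Points ℚ) : ℝ :=
  sectionNorm formExp (fun ρ => (P.coord ρ : ℝ)) *
    ∏ᶠ p : Nat.Primes, sectionNorm formExp (fun ρ => (P.coord ρ : ℚ_[p]))

/-- The number `N(B)` of points of `𝔘(ℤ) ∩ T(ℚ)` of height at most `B`. -/
def countingFunction (B : ℝ) : ℝ :=
  ({P | P ∈ integralPoints ℚ ℤ ∧ P ∈ torus ℚ ∧ height P ≤ B} : Set (Points ℚ)).ncard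

/-! ## Tamagawa measures -/

section Padic

variable (p : ℕ) [Fact p.Prime]

instance padicMeasurableSpace : MeasurableSpace ℚ_[p] := borel _

instance padicBorelSpace : BorelSpace ℚ_[p] := ⟨rfl⟩

/-- The Haar measure on `ℚ_p` with `μ(ℤ_p) = 1`. -/
def padicHaar : Measure ℚ_[p] :=
  Measure.addHaarMeasure
    ⟨⟨Metric.closedBall 0 1, isCompact_closedBall 0 1⟩,
      ⟨0, mem_interior_iff_mem_nhds.2 (Metric.closedBall_mem_nhds 0 one_pos)⟩⟩

end Padic

section Charts

variable {K : Type*} [Field K]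

/-- The Cox coordinates `(a : 1 : b : 1 : c : 1 : 1 : 1)`. -/
def chartCoord (t : Fin 3 → K) : Ray → K
  | .a0 => t 0
  | .b0 => t 1
  | .c0 => t 2
  | _ => 1

/-- The inverse `(a, b, c) ↦ (a : 1 : b : 1 : c : 1 : 1 : 1)` of the chart
`(a₀ / (a₁xy), b₀ / (b₁x), c₀ / (c₁y))` on the complement of `V(a₁b₁c₁xy)`. -/
def chart (t : Fin 3 → K) : Points K :=
  Points.mk ⟨chartCoord t, {.a0, .b0, .c0}, by decide, by
    intro ρ hρ
    cases ρ <;> simp_all [chartCoord]⟩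

/-- The restriction of the chart to `M = {a = 0}`. -/
def chartM (t : Fin 2 → K) : Points K := chart ![0, t 0, t 1]

end Charts

/-- The Tamagawa measure `τ_{(X,D),p} = da db dc / ‖1_D ⊗ da ∧ db ∧ dc‖` on `X(ℚ_p)`. As the
complement of the chart is a null set (a proper closed subvariety), it is the image of a measure
on the chart. -/
def tamagawaMeasure (p : ℕ) [Fact p.Prime] : Measure (Points ℚ_[p]) :=
  ((Measure.pi fun _ : Fin 3 => padicHaar p).withDensity fun t =>
    (ENNReal.ofReal (sectionNorm formExp (chartCoord t)))⁻¹).map chart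

/-- The residue measure `τ_{M,∞} = c_ℝ^{#{M}} · db dc / ‖1_{E₁} 1_{E₂} ⊗ db ∧ dc‖` on `M(ℝ)`, as a
measure on `X(ℝ)`; here `c_ℝ = 2`, and the norm is the one on `ω_M(E₁ + E₂)` induced by the
metric on `ω_X(D)` through the adjunction isomorphism. -/
def residueMeasureM : Measure (Points ℝ) :=
  (2 : ℝ≥0∞) ^ faceM.card •
    ((volume : Measure (Fin 2 → ℝ)).withDensity fun t =>
      (ENNReal.ofReal (sectionNorm residueExp (chartCoord ![0, t 0, t 1])))⁻¹).map chartM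

/-! ## The Clemens complex -/

/-- The faces of the `ℝ`-analytic Clemens complex of `D`: sets `A` of components of `D` such that the
intersection `Z_A` has a real point. (On the toric variety `X`, each nonempty `Z_A` is irreducible,
so that a face is determined by `A`.) The face `A` has dimension `#A - 1`. -/
def IsFace (A : Finset Ray) : Prop := A ⊆ boundary ∧ (stratum ℝ A).Nonempty

/-- The maximal faces with respect to inclusion. -/
def IsMaximalFace (A : Finset Ray) : Prop := Maximal IsFace A

/-! ## Divisors and Picard groups -/

/-- The function field `ℚ(a, b, c)` of `X`. -/
abbrev FunField : Type := FractionRing (MvPolynomial (Fin 3) ℚ)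

/-- The character of the torus with exponents `m`, as a rational function. -/
def character (m : Fin 3 → ℤ) : FunField :=
  ∏ i, (algebraMap (MvPolynomial (Fin 3) ℚ) FunField (MvPolynomial.X i)) ^ m i

/-- The coordinate ring `ℚ[σ^∨ ∩ ℤ³]` of the affine toric chart of the cone `σ`, as a subring of the
function field. The variety `X` is glued from the charts of the cones of its fan. -/
def chartRing (σ : Finset Ray) : Subalgebra ℚ FunField :=
  Algebra.adjoin ℚ (character '' {m | ∀ ρ ∈ σ, 0 ≤ pair m ρ})

/-- A prime divisor on `X`, that is, a point of codimension one, given by the normalized discrete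
valuation of the function field whose valuation ring is the local ring of `X` at this point: the
localization of the coordinate ring of a chart at a prime ideal (the ideal of elements of
valuation less than one). -/
structure PrimeDivisor where
  /-- The valuation belonging to the prime divisor. -/
  val : Valuation FunField (WithZero (Multiplicative ℤ))
  surjective : Function.Surjective val
  exists_chart : ∃ σ ∈ fan, (∀ f ∈ chartRing σ, val f ≤ 1) ∧
    ∀ f, val f ≤ 1 → ∃ g ∈ chartRing σ, ∃ h ∈ chartRing σ, val h = 1 ∧ f * h = g

namespace PrimeDivisor

/-- The order of vanishing of a rational function along a prime divisor. -/
def ord (P : PrimeDivisor) (f : FunField) : ℤ := - WithZero.log (P.val f)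

theorem ord_mul (P : PrimeDivisor) {f g : FunField} (hf : f ≠ 0) (hg : g ≠ 0) :
    P.ord (f * g) = P.ord f + P.ord g := by
  have hf' := (Valuation.ne_zero_iff P.val).2 hf
  have hg' := (Valuation.ne_zero_iff P.val).2 hg
  rw [ord, ord, ord, map_mul, WithZero.log_mul hf' hg']
  ring

theorem ord_one (P : PrimeDivisor) : P.ord 1 = 0 := by simp [ord]

theorem ord_inv (P : PrimeDivisor) (f : FunField) : P.ord f⁻¹ = - P.ord f := by
  rw [ord, ord, map_inv₀, WithZero.log_inv]

/-- `P` is the torus-invariant prime divisor belonging to the ray `ρ`. -/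
def IsToric (P : PrimeDivisor) (ρ : Ray) : Prop := ∀ m, P.ord (character m) = pair m ρ

/-- `P` is a component of the divisor with components `S`. -/
def IsComponent (P : PrimeDivisor) (S : Finset Ray) : Prop := ∃ ρ ∈ S, P.IsToric ρ

end PrimeDivisor

/-- The group of divisors on `X ∖ ⋃_{ρ ∈ S} D_ρ`, where `D_ρ` is the torus-invariant prime
divisor of the ray `ρ`. -/
abbrev Divisors (S : Finset Ray) : Type := {P : PrimeDivisor // ¬ P.IsComponent S} →₀ ℤ

/-- The restriction of divisors from `X`. -/
def restrict (S : Finset Ray) (L : PrimeDivisor →₀ ℤ) : Divisors S :=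
  L.subtypeDomain fun P => ¬ P.IsComponent S

/-- The group of principal divisors on `X ∖ ⋃_{ρ ∈ S} D_ρ`. -/
def principalDivisors (S : Finset Ray) : AddSubgroup (Divisors S) where
  carrier := {L | ∃ f : FunField, f ≠ 0 ∧ ∀ P, L P = P.1.ord f}
  zero_mem' := ⟨1, one_ne_zero, fun P => by simp [P.1.ord_one]⟩
  add_mem' := by
    rintro L L' ⟨f, hf, h⟩ ⟨g, hg, h'⟩
    exact ⟨f * g, mul_ne_zero hf hg, fun P => by simp [h, h', P.1.ord_mul hf hg]⟩
  neg_mem' := by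
    rintro L ⟨f, hf, h⟩
    exact ⟨f⁻¹, inv_ne_zero hf, fun P => by simp [h, P.1.ord_inv]⟩

/-- The Picard group (group of divisor classes) of the smooth variety `X ∖ ⋃_{ρ ∈ S} D_ρ`. -/
abbrev Pic (S : Finset Ray) : Type := Divisors S ⧸ principalDivisors S

/-- The ring of regular functions on `X ∖ ⋃_{ρ ∈ S} D_ρ`; this open subvariety is covered by
the charts of the cones `σ ∖ S`. -/
def regularFunctions (S : Finset Ray) : Subalgebra ℚ FunField := ⨅ σ ∈ fan, chartRing (σ \ S)

/-- The group of invertible regular functions on `X ∖ ⋃_{ρ ∈ S} D_ρ`. -/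
def invertibleFunctions (S : Finset Ray) : Subgroup FunFieldˣ :=
  Units.map (regularFunctions S).val.toMonoidHom |>.range

/-- The nonzero constants, as a subgroup of the invertible regular functions. -/
def constants (S : Finset Ray) : Subgroup (invertibleFunctions S) :=
  ((Units.map (algebraMap ℚ FunField).toMonoidHom).range).subgroupOf (invertibleFunctions S)

/-- The group `E` of invertible regular functions on `X ∖ ⋃_{ρ ∈ S} D_ρ` modulo constants. -/
def E (S : Finset Ray) : Type := Additive (invertibleFunctions S ⧸ constants S)

instance (S : Finset Ray) : AddCommGroup (E S) :=
  inferInstanceAs (AddCommGroup (Additive (invertibleFunctions S ⧸ constants S)))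

/-- The group `Pic(U; A)` of `A`-divisor classes. The group `Div(U) ⊕ ℤ^A` of `A`-divisors is the
free group on the prime divisors of `X` which are not components of `Δ_A = D - D_A`, that is,
the group of divisors on `U_A = X ∖ Δ_A`. -/
abbrev PicA (A : Finset Ray) : Type := Pic (boundary \ A)

/-- The number `b_A = rk Pic(U) - rk E(U) + #A`. -/
def bInv (A : Finset Ray) : ℤ :=
  (Module.finrank ℤ (Pic boundary) : ℤ) - Module.finrank ℤ (E boundary) + A.card

/-- The number `b'_A = rk Pic(U; A)`. -/
def bInv' (A : Finset Ray) : ℕ := Module.finrank ℤ (PicA A)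

/-! ## The constant `α` -/

/-- The stalk of `ω_X` at the prime divisor `P`, as a submodule over the local ring of the space of
rational top forms: it is spanned by the `df₀ ∧ df₁ ∧ df₂` for `f₀, f₁, f₂` in the local ring. -/
def canonicalStalk (P : PrimeDivisor) : Submodule P.val.integer (⋀[FunField]^3 Ω[FunField⁄ℚ]) :=
  Submodule.span P.val.integer
    {w | ∃ f : Fin 3 → P.val.integer,
      w = exteriorPower.ιMulti FunField 3
        fun i => KaehlerDifferential.D ℚ FunField (f i : FunField)}

open Classical in
/-- `L = div(ω) + D` for a nonzero rational top form `ω`, so `L` is a divisor of the class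
of `ω_X(D)`. -/
def IsLogCanonicalDivisor (L : PrimeDivisor →₀ ℤ) : Prop :=
  ∃ ω : ⋀[FunField]^3 Ω[FunField⁄ℚ], ω ≠ 0 ∧ ∀ (P : PrimeDivisor) (f : FunField), f ≠ 0 →
    (f • ω ∈ canonicalStalk P ↔ 0 ≤ P.ord f + L P - if P.IsComponent boundary then 1 else 0)

/-- The image `π_A(ω_X(D)^∨)` of the log anticanonical class in `Pic(U; A)`. -/
def logAnticanonicalClass (A : Finset Ray) : PicA A :=
  QuotientAddGroup.mk (- restrict (boundary \ A) (Classical.epsilon IsLogCanonicalDivisor))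

/-- The effective cone `Eff_A ⊆ Pic(U; A)_ℝ`, generated by the classes of effective
`A`-divisors. -/
def effectiveCone (A : Finset Ray) : PointedCone ℝ (ℝ ⊗[ℤ] PicA A) :=
  PointedCone.hull ℝ {v | ∃ L : Divisors (boundary \ A), 0 ≤ L ∧
    v = (1 : ℝ) ⊗ₜ[ℤ] (QuotientAddGroup.mk L : PicA A)}

section Characteristic

variable {Λ : Type*} [AddCommGroup Λ] {n : ℕ}

/-- The linear form on `Λ_ℝ` with value `s i` on the `i`-th vector of a `ℤ`-basis of `Λ`. -/
def linearForm (B : Module.Basis (Fin n) ℤ Λ) (s : Fin n → ℝ) : (ℝ ⊗[ℤ] Λ) →ₗ[ℝ] ℝ :=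
  (Algebra.TensorProduct.basis ℝ B).constr ℝ s

/-- The characteristic function `x ↦ ∫_{C^∨} e^{-⟨x, t⟩} dt` of a cone `C` in `Λ_ℝ`, where the
Haar measure on the dual space is normalized such that `Λ^∨` has covolume one, that is, it is the
Lebesgue measure in the coordinates with respect to any `ℤ`-basis of `Λ`. -/
def characteristicFunction (B : Module.Basis (Fin n) ℤ Λ) (C : Set (ℝ ⊗[ℤ] Λ)) (x : ℝ ⊗[ℤ] Λ) :
    ℝ≥0∞ :=
  ∫⁻ s in {s : Fin n → ℝ | ∀ v ∈ C, 0 ≤ linearForm B s v},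
    ENNReal.ofReal (Real.exp (- linearForm B s x))

end Characteristic

open Classical in
/-- The constant `α_A = X_{Eff_A}(π_A(ω_X(D)^∨)) / (b'_A - 1)!`, defined if `Pic(U; A)` is torsion
free, that is, a lattice (and set to zero otherwise). -/
def alpha (A : Finset Ray) : ℝ :=
  if h : Nonempty (Module.Basis (Fin (bInv' A)) ℤ (PicA A)) then
    1 / ((bInv' A - 1).factorial : ℝ) *
      (characteristicFunction h.some (effectiveCone A : Set (ℝ ⊗[ℤ] PicA A))
        ((1 : ℝ) ⊗ₜ[ℤ] logAnticanonicalClass A)).toReal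
  else 0

/-! ## The constants of the asymptotic formula -/

/-- `c_∞ = α_M τ_{M,∞}(M(ℝ))`. -/
def cInfinity : ℝ := alpha faceM * (residueMeasureM (stratum ℝ faceM)).toReal

/-- The local factor `(1 - 1/p)^{rk Pic U} τ_{U,p}(𝔘(ℤ_p))` of `c_fin`. -/
def localFactor (p : Nat.Primes) : ℝ :=
  (1 - 1 / ((p : ℕ) : ℝ)) ^ Module.finrank ℤ (Pic boundary) *
    (tamagawaMeasure p (integralPoints ℚ_[p] ℤ_[p])).toReal

/-- `c_fin`, the product of the local factors over all primes. -/
def cFin : ℝ := ∏' p : Nat.Primes, localFactor p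

/-- The local factor `(1 - 1/p)² (1 + 2/p - 1/p² - 1/p³)` of the explicit constant. -/
def explicitFactor (p : Nat.Primes) : ℝ :=
  (1 - 1 / ((p : ℕ) : ℝ)) ^ 2 *
    (1 + 2 / ((p : ℕ) : ℝ) - 1 / ((p : ℕ) : ℝ) ^ 2 - 1 / ((p : ℕ) : ℝ) ^ 3)

/-- The explicit constant `c = 4 ∏_p (1 - 1/p)² (1 + 2/p - 1/p² - 1/p³)`. -/
def cExplicit : ℝ := 4 * ∏' p : Nat.Primes, explicitFactor p

end ToricThreefold

end

open ToricThreefold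

/-!
The theorem has an algebraic, a measure-theoretic and an analytic part, linked by the explicit
constant `c`.

**Picard groups.** The charts of the fan of `X` are given by unimodular cones, so that their
coordinate rings are polynomial rings, in particular unique
factorization domains. Hence every prime divisor of `X` is either one of the eight toric divisors or
the valuation belonging to a prime polynomial whose zero set meets the torus. Giving a
nontoric prime divisor the degree which makes principal divisors have degree zero, every grading of the
rays whose kernel is the group of characters identifies a Picard group with `ℤⁿ`
(`IsGrading.picEquiv`). For `U` this gives rank two, and rank three for the complement of
`E₁ + E₂`. The invertible functions on `U` are constant, so `b_M = 3` (`bInv_faceM`).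
The effective cone of the complement of `E₁ + E₂` is the positive octant, as nontoric effective divisors
have nonnegative degrees. The log anticanonical class is `(1, 2, 2)`, computed from the divisor of
`da ∧ db ∧ dc` by means of the description of the stalks of `ω_X` by local coordinates. Therefore
`α_M = 1/2! · 1/(1 · 2 · 2) = 1/8` (`alpha_faceM`).

**Local densities.** The norm of `1_D ⊗ da ∧ db ∧ dc` is an explicit function of the
coordinates `(a, b, c)` (`sectionNorm_formExp`). The `p`-adic integral points consist of the points with
`|a| = 1` and those with `|a| > 1` and `|b|, |c| ≤ 1`; on both pieces the density is a product
of functions in one variable (`indicator_density_eq`), so that the volume is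
`(1 - 1/p)(1 + 1/p)² + 1/p`. Similarly, the residue measure of `M(ℝ)` is `2 · 4²`.

**Counting.** Integral points of the torus correspond to tuples `(a, b₀, b₁, c₀, c₁)` of positive
integers with coprimality conditions and to three signs (`countingFunction_eq`). For fixed `a`, Möbius
inversion counts the pairs `(b₀, b₁)` up to `z` with density `κ_a` and an error
`O(h(a) z^{3/2})`, where `h(a) = ∑_{d ∣ a} d^{-1/2}` (`exists_abs_pairCount_sub_le`); the error is
uniform since `|⌊z⌋ - z| ≤ √z` for all `z ≥ 0`, so that no truncation of the Möbius sum is needed.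
Summation by parts over the maximum of one of the pairs gives `2 κ_a² x² log x + O(h(a) x²)` for the number
of pairs of pairs (`exists_abs_quadCount_sub_le`). Finally, `κ_a²` is a constant times
`∏_{p ∣ a} (1 + 1/p)⁻²`, the convolution of `1` with a function which is small on average, so
that a second summation by parts over `a` yields `N(B) = c B (log B)² + O(B log B)`, an error even smaller
than required. The leading coefficient is a product of values of Dirichlet series, and its Euler
product has the local factors `explicitFactor p` (`hasProd_explicitFactor`).
-/

namespace ToricThreefold

/-! ### Valuations of prime elements -/

section AdicValuation

variable (R : Type*) {K : Type*} [CommRing R] [IsDomain R] [Field K] [Algebra R K]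

/-- `v` is the normalized valuation of `K` attached to the prime element `q` of `R`. -/
structure IsAdic (v : Valuation K (WithZero (Multiplicative ℤ))) (q : R) : Prop where
  prime : Prime q
  map_self : v (algebraMap R K q) = WithZero.exp (-1)
  map_of_not_dvd : ∀ r, ¬ q ∣ r → v (algebraMap R K r) = 1

variable {R}

namespace IsAdic

variable {v w : Valuation K (WithZero (Multiplicative ℤ))} {q : R}

theorem exists_map_eq [WfDvdMonoid R] (h : IsAdic R v q) {r : R} (hr : r ≠ 0) :
    ∃ (n : ℕ) (s : R), ¬ q ∣ s ∧ r = q ^ n * s ∧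
      v (algebraMap R K r) = WithZero.exp (-(n : ℤ)) := by
  obtain ⟨n, s, hs, rfl⟩ := WfDvdMonoid.max_power_factor hr h.prime.irreducible
  refine ⟨n, s, hs, rfl, ?_⟩
  rw [map_mul, map_mul, map_pow, map_pow, h.map_self, h.map_of_not_dvd s hs, mul_one,
    ← WithZero.exp_nsmul]
  simp

theorem map_le_one [WfDvdMonoid R] (h : IsAdic R v q) (r : R) : v (algebraMap R K r) ≤ 1 := by
  rcases eq_or_ne r 0 with rfl | hr
  · simp
  obtain ⟨n, s, -, -, hv⟩ := h.exists_map_eq hr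
  rw [hv, ← WithZero.exp_zero, WithZero.exp_le_exp]
  simp

theorem map_eq_one_iff [WfDvdMonoid R] (h : IsAdic R v q) {r : R} :
    v (algebraMap R K r) = 1 ↔ ¬ q ∣ r := by
  refine ⟨?_, h.map_of_not_dvd r⟩
  rintro hv ⟨s, rfl⟩
  rw [map_mul, map_mul, h.map_self] at hv
  have := h.map_le_one s
  have h1 : WithZero.exp (-1 : ℤ) * v (algebraMap R K s) ≤ WithZero.exp (-1 : ℤ) * 1 := by gcongr
  rw [hv, mul_one, ← WithZero.exp_zero, WithZero.exp_le_exp] at h1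
  omega

/-- Valuations attached to prime elements dividing each other agree. -/
theorem eq_of_dvd [WfDvdMonoid R] [IsFractionRing R K] {q' : R} (h : IsAdic R v q)
    (h' : IsAdic R w q') (hq : q ∣ q') : v = w := by
  have hass : Associated q q' := h.prime.associated_of_dvd h'.prime hq
  have key : ∀ r : R, v (algebraMap R K r) = w (algebraMap R K r) := by
    intro r
    rcases eq_or_ne r 0 with rfl | hr
    · simp
    obtain ⟨n, s, hs, rfl, hv⟩ := h.exists_map_eq hr
    have hs' : ¬ q' ∣ s := fun hd => hs (hq.trans hd)
    obtain ⟨c, rfl⟩ := hass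
    have hc : ¬ q * c ∣ (c⁻¹ : Rˣ) := fun hd =>
      h'.prime.not_isUnit (isUnit_of_dvd_unit hd (Units.isUnit _))
    have hqc : q = (q * c) * (c⁻¹ : Rˣ) := by simp
    rw [hv, map_mul, map_pow, hqc, map_mul, map_mul, map_pow, map_mul,
      h'.map_self, h'.map_of_not_dvd s hs', h'.map_of_not_dvd _ hc, mul_one, mul_one,
      ← WithZero.exp_nsmul]
    simp
  ext f
  obtain ⟨a, b, hb, rfl⟩ := IsFractionRing.div_surjective (A := R) f
  rw [map_div₀, map_div₀, key, key]

/-- The valuation ring of `v` is the localization of `R` at the ideal generated by `q`. -/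
theorem exists_of_le_one [UniqueFactorizationMonoid R] [IsFractionRing R K] (h : IsAdic R v q)
    {f : K} (hf : v f ≤ 1) :
    ∃ a b : R, v (algebraMap R K b) = 1 ∧ f * algebraMap R K b = algebraMap R K a := by
  obtain ⟨a, b, hb, rfl⟩ := IsFractionRing.div_surjective (A := R) f
  have hb0 : b ≠ 0 := nonZeroDivisors.ne_zero hb
  rcases eq_or_ne a 0 with rfl | ha
  · exact ⟨0, 1, by simp, by simp⟩
  obtain ⟨n, s, hs, rfl, hv⟩ := h.exists_map_eq ha
  obtain ⟨m, t, ht, rfl, hv'⟩ := h.exists_map_eq hb0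
  rw [map_div₀, hv, hv', ← WithZero.exp_sub, ← WithZero.exp_zero, WithZero.exp_le_exp] at hf
  have hmn : m ≤ n := by omega
  obtain ⟨k, rfl⟩ := Nat.exists_eq_add_of_le hmn
  refine ⟨q ^ k * s, t, h.map_of_not_dvd t ht, ?_⟩
  have hi : Function.Injective (algebraMap R K) := IsFractionRing.injective R K
  have hq0 : algebraMap R K q ≠ 0 := by
    rw [Ne, map_eq_zero_iff _ hi]
    exact h.prime.ne_zero
  have ht0 : algebraMap R K t ≠ 0 := by
    rw [Ne, map_eq_zero_iff _ hi]
    rintro rfl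
    exact ht (dvd_zero q)
  simp only [map_mul, map_pow, pow_add]
  field_simp

theorem surjective (h : IsAdic R v q) : Function.Surjective v := by
  intro g
  induction g using WithZero.expRecOn with
  | zero => exact ⟨0, map_zero v⟩
  | exp n =>
    refine ⟨algebraMap R K q ^ (-n), ?_⟩
    rw [map_zpow₀, h.map_self, ← WithZero.exp_zsmul]
    simp

end IsAdic

/-- A normalized discrete valuation whose valuation ring is a localization of a factorial ring
at a prime ideal belongs to a prime element: this prime ideal has height one. -/
theorem exists_isAdic_of_isLocalization [UniqueFactorizationMonoid R] [IsFractionRing R K]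
    {v : Valuation K (WithZero (Multiplicative ℤ))} (hv : Function.Surjective v)
    (hR : ∀ r : R, v (algebraMap R K r) ≤ 1)
    (hloc : ∀ f, v f ≤ 1 → ∃ a b : R, v (algebraMap R K b) = 1 ∧
      f * algebraMap R K b = algebraMap R K a) :
    ∃ q : R, IsAdic R v q := by
  have hi : Function.Injective (algebraMap R K) := IsFractionRing.injective R K
  -- the elements of positive order form a nonzero prime ideal, which contains a prime element `q`
  obtain ⟨f₀, hf₀⟩ := hv (WithZero.exp (-1))
  obtain ⟨a₀, b₀, hb₀, hab⟩ := hloc f₀ (by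
    rw [hf₀, ← WithZero.exp_zero, WithZero.exp_le_exp]; omega)
  have ha₀ : v (algebraMap R K a₀) = WithZero.exp (-1) := by
    rw [← hab, map_mul, hf₀, hb₀, mul_one]
  have ha₀0 : a₀ ≠ 0 := by
    rintro rfl
    rw [map_zero, map_zero] at ha₀
    exact WithZero.exp_ne_zero ha₀.symm
  have hlt : v (algebraMap R K a₀) < 1 := by
    rw [ha₀, ← WithZero.exp_zero, WithZero.exp_lt_exp]; omega
  have hq : ∃ q : R, Prime q ∧ v (algebraMap R K q) < 1 := by
    by_contra! hcon
    have hall : ∀ a : R, a ≠ 0 → v (algebraMap R K a) = 1 := by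
      intro a
      induction a using UniqueFactorizationMonoid.induction_on_prime with
      | h₁ => simp
      | h₂ u hu =>
        intro _
        obtain ⟨u, rfl⟩ := hu
        have h1 := hR u
        have h2 := hR (u⁻¹ : Rˣ)
        have h3 : v (algebraMap R K u) * v (algebraMap R K (u⁻¹ : Rˣ)) = 1 := by
          rw [← map_mul, ← map_mul]; simp
        refine le_antisymm h1 ?_
        calc 1 = v (algebraMap R K u) * v (algebraMap R K (u⁻¹ : Rˣ)) := h3.symm
          _ ≤ v (algebraMap R K u) * 1 := by gcongr
          _ = _ := mul_one _
      | h₃ a q ha hq ih =>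
        intro _
        rw [map_mul, map_mul, ih ha, mul_one]
        exact le_antisymm (hR q) (hcon q hq)
    exact hlt.ne (hall a₀ ha₀0)
  obtain ⟨q, hqp, hqv⟩ := hq
  have hexp : ∀ r : R, r ≠ 0 → v (algebraMap R K r) < 1 →
      ∃ k : ℕ, 0 < k ∧ v (algebraMap R K r) = WithZero.exp (-(k : ℤ)) := by
    intro r hr hrv
    have hne : v (algebraMap R K r) ≠ 0 := by
      rw [Valuation.ne_zero_iff, Ne, map_eq_zero_iff _ hi]
      exact hr
    have hl : v (algebraMap R K r) = WithZero.exp (WithZero.log (v (algebraMap R K r))) :=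
      (WithZero.exp_log hne).symm
    rw [hl, ← WithZero.exp_zero, WithZero.exp_lt_exp] at hrv
    refine ⟨(-WithZero.log (v (algebraMap R K r))).toNat, by omega, ?_⟩
    conv_lhs => rw [hl]
    congr 1
    omega
  have hdvd : ∀ r : R, ¬ q ∣ r → v (algebraMap R K r) = 1 := by
    intro r hr
    by_contra hne
    have hrv : v (algebraMap R K r) < 1 := lt_of_le_of_ne (hR r) hne
    have hr0 : r ≠ 0 := by rintro rfl; exact hr (dvd_zero q)
    obtain ⟨k, hk, hkv⟩ := hexp r hr0 hrv
    obtain ⟨j, hj, hjv⟩ := hexp q hqp.ne_zero hqv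
    have hr0' : algebraMap R K r ≠ 0 := by rwa [Ne, map_eq_zero_iff _ hi]
    -- `q ^ k / r ^ j` is a unit of the valuation ring
    have hone : v (algebraMap R K q ^ k / algebraMap R K r ^ j) = 1 := by
      rw [map_div₀, map_pow, map_pow, hkv, hjv, ← WithZero.exp_nsmul, ← WithZero.exp_nsmul,
        ← WithZero.exp_sub, ← WithZero.exp_zero]
      congr 1
      simp only [nsmul_eq_mul]
      ring
    obtain ⟨a, b, hb, hab⟩ := hloc _ hone.le
    have ha : v (algebraMap R K a) = 1 := by rw [← hab, map_mul, hone, hb, one_mul]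
    have heq : q ^ k * b = r ^ j * a := by
      apply hi
      rw [map_mul, map_mul, map_pow, map_pow, ← hab]
      field_simp
    have h1 : q ∣ r ^ j * a := heq ▸ (dvd_pow_self q hk.ne').mul_right b
    rcases hqp.dvd_or_dvd h1 with h1 | ⟨c, rfl⟩
    · exact hr (hqp.dvd_of_dvd_pow h1)
    · rw [map_mul, map_mul] at ha
      have : v (algebraMap R K q) * v (algebraMap R K c) ≤ v (algebraMap R K q) * 1 := by
        gcongr; exact hR c
      rw [ha, mul_one] at this
      exact absurd hqv (not_lt.2 this)
  refine ⟨q, hqp, ?_, hdvd⟩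
  obtain ⟨n, s, hs, rfl⟩ := WfDvdMonoid.max_power_factor ha₀0 hqp.irreducible
  obtain ⟨j, hj, hjv⟩ := hexp q hqp.ne_zero hqv
  rw [map_mul, map_mul, map_pow, map_pow, hdvd s hs, mul_one, hjv, ← WithZero.exp_nsmul,
    WithZero.exp_inj, nsmul_eq_mul] at ha₀
  have h2 : n * j = 1 := by
    zify
    linarith
  rw [hjv, Nat.eq_one_of_mul_eq_one_left h2]
  simp

/-- Every prime element of a factorial Noetherian ring has a valuation. -/
theorem exists_isAdic [IsNoetherianRing R] [IsFractionRing R K] {q : R} (hq : Prime q) :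
    ∃ v : Valuation K (WithZero (Multiplicative ℤ)), IsAdic R v q := by
  let I : Ideal R := Ideal.span {q}
  have hI : I.IsPrime := (Ideal.span_singleton_prime hq.ne_zero).2 hq
  let A := Localization.subalgebra.ofField K I.primeCompl I.primeCompl_le_nonZeroDivisors
  have hA : IsLocalization.AtPrime A I :=
    Localization.subalgebra.isLocalization_ofField K I.primeCompl I.primeCompl_le_nonZeroDivisors
  have : IsLocalRing A := IsLocalization.AtPrime.isLocalRing A I
  have : IsNoetherianRing A := IsLocalization.isNoetherianRing I.primeCompl A inferInstance
  have hmax : IsLocalRing.maximalIdeal A = Ideal.span {algebraMap R A q} := by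
    rw [← IsLocalization.AtPrime.map_eq_maximalIdeal I A, Ideal.map_span, Set.image_singleton]
  have hinj : Function.Injective (algebraMap R A) :=
    IsLocalization.injective A I.primeCompl_le_nonZeroDivisors
  have hfield : ¬ IsField A := by
    rw [IsLocalRing.isField_iff_maximalIdeal_eq, hmax, Ideal.span_singleton_eq_bot,
      map_eq_zero_iff _ hinj]
    exact hq.ne_zero
  have : IsDiscreteValuationRing A :=
    ((IsDiscreteValuationRing.TFAE A hfield).out 0 4 rfl rfl).2 ⟨_, hmax⟩
  have : IsFractionRing A K :=
    Localization.subalgebra.isFractionRing_ofField K I.primeCompl I.primeCompl_le_nonZeroDivisors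
  let w := IsDiscreteValuationRing.maximalIdeal A
  have htower : ∀ r : R, algebraMap R K r = algebraMap A K (algebraMap R A r) := fun r =>
    IsScalarTower.algebraMap_apply R A K r
  refine ⟨w.valuation K, hq, ?_, fun r hr => ?_⟩
  · rw [htower, w.valuation_of_algebraMap]
    refine w.intValuation_singleton ?_ hmax
    rw [Ne, map_eq_zero_iff _ hinj]
    exact hq.ne_zero
  · rw [htower, w.valuation_of_algebraMap, w.intValuation_eq_one_iff]
    intro hmem
    have : algebraMap R A r ∈ IsLocalRing.maximalIdeal A := hmem
    rw [IsLocalization.AtPrime.to_map_mem_maximal_iff A I, Ideal.mem_span_singleton] at this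
    exact hr this

end AdicValuation

/-! ### Characters and affine charts -/

theorem pair_eq (m : Fin 3 → ℤ) (ρ : Ray) :
    pair m ρ = m 0 * gen ρ 0 + m 1 * gen ρ 1 + m 2 * gen ρ 2 := by
  rw [pair, Fin.sum_univ_three]

theorem pair_add (m n : Fin 3 → ℤ) (ρ : Ray) : pair (m + n) ρ = pair m ρ + pair n ρ := by
  simp only [pair_eq, Pi.add_apply]; ring

theorem pair_neg (m : Fin 3 → ℤ) (ρ : Ray) : pair (-m) ρ = - pair m ρ := by
  simp only [pair_eq, Pi.neg_apply]; ring

theorem pair_zero (ρ : Ray) : pair 0 ρ = 0 := by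
  simp [pair_eq]

theorem pair_sum_smul {ι : Type*} (s : Finset ι) (k : ι → ℤ) (m : ι → Fin 3 → ℤ) (ρ : Ray) :
    pair (∑ i ∈ s, k i • m i) ρ = ∑ i ∈ s, k i * pair (m i) ρ := by
  simp only [pair, Finset.sum_apply, Pi.smul_apply, smul_eq_mul, Finset.sum_mul, Finset.mul_sum]
  rw [Finset.sum_comm]
  simp only [mul_assoc]

/-- A ray is determined by the orders of the characters along it. -/
theorem ray_ext : ∀ {ρ ρ' : Ray}, (∀ m, pair m ρ = pair m ρ') → ρ = ρ' := by
  intro ρ ρ' h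
  have h0 := h ![1, 0, 0]
  have h1 := h ![0, 1, 0]
  have h2 := h ![0, 0, 1]
  clear h
  cases ρ <;> cases ρ' <;> first | rfl | (exfalso; revert h0 h1 h2; decide)

theorem X_ne_zero (i : Fin 3) :
    (algebraMap (MvPolynomial (Fin 3) ℚ) FunField (MvPolynomial.X i)) ≠ 0 := by
  rw [Ne, map_eq_zero_iff _ (IsFractionRing.injective _ _)]
  exact MvPolynomial.X_ne_zero i

theorem character_ne_zero (m : Fin 3 → ℤ) : character m ≠ 0 :=
  Finset.prod_ne_zero_iff.2 fun i _ => zpow_ne_zero _ (X_ne_zero i)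

theorem character_zero : character 0 = 1 := by simp [character]

theorem character_add (m n : Fin 3 → ℤ) : character (m + n) = character m * character n := by
  simp only [character, Pi.add_apply, zpow_add₀ (X_ne_zero _), Finset.prod_mul_distrib]

theorem character_neg (m : Fin 3 → ℤ) : character (-m) = (character m)⁻¹ := by
  simp only [character, Pi.neg_apply, zpow_neg, Finset.prod_inv_distrib]

theorem character_zsmul (k : ℤ) (m : Fin 3 → ℤ) : character (k • m) = character m ^ k := by
  simp only [character, Pi.smul_apply, smul_eq_mul, ← Finset.prod_zpow]
  refine Finset.prod_congr rfl fun i _ => ?_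
  rw [mul_comm, zpow_mul]

theorem character_sum_smul {ι : Type*} (s : Finset ι) (k : ι → ℤ) (m : ι → Fin 3 → ℤ) :
    character (∑ i ∈ s, k i • m i) = ∏ i ∈ s, character (m i) ^ k i := by
  classical
  induction s using Finset.induction_on with
  | empty => simp [character_zero]
  | insert a s ha ih => rw [Finset.sum_insert ha, Finset.prod_insert ha, character_add, ih,
      character_zsmul]

theorem character_single (i : Fin 3) :
    character (Pi.single i 1) = algebraMap (MvPolynomial (Fin 3) ℚ) FunField (MvPolynomial.X i) := by
  rw [character, Finset.prod_eq_single i]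
  · simp
  · intro j _ hj
    simp [Pi.single_eq_of_ne hj]
  · simp

theorem character_eq_monomial {m : Fin 3 → ℤ} (hm : 0 ≤ m) :
    character m = algebraMap (MvPolynomial (Fin 3) ℚ) FunField
      (MvPolynomial.monomial (Finsupp.equivFunOnFinite.symm fun i => (m i).toNat) 1) := by
  rw [MvPolynomial.monomial_eq, character, Finsupp.prod_fintype _ _ (by simp)]
  simp only [map_one, one_mul, map_prod, map_pow]
  refine Finset.prod_congr rfl fun i _ => ?_
  rw [← zpow_natCast]
  simp [Int.toNat_of_nonneg (hm i)]

/-- Distinct characters are linearly independent. -/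
theorem eq_zero_of_sum_character {ι : Type*} {f : ι → Fin 3 → ℤ} (hf : Function.Injective f)
    (s : Finset ι) (c : ι → ℚ)
    (hsum : ∑ m ∈ s, algebraMap ℚ FunField (c m) * character (f m) = 0) {n : ι} (hn : n ∈ s) :
    c n = 0 := by
  -- multiply by a monomial to clear denominators
  let N : Fin 3 → ℤ := fun i => ∑ m ∈ s, |f m i|
  have hN : ∀ m ∈ s, 0 ≤ f m + N := by
    intro m hm i
    have h1 : |f m i| ≤ N i := Finset.single_le_sum (f := fun m => |f m i|)
      (fun _ _ => abs_nonneg _) hm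
    have h2 := neg_abs_le (f m i)
    simp only [Pi.zero_apply, Pi.add_apply]
    linarith
  let E : ι → (Fin 3 →₀ ℕ) := fun m =>
    Finsupp.equivFunOnFinite.symm fun i => ((f m + N) i).toNat
  have hzero : (∑ m ∈ s, MvPolynomial.monomial (E m) (c m)) = 0 := by
    apply IsFractionRing.injective (MvPolynomial (Fin 3) ℚ) FunField
    rw [map_zero, map_sum, ← zero_mul (character N), ← hsum, Finset.sum_mul]
    refine Finset.sum_congr rfl fun m hm => ?_
    rw [mul_assoc, ← character_add, character_eq_monomial (hN m hm),
      IsScalarTower.algebraMap_apply ℚ (MvPolynomial (Fin 3) ℚ) FunField,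
      ← map_mul, MvPolynomial.algebraMap_eq, MvPolynomial.C_mul_monomial, mul_one]
  have := congrArg (MvPolynomial.coeff (E n)) hzero
  rw [MvPolynomial.coeff_sum, MvPolynomial.coeff_zero, Finset.sum_eq_single n] at this
  · simpa using this
  · intro m hm hmn
    rw [MvPolynomial.coeff_monomial, if_neg]
    intro hE
    apply hmn
    apply hf
    funext i
    have := DFunLike.congr_fun hE i
    have h1 := hN m hm i
    have h2 := hN n hn i
    simp only [E, Finsupp.equivFunOnFinite_symm_apply_apply, Pi.add_apply, Pi.zero_apply]
      at this h1 h2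
    omega
  · exact fun h => absurd hn h

/-- A smooth three-dimensional cone, given by its three rays `e` together with the dual basis `m` of
the character lattice. -/
structure Frame where
  /-- the rays of the cone -/
  e : Fin 3 → Ray
  /-- the dual basis of the character lattice -/
  m : Fin 3 → Fin 3 → ℤ
  dual : ∀ i j, pair (m i) (e j) = if i = j then 1 else 0

namespace Frame

/-- The set of rays of the cone. -/
def cone (F : Frame) : Finset Ray := Finset.univ.image F.e

variable (F : Frame)

theorem e_mem (i : Fin 3) : F.e i ∈ F.cone := Finset.mem_image_of_mem _ (Finset.mem_univ i)

theorem mem_cone {ρ : Ray} : ρ ∈ F.cone ↔ ∃ i, F.e i = ρ := by simp [cone]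

theorem mul_eq_one : Matrix.of F.m * (Matrix.of fun i j => gen (F.e j) i) = 1 := by
  ext i j
  rw [Matrix.mul_apply, Matrix.one_apply, ← F.dual i j]
  rfl

theorem eq_sum (n : Fin 3 → ℤ) : n = ∑ i, pair n (F.e i) • F.m i := by
  have h := mul_eq_one_comm.1 F.mul_eq_one
  have h2 : Matrix.vecMul n ((Matrix.of fun i j => gen (F.e j) i) * Matrix.of F.m) = n := by
    rw [h, Matrix.vecMul_one]
  rw [← Matrix.vecMul_vecMul] at h2
  conv_lhs => rw [← h2]
  ext k
  rw [Matrix.vecMul, dotProduct, Finset.sum_apply]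
  rfl

/-- The coordinate functions of the affine chart of the cone. -/
noncomputable def coord (i : Fin 3) : FunField := character (F.m i)

theorem character_eq_prod (n : Fin 3 → ℤ) :
    character n = ∏ i, F.coord i ^ pair n (F.e i) := by
  conv_lhs => rw [F.eq_sum n]
  exact character_sum_smul _ _ _

theorem character_mem_chartRing {σ : Finset Ray} {n : Fin 3 → ℤ} (hn : ∀ ρ ∈ σ, 0 ≤ pair n ρ) :
    character n ∈ chartRing σ := Algebra.subset_adjoin ⟨n, hn, rfl⟩

theorem pair_m_nonneg (i : Fin 3) : ∀ ρ ∈ F.cone, 0 ≤ pair (F.m i) ρ := by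
  intro ρ hρ
  obtain ⟨j, rfl⟩ := F.mem_cone.1 hρ
  rw [F.dual]
  split_ifs <;> simp

theorem coord_mem (i : Fin 3) : F.coord i ∈ chartRing F.cone :=
  character_mem_chartRing (F.pair_m_nonneg i)

/-- The parametrization of the coordinate ring of the chart by polynomials. -/
noncomputable def param : MvPolynomial (Fin 3) ℚ →ₐ[ℚ] FunField := MvPolynomial.aeval F.coord

theorem param_X (i : Fin 3) : F.param (MvPolynomial.X i) = F.coord i := MvPolynomial.aeval_X _ _

theorem range_param : F.param.range = chartRing F.cone := by
  rw [param, ← Algebra.adjoin_range_eq_range_aeval]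
  apply le_antisymm
  · rw [Algebra.adjoin_le_iff]
    rintro _ ⟨i, rfl⟩
    exact F.coord_mem i
  · rw [chartRing, Algebra.adjoin_le_iff]
    rintro _ ⟨n, hn, rfl⟩
    rw [F.character_eq_prod n]
    refine prod_mem fun i _ => ?_
    obtain ⟨k, hk⟩ := Int.eq_ofNat_of_zero_le (hn (F.e i) (F.e_mem i))
    rw [hk]
    simp only [zpow_natCast]
    exact pow_mem (Algebra.subset_adjoin (Set.mem_range_self i)) k

theorem param_injective : Function.Injective F.param := by
  rw [injective_iff_map_eq_zero]
  intro p hp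
  have hinj : Function.Injective fun k : Fin 3 →₀ ℕ => ∑ i, (k i : ℤ) • F.m i := by
    intro k l h
    ext j
    have := congrArg (fun n => pair n (F.e j)) h
    simp only [pair_sum_smul, F.dual] at this
    simpa using this
  ext k
  by_cases hk : k ∈ p.support
  · refine eq_zero_of_sum_character hinj p.support (fun k => p.coeff k) ?_ hk
    rw [← hp, param, MvPolynomial.aeval_def, MvPolynomial.eval₂_eq']
    refine Finset.sum_congr rfl fun k _ => ?_
    rw [character_sum_smul]
    simp only [zpow_natCast]
    rfl
  · simpa using hk

/-- The coordinate ring of the chart of a smooth cone is a polynomial ring. -/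
noncomputable def chartEquiv : MvPolynomial (Fin 3) ℚ ≃ₐ[ℚ] chartRing F.cone :=
  (AlgEquiv.ofInjective F.param F.param_injective).trans (Subalgebra.equivOfEq _ _ F.range_param)

theorem coe_chartEquiv (p : MvPolynomial (Fin 3) ℚ) : (F.chartEquiv p : FunField) = F.param p := rfl

instance : UniqueFactorizationMonoid (chartRing F.cone) :=
  F.chartEquiv.toMulEquiv.uniqueFactorizationMonoid inferInstance

instance : IsNoetherianRing (chartRing F.cone) :=
  isNoetherianRing_of_ringEquiv _ F.chartEquiv.toRingEquiv

/-- Elements of one chart ring are moved into another one by multiplying with a character, which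
can be taken to be trivial along the common rays. -/
theorem exists_character_mul_mem {σ : Finset Ray} {g : FunField} (hg : g ∈ chartRing σ) :
    ∃ N : Fin 3 → ℤ, (∀ ρ ∈ F.cone, 0 ≤ pair N ρ) ∧ (∀ ρ ∈ F.cone, ρ ∈ σ → pair N ρ = 0) ∧
      character N * g ∈ chartRing F.cone := by
  induction hg using Algebra.adjoin_induction with
  | mem x hx =>
    obtain ⟨n, hn, rfl⟩ := hx
    have hp : ∀ j, pair (∑ i, (max (-pair n (F.e i)) 0) • F.m i) (F.e j) =
        max (-pair n (F.e j)) 0 := by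
      intro j
      rw [pair_sum_smul]
      simp [F.dual]
    refine ⟨∑ i, (max (-pair n (F.e i)) 0) • F.m i, ?_, ?_, ?_⟩
    · intro ρ hρ
      obtain ⟨j, rfl⟩ := F.mem_cone.1 hρ
      rw [hp]
      exact le_max_right _ _
    · intro ρ hρ hσ
      obtain ⟨j, rfl⟩ := F.mem_cone.1 hρ
      rw [hp]
      have := hn _ hσ
      exact max_eq_right (by linarith)
    · rw [← character_add]
      apply character_mem_chartRing
      intro ρ hρ
      obtain ⟨j, rfl⟩ := F.mem_cone.1 hρ
      rw [pair_add, hp]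
      have := le_max_left (-pair n (F.e j)) 0
      linarith
  | algebraMap r =>
    exact ⟨0, by simp [pair_zero], by simp [pair_zero], by
      rw [character_zero, one_mul]; exact Subalgebra.algebraMap_mem _ _⟩
  | add x y _ _ hx hy =>
    obtain ⟨N, h1, h2, h3⟩ := hx
    obtain ⟨M, k1, k2, k3⟩ := hy
    refine ⟨N + M, fun ρ hρ => ?_, fun ρ hρ hσ => ?_, ?_⟩
    · rw [pair_add]; exact add_nonneg (h1 ρ hρ) (k1 ρ hρ)
    · rw [pair_add, h2 ρ hρ hσ, k2 ρ hρ hσ, add_zero]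
    · have : character (N + M) * (x + y) =
          character M * (character N * x) + character N * (character M * y) := by
        rw [character_add]; ring
      rw [this]
      exact add_mem (mul_mem (character_mem_chartRing k1) h3)
        (mul_mem (character_mem_chartRing h1) k3)
  | mul x y _ _ hx hy =>
    obtain ⟨N, h1, h2, h3⟩ := hx
    obtain ⟨M, k1, k2, k3⟩ := hy
    refine ⟨N + M, fun ρ hρ => ?_, fun ρ hρ hσ => ?_, ?_⟩
    · rw [pair_add]; exact add_nonneg (h1 ρ hρ) (k1 ρ hρ)
    · rw [pair_add, h2 ρ hρ hσ, k2 ρ hρ hσ, add_zero]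
    · have : character (N + M) * (x * y) = (character N * x) * (character M * y) := by
        rw [character_add]; ring
      rw [this]
      exact mul_mem h3 k3

/-- The chart `𝔸³` of the cone spanned by `a0`, `b0`, `c0`. -/
def std : Frame where
  e := ![.a0, .b0, .c0]
  m := fun i => Pi.single i 1
  dual := by decide

theorem std_param : std.param = Algebra.algHom ℚ (MvPolynomial (Fin 3) ℚ) FunField := by
  apply MvPolynomial.algHom_ext
  intro i
  rw [param_X, coord]
  exact character_single i

theorem mem_chartRing_std {f : FunField} :
    f ∈ chartRing std.cone ↔ ∃ p : MvPolynomial (Fin 3) ℚ, algebraMap _ _ p = f := by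
  rw [← range_param, std_param]
  rfl

instance : IsFractionRing (chartRing F.cone) FunField := by
  refine IsFractionRing.of_field _ _ fun z => ?_
  obtain ⟨p, q, hq, rfl⟩ := IsFractionRing.div_surjective (A := MvPolynomial (Fin 3) ℚ) z
  obtain ⟨N, -, -, hN⟩ := F.exists_character_mul_mem (mem_chartRing_std.2 ⟨p, rfl⟩)
  obtain ⟨M, -, -, hM⟩ := F.exists_character_mul_mem (mem_chartRing_std.2 ⟨q, rfl⟩)
  obtain ⟨k, hk1, -, hk⟩ := F.exists_character_mul_mem
    (character_mem_chartRing (σ := ∅) (n := N) (by simp))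
  obtain ⟨l, hl1, -, hl⟩ := F.exists_character_mul_mem
    (character_mem_chartRing (σ := ∅) (n := M) (by simp))
  refine ⟨⟨_, mul_mem (mul_mem hN hl) (character_mem_chartRing hk1)⟩,
    ⟨_, mul_mem (mul_mem hM hk) (character_mem_chartRing hl1)⟩, ?_⟩
  have h1 := character_ne_zero N
  have h2 := character_ne_zero M
  have h3 := character_ne_zero k
  have h4 := character_ne_zero l
  have hq0 : algebraMap (MvPolynomial (Fin 3) ℚ) FunField q ≠ 0 :=
    IsFractionRing.to_map_ne_zero_of_mem_nonZeroDivisors hq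
  simp only [Subalgebra.algebraMap_def, Algebra.algebraMap_self, RingHom.id_apply]
  field_simp

end Frame

set_option maxRecDepth 100000 in
theorem exists_frame {σ : Finset Ray} (hσ : σ ∈ fan) : ∃ F : Frame, F.cone = σ := by
  have hfan : fan =
      {{.a0, .b0, .c0}, {.a0, .b0, .c1}, {.a0, .b1, .c0}, {.a0, .b1, .c1}, {.a1, .b0, .c0},
       {.x, .b1, .c0}, {.a1, .x, .c0}, {.x, .b1, .c1},
       {.y, .b0, .c1}, {.a1, .b0, .y}, {.y, .x, .c1}, {.a1, .x, .y}} := by decide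
  rw [hfan] at hσ
  simp only [Finset.mem_insert, Finset.mem_singleton] at hσ
  rcases hσ with rfl | rfl | rfl | rfl | rfl | rfl | rfl | rfl | rfl | rfl | rfl | rfl
  · exact ⟨⟨![.a0, .b0, .c0], ![![1, 0, 0], ![0, 1, 0], ![0, 0, 1]], by decide⟩, by decide⟩
  · exact ⟨⟨![.a0, .b0, .c1], ![![1, 0, 0], ![0, 1, 0], ![0, 0, -1]], by decide⟩, by decide⟩
  · exact ⟨⟨![.a0, .b1, .c0], ![![1, 0, 0], ![0, -1, 0], ![0, 0, 1]], by decide⟩, by decide⟩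
  · exact ⟨⟨![.a0, .b1, .c1], ![![1, 0, 0], ![0, -1, 0], ![0, 0, -1]], by decide⟩, by decide⟩
  · exact ⟨⟨![.a1, .b0, .c0], ![![-1, 0, 0], ![0, 1, 0], ![0, 0, 1]], by decide⟩, by decide⟩
  · exact ⟨⟨![.x, .b1, .c0], ![![-1, 0, 0], ![1, -1, 0], ![0, 0, 1]], by decide⟩, by decide⟩
  · exact ⟨⟨![.a1, .x, .c0], ![![-1, 1, 0], ![0, -1, 0], ![0, 0, 1]], by decide⟩, by decide⟩
  · exact ⟨⟨![.x, .b1, .c1], ![![-1, 0, 0], ![1, -1, 0], ![0, 0, -1]], by decide⟩, by decide⟩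
  · exact ⟨⟨![.y, .b0, .c1], ![![-1, 0, 0], ![0, 1, 0], ![1, 0, -1]], by decide⟩, by decide⟩
  · exact ⟨⟨![.a1, .b0, .y], ![![-1, 0, 1], ![0, 1, 0], ![0, 0, -1]], by decide⟩, by decide⟩
  · exact ⟨⟨![.y, .x, .c1], ![![-1, 1, 0], ![0, -1, 0], ![1, -1, -1]], by decide⟩, by decide⟩
  · exact ⟨⟨![.a1, .x, .y], ![![-1, 1, 1], ![0, -1, 0], ![0, 0, -1]], by decide⟩, by decide⟩

theorem exists_mem_fan (ρ : Ray) : ∃ σ ∈ fan, ρ ∈ σ := by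
  revert ρ
  decide

/-! ### Prime divisors -/

namespace PrimeDivisor

/-- The center of the prime divisor lies on the chart of the cone `σ`. -/
def HasChart (P : PrimeDivisor) (σ : Finset Ray) : Prop :=
  (∀ f ∈ chartRing σ, P.val f ≤ 1) ∧
    ∀ f, P.val f ≤ 1 → ∃ g ∈ chartRing σ, ∃ h ∈ chartRing σ, P.val h = 1 ∧ f * h = g

theorem val_eq_exp (P : PrimeDivisor) {f : FunField} (hf : f ≠ 0) :
    P.val f = WithZero.exp (-P.ord f) := by
  rw [ord, neg_neg, WithZero.exp_log ((Valuation.ne_zero_iff P.val).2 hf)]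

theorem val_eq_one_iff (P : PrimeDivisor) {f : FunField} (hf : f ≠ 0) :
    P.val f = 1 ↔ P.ord f = 0 := by
  rw [P.val_eq_exp hf, ← WithZero.exp_zero, WithZero.exp_inj]; omega

theorem val_le_one_iff (P : PrimeDivisor) {f : FunField} (hf : f ≠ 0) :
    P.val f ≤ 1 ↔ 0 ≤ P.ord f := by
  rw [P.val_eq_exp hf, ← WithZero.exp_zero, WithZero.exp_le_exp]; omega

theorem val_character_of_isToric {P : PrimeDivisor} {ρ : Ray} (h : P.IsToric ρ) (n : Fin 3 → ℤ) :
    P.val (character n) = WithZero.exp (-pair n ρ) := by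
  rw [P.val_eq_exp (character_ne_zero n), h n]

theorem isToric_of_val {P : PrimeDivisor} {ρ : Ray}
    (h : ∀ n, P.val (character n) = WithZero.exp (-pair n ρ)) : P.IsToric ρ := by
  intro n
  rw [ord, h n, WithZero.log_exp, neg_neg]

theorem ext_val {P Q : PrimeDivisor} (h : P.val = Q.val) : P = Q := by
  cases P; cases Q; cases h; rfl

theorem eq_of_isToric {P : PrimeDivisor} {ρ ρ' : Ray} (h : P.IsToric ρ) (h' : P.IsToric ρ') :
    ρ = ρ' := ray_ext fun m => by rw [← h m, ← h' m]

/-- The coordinate function of a frame, as an element of the chart ring. -/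
noncomputable def _root_.ToricThreefold.Frame.coordMem (F : Frame) (i : Fin 3) :
    chartRing F.cone := ⟨F.coord i, F.coord_mem i⟩

theorem _root_.ToricThreefold.Frame.chartEquiv_X (F : Frame) (i : Fin 3) :
    F.chartEquiv (MvPolynomial.X i) = F.coordMem i :=
  Subtype.ext (by rw [F.coe_chartEquiv, F.param_X]; rfl)

theorem _root_.ToricThreefold.Frame.prime_coordMem (F : Frame) (i : Fin 3) :
    Prime (F.coordMem i) := by
  rw [← F.chartEquiv_X]
  exact (MulEquiv.prime_iff F.chartEquiv.toMulEquiv).2 MvPolynomial.X_prime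

theorem _root_.ToricThreefold.Frame.coordMem_dvd (F : Frame) {i j : Fin 3}
    (h : F.coordMem i ∣ F.coordMem j) : i = j := by
  rw [← F.chartEquiv_X, ← F.chartEquiv_X, map_dvd_iff F.chartEquiv, MvPolynomial.X_dvd_X] at h
  exact h

/-- Along the divisor of a coordinate function, characters have the expected order. -/
theorem _root_.ToricThreefold.Frame.val_character (F : Frame) {i : Fin 3}
    {v : Valuation FunField (WithZero (Multiplicative ℤ))}
    (h : IsAdic (chartRing F.cone) v (F.coordMem i)) (n : Fin 3 → ℤ) :
    v (character n) = WithZero.exp (-pair n (F.e i)) := by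
  rw [F.character_eq_prod n, map_prod, Finset.prod_eq_single i]
  · have h1 : v (F.coord i) = WithZero.exp (-1) := h.map_self
    rw [map_zpow₀, h1, ← WithZero.exp_zsmul]
    simp
  · intro j _ hj
    have h1 : v (F.coord j) = 1 := h.map_of_not_dvd (F.coordMem j)
      fun hd => hj (F.coordMem_dvd hd).symm
    rw [map_zpow₀, h1, one_zpow]
  · simp

theorem _root_.ToricThreefold.IsAdic.of_dvd {R K : Type*} [CommRing R] [IsDomain R] [Field K]
    [Algebra R K] {v : Valuation K (WithZero (Multiplicative ℤ))} {q q' : R}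
    [WfDvdMonoid R] (h : IsAdic R v q) (hq' : Prime q') (hd : q ∣ q') : IsAdic R v q' := by
  obtain ⟨c, rfl⟩ := h.prime.associated_of_dvd hq' hd
  refine ⟨hq', ?_, fun r hr => h.map_of_not_dvd r fun hd => hr ?_⟩
  · rw [map_mul, map_mul, h.map_self, h.map_of_not_dvd, mul_one]
    exact fun hd => h.prime.not_isUnit (isUnit_of_dvd_unit hd c.isUnit)
  · obtain ⟨s, rfl⟩ := hd
    exact ⟨(c⁻¹ : Rˣ) * s, by simp [mul_assoc]⟩

/-- Change of charts: a prime divisor on the chart of `σ` is given by a prime element of another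
chart, if it is not contained in the complement of that chart. -/
theorem exists_isAdic_frame (P : PrimeDivisor) {σ : Finset Ray} (hσ : P.HasChart σ) (F : Frame)
    (h1 : ∀ n, (∀ ρ ∈ F.cone, 0 ≤ pair n ρ) → P.val (character n) ≤ 1)
    (h2 : ∀ n, (∀ ρ ∈ F.cone, ρ ∈ σ → pair n ρ = 0) → P.val (character n) = 1) :
    ∃ q : chartRing F.cone, IsAdic (chartRing F.cone) P.val q := by
  refine exists_isAdic_of_isLocalization P.surjective ?_ ?_
  · rintro ⟨r, hr⟩
    change P.val r ≤ 1
    induction hr using Algebra.adjoin_induction with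
    | mem x hx =>
      obtain ⟨n, hn, rfl⟩ := hx
      exact h1 n hn
    | algebraMap r => exact hσ.1 _ (Subalgebra.algebraMap_mem _ _)
    | add x y _ _ hx hy => exact (P.val.map_add x y).trans (max_le hx hy)
    | mul x y _ _ hx hy => rw [map_mul]; exact mul_le_one' hx hy
  · intro f hf
    obtain ⟨g, hg, h, hh, hv, rfl⟩ := hσ.2 f hf
    obtain ⟨N, hN, hN', hNg⟩ := F.exists_character_mul_mem hg
    obtain ⟨M, hM, hM', hMh⟩ := F.exists_character_mul_mem hh
    refine ⟨⟨_, mul_mem (Frame.character_mem_chartRing hM) hNg⟩,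
      ⟨_, mul_mem (Frame.character_mem_chartRing hN) hMh⟩, ?_, ?_⟩
    · change P.val (_ * (_ * _)) = 1
      rw [map_mul, map_mul, hv, h2 N hN', h2 M hM']
      simp
    · change f * (_ * (_ * _)) = _ * (_ * (f * _))
      ring

theorem isAdic_of_isToric {P : PrimeDivisor} {F : Frame} {i : Fin 3} (h : P.IsToric (F.e i))
    {σ : Finset Ray} (hσ : P.HasChart σ) (hi : F.e i ∈ σ) :
    IsAdic (chartRing F.cone) P.val (F.coordMem i) := by
  obtain ⟨q, hq⟩ := P.exists_isAdic_frame hσ F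
    (fun n hn => by
      rw [val_character_of_isToric h, ← WithZero.exp_zero, WithZero.exp_le_exp]
      have := hn _ (F.e_mem i)
      omega)
    (fun n hn => by
      rw [val_character_of_isToric h, hn _ (F.e_mem i) hi, neg_zero, WithZero.exp_zero])
  refine hq.of_dvd (F.prime_coordMem i) ?_
  by_contra hd
  have h1 := hq.map_of_not_dvd _ hd
  have h2 : P.val (F.coord i) = _ := val_character_of_isToric h (F.m i)
  rw [F.dual, if_pos rfl] at h2
  have h3 := h1.symm.trans h2
  rw [← WithZero.exp_zero, WithZero.exp_inj] at h3
  omega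

theorem exists_frame_hasChart (P : PrimeDivisor) : ∃ F : Frame, F.cone ∈ fan ∧ P.HasChart F.cone := by
  obtain ⟨σ, hσ, h⟩ := P.exists_chart
  obtain ⟨F, rfl⟩ := exists_frame hσ
  exact ⟨F, hσ, h⟩

/-- A prime divisor with center on the chart of a cone is either torus-invariant and belongs to
a ray of that cone, or meets the torus, in which case characters have order zero. -/
theorem isToric_or_val_character {P : PrimeDivisor} {F : Frame} (hF : P.HasChart F.cone) :
    (∃ i, P.IsToric (F.e i)) ∨ ∀ n, P.val (character n) = 1 := by
  obtain ⟨q, hq⟩ := exists_isAdic_of_isLocalization (R := chartRing F.cone) P.surjective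
    (fun r => hF.1 _ r.2) (fun f hf => by
      obtain ⟨g, hg, h, hh, hv, e⟩ := hF.2 f hf
      exact ⟨⟨g, hg⟩, ⟨h, hh⟩, hv, e⟩)
  by_cases hd : ∃ i, q ∣ F.coordMem i
  · obtain ⟨i, hi⟩ := hd
    exact Or.inl ⟨i, isToric_of_val (F.val_character (hq.of_dvd (F.prime_coordMem i) hi))⟩
  · push Not at hd
    right
    intro n
    rw [F.character_eq_prod n, map_prod]
    refine Finset.prod_eq_one fun i _ => ?_
    have h1 : P.val (F.coord i) = 1 := hq.map_of_not_dvd _ (hd i)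
    rw [map_zpow₀, h1, one_zpow]

theorem exists_mem_of_isToric {P : PrimeDivisor} {ρ : Ray} (h : P.IsToric ρ) {F : Frame}
    (hF : P.HasChart F.cone) : ∃ i, F.e i = ρ := by
  rcases isToric_or_val_character hF with ⟨i, hi⟩ | h1
  · exact ⟨i, eq_of_isToric hi h⟩
  · exfalso
    have h2 : ∀ n, pair n ρ = 0 := fun n => by
      rw [← h n, ← P.val_eq_one_iff (character_ne_zero n)]
      exact h1 n
    have e0 := h2 ![1, 0, 0]
    have e1 := h2 ![0, 1, 0]
    have e2 := h2 ![0, 0, 1]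
    cases ρ <;> revert e0 e1 e2 <;> decide

/-- In every chart of a cone containing the ray `i`, the torus-invariant divisor of the ray is given
by the corresponding coordinate function. -/
theorem isAdic_frame {P : PrimeDivisor} {F : Frame} {i : Fin 3} (h : P.IsToric (F.e i)) :
    IsAdic (chartRing F.cone) P.val (F.coordMem i) := by
  obtain ⟨G, -, hG⟩ := P.exists_frame_hasChart
  obtain ⟨j, hj⟩ := exists_mem_of_isToric h hG
  exact isAdic_of_isToric h hG (hj ▸ G.e_mem j)

theorem isToric_unique {P Q : PrimeDivisor} {ρ : Ray} (hP : P.IsToric ρ) (hQ : Q.IsToric ρ) :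
    P = Q := by
  obtain ⟨F, -, hF⟩ := P.exists_frame_hasChart
  obtain ⟨i, rfl⟩ := exists_mem_of_isToric hP hF
  exact ext_val ((isAdic_frame hP).eq_of_dvd (isAdic_frame hQ) dvd_rfl)

/-- The prime divisor on a chart belonging to a prime element of its coordinate ring. -/
theorem exists_of_prime (F : Frame) (hF : F.cone ∈ fan) {q : chartRing F.cone} (hq : Prime q) :
    ∃ P : PrimeDivisor, IsAdic (chartRing F.cone) P.val q := by
  obtain ⟨v, hv⟩ := exists_isAdic (K := FunField) hq
  refine ⟨⟨v, hv.surjective, F.cone, hF, fun f hf => hv.map_le_one ⟨f, hf⟩, fun f hf => ?_⟩, hv⟩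
  obtain ⟨a, b, hb, hab⟩ := hv.exists_of_le_one hf
  exact ⟨a, a.2, b, b.2, hb, hab⟩

theorem exists_isToric (ρ : Ray) : ∃ P : PrimeDivisor, P.IsToric ρ := by
  obtain ⟨σ, hσ, hρ⟩ := exists_mem_fan ρ
  obtain ⟨F, rfl⟩ := exists_frame hσ
  obtain ⟨i, rfl⟩ := F.mem_cone.1 hρ
  obtain ⟨P, hP⟩ := exists_of_prime F hσ (F.prime_coordMem i)
  exact ⟨P, isToric_of_val (F.val_character hP)⟩

/-- The torus-invariant prime divisor of a ray. -/
noncomputable def toric (ρ : Ray) : PrimeDivisor := (exists_isToric ρ).choose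

theorem isToric_toric (ρ : Ray) : (toric ρ).IsToric ρ := (exists_isToric ρ).choose_spec

theorem isToric_iff {P : PrimeDivisor} {ρ : Ray} : P.IsToric ρ ↔ P = toric ρ :=
  ⟨fun h => isToric_unique h (isToric_toric ρ), fun h => h ▸ isToric_toric ρ⟩

theorem toric_injective : Function.Injective toric := fun ρ _ h =>
  eq_of_isToric (isToric_toric ρ) (isToric_iff.2 h)

theorem isComponent_toric {ρ : Ray} {S : Finset Ray} : (toric ρ).IsComponent S ↔ ρ ∈ S := by
  constructor
  · rintro ⟨ρ', h, h'⟩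
    rwa [eq_of_isToric (isToric_toric ρ) h']
  · exact fun h => ⟨ρ, h, isToric_toric ρ⟩

/-- A prime divisor which is not torus-invariant. -/
def MeetsTorus (P : PrimeDivisor) : Prop := ∀ ρ, P ≠ toric ρ

theorem MeetsTorus.val_character {P : PrimeDivisor} (h : P.MeetsTorus) (n : Fin 3 → ℤ) :
    P.val (character n) = 1 := by
  obtain ⟨F, -, hF⟩ := P.exists_frame_hasChart
  rcases isToric_or_val_character hF with ⟨i, hi⟩ | h1
  · exact absurd (isToric_iff.1 hi) (h _)
  · exact h1 n

theorem MeetsTorus.not_isComponent {P : PrimeDivisor} (h : P.MeetsTorus) (S : Finset Ray) :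
    ¬ P.IsComponent S := by
  rintro ⟨ρ, -, hρ⟩
  exact h ρ (isToric_iff.1 hρ)

theorem _root_.ToricThreefold.isAdic_std {v : Valuation FunField (WithZero (Multiplicative ℤ))}
    {q : MvPolynomial (Fin 3) ℚ} :
    IsAdic (chartRing Frame.std.cone) v (Frame.std.chartEquiv q) ↔
      IsAdic (MvPolynomial (Fin 3) ℚ) v q := by
  have hmap : ∀ p, algebraMap (chartRing Frame.std.cone) FunField (Frame.std.chartEquiv p) =
      algebraMap (MvPolynomial (Fin 3) ℚ) FunField p := fun p => by
    change ((Frame.std.chartEquiv p : chartRing Frame.std.cone) : FunField) = _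
    rw [Frame.coe_chartEquiv, Frame.std_param]; rfl
  have hprime : Prime (Frame.std.chartEquiv q) ↔ Prime q :=
    MulEquiv.prime_iff Frame.std.chartEquiv.toMulEquiv
  constructor
  · rintro ⟨h1, h2, h3⟩
    refine ⟨hprime.1 h1, by rw [← hmap]; exact h2, fun r hr => ?_⟩
    rw [← hmap]
    exact h3 _ fun hd => hr ((map_dvd_iff Frame.std.chartEquiv).1 hd)
  · rintro ⟨h1, h2, h3⟩
    refine ⟨hprime.2 h1, by rw [hmap]; exact h2, fun r hr => ?_⟩
    obtain ⟨r, rfl⟩ := Frame.std.chartEquiv.surjective r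
    rw [hmap]
    exact h3 _ fun hd => hr (map_dvd Frame.std.chartEquiv hd)

/-- A prime divisor meeting the torus is given by an irreducible polynomial. -/
theorem MeetsTorus.exists_isAdic {P : PrimeDivisor} (h : P.MeetsTorus) :
    ∃ q : MvPolynomial (Fin 3) ℚ, IsAdic (MvPolynomial (Fin 3) ℚ) P.val q := by
  obtain ⟨F, -, hF⟩ := P.exists_frame_hasChart
  obtain ⟨q, hq⟩ := P.exists_isAdic_frame hF Frame.std (fun n _ => (h.val_character n).le)
    (fun n _ => h.val_character n)
  obtain ⟨q, rfl⟩ := Frame.std.chartEquiv.surjective q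
  exact ⟨q, isAdic_std.1 hq⟩

theorem std_cone_mem : Frame.std.cone ∈ fan := by decide

/-- Every irreducible polynomial has a prime divisor. -/
theorem exists_of_prime_poly {q : MvPolynomial (Fin 3) ℚ} (hq : Prime q) :
    ∃ P : PrimeDivisor, IsAdic (MvPolynomial (Fin 3) ℚ) P.val q := by
  obtain ⟨P, hP⟩ := exists_of_prime Frame.std std_cone_mem
    ((MulEquiv.prime_iff Frame.std.chartEquiv.toMulEquiv).2 hq)
  exact ⟨P, isAdic_std.1 hP⟩

end PrimeDivisor

/-! ### Degrees of divisors and Picard groups -/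

namespace PrimeDivisor

theorem val_const (P : PrimeDivisor) {c : ℚ} (hc : c ≠ 0) : P.val (algebraMap ℚ FunField c) = 1 := by
  obtain ⟨σ, -, h, -⟩ := P.exists_chart
  have h1 := h _ (Subalgebra.algebraMap_mem (chartRing σ) c)
  have h2 := h _ (Subalgebra.algebraMap_mem (chartRing σ) c⁻¹)
  refine le_antisymm h1 ?_
  calc 1 = P.val (algebraMap ℚ FunField c) * P.val (algebraMap ℚ FunField c⁻¹) := by
        rw [← map_mul, ← map_mul, mul_inv_cancel₀ hc, map_one, map_one]
    _ ≤ P.val (algebraMap ℚ FunField c) * 1 := by gcongr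
    _ = _ := mul_one _

theorem MeetsTorus.ord_character {P : PrimeDivisor} (h : P.MeetsTorus) (n : Fin 3 → ℤ) :
    P.ord (character n) = 0 :=
  (P.val_eq_one_iff (character_ne_zero n)).1 (h.val_character n)

theorem ord_toric_character (ρ : Ray) (n : Fin 3 → ℤ) : (toric ρ).ord (character n) = pair n ρ :=
  isToric_toric ρ n

theorem toric_or_meetsTorus (P : PrimeDivisor) : (∃ ρ, P = toric ρ) ∨ P.MeetsTorus := by
  by_cases h : ∃ ρ, P = toric ρ
  · exact Or.inl h
  · exact Or.inr fun ρ hρ => h ⟨ρ, hρ⟩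

open Classical in
/-- An irreducible polynomial defining a prime divisor which meets the torus. -/
noncomputable def poly (P : PrimeDivisor) : MvPolynomial (Fin 3) ℚ :=
  if h : P.MeetsTorus then h.exists_isAdic.choose else 1

theorem MeetsTorus.isAdic_poly {P : PrimeDivisor} (h : P.MeetsTorus) :
    IsAdic (MvPolynomial (Fin 3) ℚ) P.val P.poly := by
  rw [poly, dif_pos h]
  exact h.exists_isAdic.choose_spec

/-- The equation of a prime divisor as a rational function. -/
noncomputable def eqn (P : PrimeDivisor) : FunField :=
  algebraMap (MvPolynomial (Fin 3) ℚ) FunField P.poly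

theorem MeetsTorus.eqn_ne_zero {P : PrimeDivisor} (h : P.MeetsTorus) : P.eqn ≠ 0 := by
  rw [eqn, Ne, map_eq_zero_iff _ (IsFractionRing.injective _ _)]
  exact h.isAdic_poly.prime.ne_zero

theorem MeetsTorus.ord_eqn_self {P : PrimeDivisor} (h : P.MeetsTorus) : P.ord P.eqn = 1 := by
  rw [ord, eqn, h.isAdic_poly.map_self, WithZero.log_exp, neg_neg]

theorem MeetsTorus.ord_eqn {P Q : PrimeDivisor} (h : P.MeetsTorus) (hQ : Q.MeetsTorus)
    (hne : Q ≠ P) : Q.ord P.eqn = 0 := by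
  rw [← Q.val_eq_one_iff h.eqn_ne_zero]
  refine hQ.isAdic_poly.map_of_not_dvd _ fun hd => hne ?_
  exact ext_val (hQ.isAdic_poly.eq_of_dvd h.isAdic_poly hd)

theorem not_meetsTorus_of_dvd {P : PrimeDivisor} {q : MvPolynomial (Fin 3) ℚ}
    (h : IsAdic (MvPolynomial (Fin 3) ℚ) P.val q) {i : Fin 3} (hi : q ∣ MvPolynomial.X i) :
    ¬ P.MeetsTorus := by
  intro hP
  have h1 := hP.val_character (Pi.single i 1)
  rw [character_single, h.map_eq_one_iff] at h1
  exact h1 hi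

theorem meetsTorus_of_not_dvd {P : PrimeDivisor} {q : MvPolynomial (Fin 3) ℚ}
    (h : IsAdic (MvPolynomial (Fin 3) ℚ) P.val q) (hq : ∀ i, ¬ q ∣ MvPolynomial.X i) :
    P.MeetsTorus := by
  rintro ρ rfl
  have h1 : ∀ n, pair n ρ = 0 := fun n => by
    rw [← ord_toric_character, ← val_eq_one_iff _ (character_ne_zero n), character, map_prod]
    exact Finset.prod_eq_one fun i _ => by rw [map_zpow₀, h.map_of_not_dvd _ (hq i), one_zpow]
  have e0 := h1 ![1, 0, 0]
  have e1 := h1 ![0, 1, 0]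
  have e2 := h1 ![0, 0, 1]
  cases ρ <;> revert e0 e1 e2 <;> decide

end PrimeDivisor

open PrimeDivisor

/-- The torus-invariant divisor with given multiplicities. -/
noncomputable def toricDivisor (n : Ray → ℤ) : PrimeDivisor →₀ ℤ :=
  ∑ ρ, Finsupp.single (toric ρ) (n ρ)

theorem toricDivisor_toric (n : Ray → ℤ) (ρ : Ray) : toricDivisor n (toric ρ) = n ρ := by
  rw [toricDivisor, Finsupp.finsetSum_apply, Finset.sum_eq_single ρ]
  · simp
  · intro ρ' _ h
    exact Finsupp.single_eq_of_ne fun e => h (toric_injective e.symm)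
  · simp

theorem toricDivisor_meetsTorus (n : Ray → ℤ) {P : PrimeDivisor} (h : P.MeetsTorus) :
    toricDivisor n P = 0 := by
  rw [toricDivisor, Finsupp.finsetSum_apply]
  exact Finset.sum_eq_zero fun ρ _ => Finsupp.single_eq_of_ne (h ρ)

section Degree

variable {M : Type*} [AddCommGroup M] (w : Ray → M)

open Classical in
/-- The degree of a prime divisor, if the torus-invariant divisor of the ray `ρ` has degree `w ρ` and
principal divisors have degree zero. -/
noncomputable def primeDegree (P : PrimeDivisor) : M :=
  if h : ∃ ρ, P = toric ρ then w h.choose else - ∑ ρ, (toric ρ).ord P.eqn • w ρ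

theorem primeDegree_toric (ρ : Ray) : primeDegree w (toric ρ) = w ρ := by
  have h : ∃ ρ', toric ρ = toric ρ' := ⟨ρ, rfl⟩
  rw [primeDegree, dif_pos h, ← toric_injective h.choose_spec]

theorem primeDegree_meetsTorus {P : PrimeDivisor} (h : P.MeetsTorus) :
    primeDegree w P = - ∑ ρ, (toric ρ).ord P.eqn • w ρ := by
  rw [primeDegree, dif_neg]
  rintro ⟨ρ, hρ⟩
  exact h ρ hρ

/-- The degree homomorphism on divisors of `X`. -/
noncomputable def degree : (PrimeDivisor →₀ ℤ) →ₗ[ℤ] M := Finsupp.linearCombination ℤ (primeDegree w)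

theorem degree_toricDivisor (n : Ray → ℤ) : degree w (toricDivisor n) = ∑ ρ, n ρ • w ρ := by
  simp [degree, toricDivisor, primeDegree_toric]

/-- `L` is the divisor of `f`. -/
def IsDivisorOf (L : PrimeDivisor →₀ ℤ) (f : FunField) : Prop := ∀ P : PrimeDivisor, L P = P.ord f

theorem IsDivisorOf.mul {L L' : PrimeDivisor →₀ ℤ} {f g : FunField} (hf : f ≠ 0) (hg : g ≠ 0)
    (h : IsDivisorOf L f) (h' : IsDivisorOf L' g) : IsDivisorOf (L + L') (f * g) := fun P => by
  rw [Finsupp.add_apply, h, h', P.ord_mul hf hg]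

theorem IsDivisorOf.inv {L : PrimeDivisor →₀ ℤ} {f : FunField} (h : IsDivisorOf L f) :
    IsDivisorOf (-L) f⁻¹ := fun P => by
  rw [Finsupp.neg_apply, h, P.ord_inv]

theorem isDivisorOf_character (m : Fin 3 → ℤ) :
    IsDivisorOf (toricDivisor (pair m)) (character m) := fun P => by
  rcases P.toric_or_meetsTorus with ⟨ρ, rfl⟩ | h
  · rw [toricDivisor_toric, ord_toric_character]
  · rw [toricDivisor_meetsTorus _ h, h.ord_character]

theorem isDivisorOf_const {c : ℚ} (hc : c ≠ 0) :
    IsDivisorOf 0 (algebraMap ℚ FunField c) := fun P => by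
  have : algebraMap ℚ FunField c ≠ 0 := by rwa [Ne, map_eq_zero]
  rw [Finsupp.zero_apply, (P.val_eq_one_iff this).1 (P.val_const hc)]

theorem isDivisorOf_eqn {Q : PrimeDivisor} (h : Q.MeetsTorus) :
    IsDivisorOf (Finsupp.single Q 1 + toricDivisor fun ρ => (toric ρ).ord Q.eqn) Q.eqn := fun P => by
  rw [Finsupp.add_apply]
  rcases P.toric_or_meetsTorus with ⟨ρ, rfl⟩ | hP
  · rw [toricDivisor_toric, Finsupp.single_eq_of_ne (h ρ).symm, zero_add]
  · rw [toricDivisor_meetsTorus _ hP, add_zero]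
    by_cases hPQ : P = Q
    · rw [hPQ, Finsupp.single_eq_same, h.ord_eqn_self]
    · rw [Finsupp.single_eq_of_ne hPQ, h.ord_eqn hP hPQ]

theorem degree_eqn {Q : PrimeDivisor} (h : Q.MeetsTorus) :
    degree w (Finsupp.single Q 1 + toricDivisor fun ρ => (toric ρ).ord Q.eqn) = 0 := by
  rw [map_add, degree_toricDivisor, degree, Finsupp.linearCombination_single, one_smul,
    primeDegree_meetsTorus w h, neg_add_cancel]

theorem exists_const_of_isUnit {p : MvPolynomial (Fin 3) ℚ} (hp : IsUnit p) :
    ∃ c : ℚ, c ≠ 0 ∧ algebraMap _ FunField p = algebraMap ℚ FunField c := by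
  rw [MvPolynomial.isUnit_iff_eq_C_of_isReduced] at hp
  obtain ⟨c, hc, rfl⟩ := hp
  refine ⟨c, hc.ne_zero, ?_⟩
  rw [IsScalarTower.algebraMap_apply ℚ (MvPolynomial (Fin 3) ℚ) FunField, MvPolynomial.algebraMap_eq]

/-- Principal divisors have degree zero. -/
theorem exists_isDivisorOf (hw : ∀ m, ∑ ρ, pair m ρ • w ρ = 0) {f : FunField} (hf : f ≠ 0) :
    ∃ L, IsDivisorOf L f ∧ degree w L = 0 := by
  have hpoly : ∀ p : MvPolynomial (Fin 3) ℚ, p ≠ 0 →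
      ∃ L, IsDivisorOf L (algebraMap _ FunField p) ∧ degree w L = 0 := by
    intro p
    induction p using UniqueFactorizationMonoid.induction_on_prime with
    | h₁ => simp
    | h₂ u hu =>
      intro _
      obtain ⟨c, hc, e⟩ := exists_const_of_isUnit hu
      exact ⟨0, e ▸ isDivisorOf_const hc, map_zero _⟩
    | h₃ a q ha hq ih =>
      intro _
      obtain ⟨L, hL, hL0⟩ := ih ha
      have key : ∃ (q' : MvPolynomial (Fin 3) ℚ) (L' : PrimeDivisor →₀ ℤ), Associated q' q ∧
          IsDivisorOf L' (algebraMap _ FunField q') ∧ degree w L' = 0 := by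
        by_cases hd : ∃ i, q ∣ MvPolynomial.X i
        · obtain ⟨i, hi⟩ := hd
          refine ⟨MvPolynomial.X i, _, (hq.associated_of_dvd MvPolynomial.X_prime hi).symm,
            character_single i ▸ isDivisorOf_character _, ?_⟩
          rw [degree_toricDivisor, hw]
        · push Not at hd
          obtain ⟨Q, hQ⟩ := exists_of_prime_poly hq
          have hm := meetsTorus_of_not_dvd hQ hd
          refine ⟨Q.poly, _, ?_, isDivisorOf_eqn hm, degree_eqn w hm⟩
          refine (hq.associated_of_dvd hm.isAdic_poly.prime ?_).symm
          by_contra hnd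
          have h1 := hQ.map_of_not_dvd _ hnd
          rw [hm.isAdic_poly.map_eq_one_iff] at h1
          exact h1 dvd_rfl
      obtain ⟨q', L', ⟨u, rfl⟩, hL', hL0'⟩ := key
      obtain ⟨c, hc, e⟩ := exists_const_of_isUnit u.isUnit
      have hinj := IsFractionRing.injective (MvPolynomial (Fin 3) ℚ) FunField
      refine ⟨L' + 0 + L, ?_, by simp [hL0, hL0']⟩
      have hu0 : algebraMap _ FunField (u : MvPolynomial (Fin 3) ℚ) ≠ 0 := by
        rw [e]; simpa using hc
      have hq0 : algebraMap _ FunField q' ≠ 0 := by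
        rw [Ne, map_eq_zero_iff _ hinj]
        rintro rfl
        exact hq.ne_zero (zero_mul _)
      have ha0 : algebraMap _ FunField a ≠ 0 := by rwa [Ne, map_eq_zero_iff _ hinj]
      rw [map_mul, map_mul]
      exact (hL'.mul hq0 hu0 (e ▸ isDivisorOf_const hc)).mul (mul_ne_zero hq0 hu0) ha0 hL
  obtain ⟨p, q, hq, rfl⟩ := IsFractionRing.div_surjective (A := MvPolynomial (Fin 3) ℚ) f
  obtain ⟨hp0, hq0⟩ := div_ne_zero_iff.1 hf
  obtain ⟨L, hL, h0⟩ := hpoly p (by rintro rfl; simp at hp0)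
  obtain ⟨L', hL', h0'⟩ := hpoly q (nonZeroDivisors.ne_zero hq)
  refine ⟨L + -L', ?_, by simp [h0, h0']⟩
  rw [div_eq_mul_inv]
  exact hL.mul hp0 (inv_ne_zero hq0) hL'.inv

/-- Every divisor is linearly equivalent to a torus-invariant one. -/
theorem exists_toricDivisor (L : PrimeDivisor →₀ ℤ) :
    ∃ (f : FunField) (n : Ray → ℤ), f ≠ 0 ∧ IsDivisorOf (L - toricDivisor n) f := by
  induction L using Finsupp.induction_linear with
  | zero =>
    refine ⟨1, 0, one_ne_zero, ?_⟩
    have := isDivisorOf_character 0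
    rw [character_zero] at this
    convert! this using 1
    ext P
    simp [toricDivisor, pair_zero]
  | add L L' hL hL' =>
    obtain ⟨f, n, hf, h⟩ := hL
    obtain ⟨g, m, hg, h'⟩ := hL'
    refine ⟨f * g, n + m, mul_ne_zero hf hg, ?_⟩
    convert! h.mul hf hg h' using 1
    simp only [toricDivisor, Pi.add_apply, Finsupp.single_add, Finset.sum_add_distrib]
    abel
  | single P a =>
    rcases P.toric_or_meetsTorus with ⟨ρ, rfl⟩ | hP
    · refine ⟨1, Pi.single ρ a, one_ne_zero, ?_⟩
      have : toricDivisor (Pi.single ρ a) = Finsupp.single (toric ρ) a := by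
        rw [toricDivisor, Finset.sum_eq_single ρ]
        · simp
        · intro ρ' _ h
          simp [Pi.single_eq_of_ne h]
        · simp
      rw [this, sub_self]
      intro Q
      rw [Q.ord_one]; rfl
    · refine ⟨P.eqn ^ a, fun ρ => -a * (toric ρ).ord P.eqn, zpow_ne_zero _ hP.eqn_ne_zero, ?_⟩
      intro Q
      have h1 := isDivisorOf_eqn hP Q
      have h2 : Q.ord (P.eqn ^ a) = a * Q.ord P.eqn := by
        rw [ord, map_zpow₀, WithZero.log_zpow, ord]
        simp
      rw [h2, ← h1]
      rcases Q.toric_or_meetsTorus with ⟨ρ, rfl⟩ | hQ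
      · simp only [Finsupp.sub_apply, Finsupp.add_apply, toricDivisor_toric]
        rw [Finsupp.single_eq_of_ne (hP ρ).symm, Finsupp.single_eq_of_ne (hP ρ).symm]
        ring
      · simp only [Finsupp.sub_apply, Finsupp.add_apply, toricDivisor_meetsTorus _ hQ]
        by_cases hPQ : Q = P
        · rw [hPQ]; simp
        · rw [Finsupp.single_eq_of_ne hPQ, Finsupp.single_eq_of_ne hPQ]; ring

variable (S : Finset Ray)

/-- The degree homomorphism on divisors of the complement of the toric divisors in `S`. -/
noncomputable def degreeOn : Divisors S →ₗ[ℤ] M :=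
  Finsupp.linearCombination ℤ fun P => primeDegree w P.1

variable {S}

theorem degreeOn_restrict (hwS : ∀ ρ ∈ S, w ρ = 0) (L : PrimeDivisor →₀ ℤ) :
    degreeOn w S (restrict S L) = degree w L := by
  classical
  induction L using Finsupp.induction_linear with
  | zero => simp [restrict]
  | add L L' h h' =>
    rw [map_add, ← h, ← h', ← map_add]
    exact congrArg _ Finsupp.subtypeDomain_add
  | single P a =>
    rw [degree, Finsupp.linearCombination_single]
    by_cases hP : P.IsComponent S
    · obtain ⟨ρ, hρ, h⟩ := hP
      rw [isToric_iff] at h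
      subst h
      rw [primeDegree_toric, hwS ρ hρ, smul_zero]
      have : restrict S (Finsupp.single (toric ρ) a) = 0 := by
        ext ⟨Q, hQ⟩
        rw [restrict, Finsupp.subtypeDomain_apply, Finsupp.zero_apply, Finsupp.single_eq_of_ne]
        rintro rfl
        exact hQ (isComponent_toric.2 hρ)
      rw [this, map_zero]
    · have : restrict S (Finsupp.single P a) = Finsupp.single ⟨P, hP⟩ a := by
        ext ⟨Q, hQ⟩
        rw [restrict, Finsupp.subtypeDomain_apply, Finsupp.single_apply, Finsupp.single_apply]
        simp only [Subtype.mk.injEq]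
      rw [this, degreeOn, Finsupp.linearCombination_single]

theorem restrict_surjective (L : Divisors S) : ∃ L', restrict S L' = L := by
  classical
  refine ⟨L.mapDomain Subtype.val, ?_⟩
  ext P
  rw [restrict, Finsupp.subtypeDomain_apply, Finsupp.mapDomain_apply Subtype.val_injective]

/-- The weights `w` describe the class group of the complement of `S`: they induce an exact
sequence `ℤ³ → ℤ^(Ray ∖ S) → M → 0`. -/
structure IsGrading (w : Ray → M) (S : Finset Ray) : Prop where
  pair_smul : ∀ m, ∑ ρ, pair m ρ • w ρ = 0
  eq_zero : ∀ ρ ∈ S, w ρ = 0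
  exact : ∀ n : Ray → ℤ, ∑ ρ, n ρ • w ρ = 0 → ∃ m, ∀ ρ, ρ ∉ S → n ρ = pair m ρ
  surjective : ∀ x, ∃ n : Ray → ℤ, ∑ ρ, n ρ • w ρ = x

variable {w}

theorem IsGrading.mem_principalDivisors_iff (h : IsGrading w S) (L : Divisors S) :
    L ∈ principalDivisors S ↔ degreeOn w S L = 0 := by
  constructor
  · rintro ⟨f, hf, hL⟩
    obtain ⟨L', hL', h0⟩ := exists_isDivisorOf w h.pair_smul hf
    rw [← h0, ← degreeOn_restrict w h.eq_zero]
    congr 1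
    ext P
    rw [hL, restrict, Finsupp.subtypeDomain_apply, hL']
  · intro h0
    obtain ⟨L, rfl⟩ := restrict_surjective L
    rw [degreeOn_restrict w h.eq_zero] at h0
    obtain ⟨f, n, hf, hfn⟩ := exists_toricDivisor L
    obtain ⟨L', hL', h0'⟩ := exists_isDivisorOf w h.pair_smul hf
    have : L' = L - toricDivisor n := by
      ext P
      rw [hL', hfn]
    rw [this, map_sub, h0, degree_toricDivisor, zero_sub, neg_eq_zero] at h0'
    obtain ⟨m, hm⟩ := h.exact n h0'
    refine ⟨f * character m, mul_ne_zero hf (character_ne_zero m), ?_⟩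
    rintro ⟨P, hP⟩
    rw [P.ord_mul hf (character_ne_zero m), ← hfn P, ← isDivisorOf_character m P, Finsupp.sub_apply,
      restrict, Finsupp.subtypeDomain_apply]
    rcases P.toric_or_meetsTorus with ⟨ρ, rfl⟩ | hP'
    · rw [isComponent_toric] at hP
      rw [toricDivisor_toric, toricDivisor_toric, hm ρ hP]
      ring
    · rw [toricDivisor_meetsTorus _ hP', toricDivisor_meetsTorus _ hP']
      ring

theorem IsGrading.degreeOn_surjective (h : IsGrading w S) :
    Function.Surjective (degreeOn w S) := fun x => by
  obtain ⟨n, hn⟩ := h.surjective x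
  exact ⟨restrict S (toricDivisor n), by
    rw [degreeOn_restrict w h.eq_zero, degree_toricDivisor, hn]⟩

/-- The Picard group is identified with the group of degrees. -/
noncomputable def IsGrading.picEquiv (h : IsGrading w S) : Pic S ≃+ M :=
  (QuotientAddGroup.quotientAddEquivOfEq (by
    ext L
    rw [h.mem_principalDivisors_iff, AddMonoidHom.mem_ker]
    rfl)).trans
  (QuotientAddGroup.quotientKerEquivOfSurjective (degreeOn w S).toAddMonoidHom h.degreeOn_surjective)

theorem IsGrading.picEquiv_mk (h : IsGrading w S) (L : Divisors S) :
    h.picEquiv (QuotientAddGroup.mk L) = degreeOn w S L := rfl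

end Degree

open PrimeDivisor

/-! ### The Picard groups of `U` and of the complement of `E₁ + E₂` -/

theorem sum_ray {M : Type*} [AddCommMonoid M] (f : Ray → M) :
    ∑ ρ, f ρ = f .a0 + f .a1 + f .b0 + f .b1 + f .c0 + f .c1 + f .x + f .y := by
  have : (Finset.univ : Finset Ray) = {.a0, .a1, .b0, .b1, .c0, .c1, .x, .y} := rfl
  rw [this]
  simp [add_assoc]

/-- The degrees of the toric divisors in `Pic U ≅ ℤ²`. -/
def weightU : Ray → Fin 2 → ℤ
  | .b0 => ![1, 0]
  | .b1 => ![1, 0]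
  | .c0 => ![0, 1]
  | .c1 => ![0, 1]
  | _ => 0

/-- The degrees of the toric divisors in `Pic (X ∖ (E₁ ∪ E₂)) ≅ ℤ³`. -/
def weightM : Ray → Fin 3 → ℤ
  | .a0 => ![1, 0, 0]
  | .a1 => ![1, 0, 0]
  | .b0 => ![0, 1, 0]
  | .b1 => ![0, 1, 0]
  | .c0 => ![0, 0, 1]
  | .c1 => ![0, 0, 1]
  | _ => 0

theorem sum_weightU (n : Ray → ℤ) :
    ∑ ρ, n ρ • weightU ρ = ![n .b0 + n .b1, n .c0 + n .c1] := by
  rw [sum_ray]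
  ext i
  fin_cases i <;> simp [weightU]

theorem sum_weightM (n : Ray → ℤ) :
    ∑ ρ, n ρ • weightM ρ = ![n .a0 + n .a1, n .b0 + n .b1, n .c0 + n .c1] := by
  rw [sum_ray]
  ext i
  fin_cases i <;> simp [weightM]

theorem isGrading_weightU : IsGrading weightU boundary where
  pair_smul m := by
    rw [sum_weightU]
    ext i
    fin_cases i <;> simp [pair_eq, gen]
  eq_zero := by decide
  exact n hn := by
    rw [sum_weightU] at hn
    have h0 : n .b0 + n .b1 = 0 := congrFun hn 0
    have h1 : n .c0 + n .c1 = 0 := congrFun hn 1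
    refine ⟨![-n .a1, n .b0, n .c0], fun ρ hρ => ?_⟩
    cases ρ <;> first | (exfalso; revert hρ; decide) | (simp [pair_eq, gen]; try omega)
  surjective x := by
    refine ⟨fun ρ => if ρ = .b0 then x 0 else if ρ = .c0 then x 1 else 0, ?_⟩
    rw [sum_weightU]
    ext i
    fin_cases i <;> simp

theorem isGrading_weightM : IsGrading weightM (boundary \ faceM) where
  pair_smul m := by
    rw [sum_weightM]
    ext i
    fin_cases i <;> simp [pair_eq, gen]
  eq_zero := by decide
  exact n hn := by
    rw [sum_weightM] at hn
    have h0 : n .a0 + n .a1 = 0 := congrFun hn 0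
    have h1 : n .b0 + n .b1 = 0 := congrFun hn 1
    have h2 : n .c0 + n .c1 = 0 := congrFun hn 2
    refine ⟨![n .a0, n .b0, n .c0], fun ρ hρ => ?_⟩
    cases ρ <;> first | (exfalso; revert hρ; decide) | (simp [pair_eq, gen]; try omega)
  surjective x := by
    refine ⟨fun ρ => if ρ = .a0 then x 0 else if ρ = .b0 then x 1 else if ρ = .c0 then x 2 else 0, ?_⟩
    rw [sum_weightM]
    ext i
    fin_cases i <;> simp

theorem finrank_pic {n : ℕ} {S : Finset Ray} {w : Ray → Fin n → ℤ} (h : IsGrading w S) :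
    Module.finrank ℤ (Pic S) = n := by
  rw [h.picEquiv.toIntLinearEquiv.finrank_eq, Module.finrank_fin_fun]

theorem finrank_pic_boundary : Module.finrank ℤ (Pic boundary) = 2 := finrank_pic isGrading_weightU

theorem bInv'_faceM : bInv' faceM = 3 := finrank_pic isGrading_weightM

/-! ### Invertible functions on `U` -/

/-- A function without zeros or poles on the torus is a multiple of a character. -/
theorem exists_eq_const_mul_character {f : FunField} (hf : f ≠ 0)
    (h : ∀ P : PrimeDivisor, P.MeetsTorus → P.ord f = 0) :
    ∃ (c : ℚ) (n : Fin 3 → ℤ), c ≠ 0 ∧ f = algebraMap ℚ FunField c * character n := by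
  have hpoly : ∀ p : MvPolynomial (Fin 3) ℚ, p ≠ 0 →
      (∀ q, Prime q → q ∣ p → ∃ i, q ∣ MvPolynomial.X i) →
      ∃ (c : ℚ) (n : Fin 3 → ℤ), c ≠ 0 ∧
        algebraMap _ FunField p = algebraMap ℚ FunField c * character n := by
    intro p
    induction p using UniqueFactorizationMonoid.induction_on_prime with
    | h₁ => simp
    | h₂ u hu =>
      intro _ _
      obtain ⟨c, hc, e⟩ := exists_const_of_isUnit hu
      exact ⟨c, 0, hc, by rw [e, character_zero, mul_one]⟩
    | h₃ a q ha hq ih =>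
      intro _ h
      obtain ⟨c, n, hc, e⟩ := ih ha fun q' hq' hd => h q' hq' (hd.mul_left q)
      obtain ⟨i, hi⟩ := h q hq (dvd_mul_right q a)
      obtain ⟨u, hu⟩ := (hq.associated_of_dvd MvPolynomial.X_prime hi).symm
      obtain ⟨d, hd, e'⟩ := exists_const_of_isUnit u.isUnit
      refine ⟨c * d, n + Pi.single i 1, mul_ne_zero hc hd, ?_⟩
      rw [map_mul, ← hu, map_mul, e, e', character_add, character_single, map_mul]
      ring
  obtain ⟨a, b, hab, rfl⟩ := IsFractionRing.exists_reduced_fraction (MvPolynomial (Fin 3) ℚ) f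
  rw [IsFractionRing.mk'_eq_div] at hf h ⊢
  have hinj := IsFractionRing.injective (MvPolynomial (Fin 3) ℚ) FunField
  have hb : (b : MvPolynomial (Fin 3) ℚ) ≠ 0 := nonZeroDivisors.ne_zero b.2
  have hb' : algebraMap _ FunField (b : MvPolynomial (Fin 3) ℚ) ≠ 0 := by
    rwa [Ne, map_eq_zero_iff _ hinj]
  have ha : a ≠ 0 := by
    rintro rfl
    simp at hf
  have key : ∀ q p p' : MvPolynomial (Fin 3) ℚ, Prime q → q ∣ p → ¬ q ∣ p' → p' ≠ 0 →
      (∀ P : PrimeDivisor, P.MeetsTorus →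
        P.val (algebraMap _ FunField p) = P.val (algebraMap _ FunField p')) →
      ∃ i, q ∣ MvPolynomial.X i := by
    intro q p p' hq hd hd' hp' hP
    by_contra! hcon
    obtain ⟨P, hPq⟩ := exists_of_prime_poly hq
    have h1 := hP P (meetsTorus_of_not_dvd hPq hcon)
    rw [hPq.map_of_not_dvd _ hd', hPq.map_eq_one_iff] at h1
    exact h1 hd
  have hval : ∀ P : PrimeDivisor, P.MeetsTorus →
      P.val (algebraMap _ FunField a) =
        P.val (algebraMap _ FunField (b : MvPolynomial (Fin 3) ℚ)) := by
    intro P hP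
    have h1 := h P hP
    rw [← P.val_eq_one_iff hf, map_div₀] at h1
    exact (div_eq_one_iff_eq ((Valuation.ne_zero_iff _).2 hb')).1 h1
  obtain ⟨c, n, hc, e⟩ := hpoly a ha fun q hq hd =>
    key q a b hq hd (fun hd' => hq.not_isUnit (hab hd hd')) hb hval
  obtain ⟨d, m, hd, e'⟩ := hpoly b hb fun q hq hd =>
    key q b a hq hd (fun hd' => hq.not_isUnit (hab hd' hd)) ha fun P hP => (hval P hP).symm
  refine ⟨c / d, n + -m, div_ne_zero hc hd, ?_⟩
  have hd' : algebraMap ℚ FunField d ≠ 0 := by rwa [Ne, map_eq_zero]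
  have := character_ne_zero m
  rw [e, e', character_add, character_neg, map_div₀]
  field_simp

theorem val_le_one_of_mem_regularFunctions {S : Finset Ray} {f : FunField}
    (hf : f ∈ regularFunctions S) {P : PrimeDivisor} (hP : ¬ P.IsComponent S) : P.val f ≤ 1 := by
  obtain ⟨F, hF, hFP⟩ := P.exists_frame_hasChart
  have hf' : f ∈ chartRing (F.cone \ S) := by
    rw [regularFunctions, Algebra.mem_iInf] at hf
    exact Algebra.mem_iInf.1 (hf F.cone) hF
  clear hf
  induction hf' using Algebra.adjoin_induction with
  | mem x hx =>
    obtain ⟨n, hn, rfl⟩ := hx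
    rw [P.val_le_one_iff (character_ne_zero n)]
    rcases P.toric_or_meetsTorus with ⟨ρ, rfl⟩ | h
    · obtain ⟨i, hi⟩ := exists_mem_of_isToric (isToric_toric ρ) hFP
      rw [ord_toric_character]
      refine hn ρ (Finset.mem_sdiff.2 ⟨F.mem_cone.2 ⟨i, hi⟩, fun h => hP (isComponent_toric.2 h)⟩)
    · rw [h.ord_character]
  | algebraMap r => exact hFP.1 _ (Subalgebra.algebraMap_mem _ _)
  | add x y _ _ hx hy =>
    exact (P.val.map_add x y).trans (max_le hx hy)
  | mul x y _ _ hx hy => rw [map_mul]; exact mul_le_one' hx hy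

/-- All invertible regular functions on `U` are constant. -/
theorem subsingleton_E : Subsingleton (E boundary) := by
  have : constants boundary = ⊤ := by
    rw [eq_top_iff]
    rintro ⟨_, u, rfl⟩ -
    have hne : ((u : regularFunctions boundary) : FunField) ≠ 0 := by
      intro h0
      exact u.ne_zero (Subtype.ext h0)
    have hord : ∀ P : PrimeDivisor, ¬ P.IsComponent boundary →
        P.ord ((u : regularFunctions boundary) : FunField) = 0 := by
      intro P hP
      have h1 := val_le_one_of_mem_regularFunctions (u : regularFunctions boundary).2 hP
      have h2 := val_le_one_of_mem_regularFunctions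
        ((u⁻¹ : (regularFunctions boundary)ˣ) : regularFunctions boundary).2 hP
      have h3 : (((u⁻¹ : (regularFunctions boundary)ˣ) : regularFunctions boundary) : FunField) =
          ((u : regularFunctions boundary) : FunField)⁻¹ := by
        refine eq_inv_of_mul_eq_one_left ?_
        have := congrArg Subtype.val u.inv_mul
        exact this
      rw [h3, P.val_le_one_iff (inv_ne_zero hne), P.ord_inv] at h2
      rw [P.val_le_one_iff hne] at h1
      omega
    obtain ⟨c, n, hc, hu⟩ := exists_eq_const_mul_character hne
      fun P hP => hord P (hP.not_isComponent _)
    have hc' : algebraMap ℚ FunField c ≠ 0 := by rwa [Ne, map_eq_zero]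
    have hn : ∀ ρ, ρ ∉ boundary → pair n ρ = 0 := by
      intro ρ hρ
      have := hord (toric ρ) fun h => hρ (isComponent_toric.1 h)
      rwa [hu, ord_mul _ hc' (character_ne_zero n), ← isDivisorOf_const hc, Finsupp.zero_apply,
        zero_add, ord_toric_character] at this
    have hn0 : n = 0 := by
      have h1 := hn .a1 (by decide)
      have h2 := hn .b0 (by decide)
      have h3 := hn .c0 (by decide)
      simp [pair_eq, gen] at h1 h2 h3
      ext i
      fin_cases i <;> assumption
    rw [hn0, character_zero, mul_one] at hu
    rw [constants, Subgroup.mem_subgroupOf]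
    refine ⟨Units.mk0 c hc, ?_⟩
    ext
    exact hu.symm
  have h2 : Subsingleton (invertibleFunctions boundary ⧸ constants boundary) := by
    rw [this]
    exact QuotientGroup.subsingleton_quotient_top
  exact h2

theorem bInv_faceM : bInv faceM = 3 := by
  have := subsingleton_E
  rw [bInv, finrank_pic_boundary, Module.finrank_zero_of_subsingleton]
  decide

/-! ### The effective cone -/

/-- The chart of the cone spanned by `a0`, `b0`, `c0`, with the `i`-th ray replaced by its opposite. -/
def Frame.flip (i : Fin 3) : Frame where
  e := fun j => if j = i then ![.a1, .b1, .c1] j else ![.a0, .b0, .c0] j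
  m := fun j => if j = i then -Pi.single j 1 else Pi.single j 1
  dual := by revert i; decide

theorem pair_single_flip : ∀ i, pair (Pi.single i 1) ((Frame.flip i).e i) = -1 := by decide

/-- A polynomial has no zero along the divisor where one of the coordinates is infinite. -/
theorem one_le_val_flip (i : Fin 3) {p : MvPolynomial (Fin 3) ℚ} (hp : p ≠ 0) :
    1 ≤ (toric ((Frame.flip i).e i)).val (algebraMap _ FunField p) := by
  set v := (toric ((Frame.flip i).e i)).val
  have hadic := isAdic_frame (isToric_toric ((Frame.flip i).e i))
  have hX : v (algebraMap _ FunField (MvPolynomial.X i : MvPolynomial (Fin 3) ℚ)) =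
      WithZero.exp 1 := by
    rw [← character_single, val_character_of_isToric (isToric_toric _)]
    rw [pair_single_flip, neg_neg]
  have hmod : ∀ r : MvPolynomial (Fin 3) ℚ, r ≠ 0 → (∀ k ∈ r.support, k i = 0) →
      v (algebraMap _ FunField r) = 1 := by
    intro r hr h
    have h1 : (Frame.flip i).param r = algebraMap _ FunField r := by
      change ((Frame.flip i).param : MvPolynomial (Fin 3) ℚ →+* FunField) r = _
      refine MvPolynomial.hom_congr_vars ?_ ?_ rfl
      · ext c
        simp
      · intro j hj _
        obtain ⟨k, hk, hjk⟩ := (MvPolynomial.mem_vars_iff_mem_support j).1 hj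
        have hji : j ≠ i := by
          rintro rfl
          exact (Finsupp.mem_support_iff.1 hjk) (h k hk)
        change (Frame.flip i).param (MvPolynomial.X j) = _
        rw [Frame.param_X, Frame.coord, ← character_single]
        simp [Frame.flip, hji]
    rw [← h1, ← Frame.coe_chartEquiv]
    refine hadic.map_of_not_dvd ((Frame.flip i).chartEquiv r) ?_
    rw [← Frame.chartEquiv_X, map_dvd_iff]
    rw [MvPolynomial.X_dvd_iff_modMonomial_eq_zero]
    intro h0
    obtain ⟨k, hk⟩ := MvPolynomial.support_nonempty.2 hr
    have h2 := MvPolynomial.coeff_modMonomial_of_not_le (s' := k) (s := Finsupp.single i 1) r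
      (fun hle => by
        have := hle i
        rw [h k hk] at this
        simp at this)
    rw [h0, MvPolynomial.coeff_zero] at h2
    exact MvPolynomial.mem_support_iff.1 hk h2.symm
  have hind : ∀ (n : ℕ) (f : MvPolynomial (Fin 3) ℚ), (∀ k ∈ f.support, k i < n) → f ≠ 0 →
      1 ≤ v (algebraMap _ FunField f) := by
    intro n
    induction n with
    | zero =>
      intro f h hf
      obtain ⟨k, hk⟩ := MvPolynomial.support_nonempty.2 hf
      exact absurd (h k hk) (Nat.not_lt_zero _)
    | succ n ih =>
      intro f h hf
      have hdec := MvPolynomial.divMonomial_add_modMonomial_single f i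
      set s := f.divMonomial (Finsupp.single i 1)
      set r := f.modMonomial (Finsupp.single i 1)
      have hr : r ≠ 0 → v (algebraMap _ FunField r) = 1 := by
        intro hr0
        refine hmod r hr0 fun k hk => ?_
        by_contra hki
        have hle : Finsupp.single i 1 ≤ k := by
          rw [Finsupp.single_le_iff]; omega
        exact MvPolynomial.mem_support_iff.1 hk (MvPolynomial.coeff_modMonomial_of_le f hle)
      have hr' : v (algebraMap _ FunField r) ≤ 1 := by
        by_cases hr0 : r = 0
        · simp [hr0]
        · exact (hr hr0).le
      by_cases hs : s = 0
      · rw [hs, mul_zero, zero_add] at hdec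
        rw [← hdec]
        exact (hr (by rwa [hdec])).ge
      · have h1 : 1 ≤ v (algebraMap _ FunField s) := by
          refine ih s (fun k hk => ?_) hs
          rw [MvPolynomial.mem_support_iff, MvPolynomial.coeff_divMonomial] at hk
          have := h _ (MvPolynomial.mem_support_iff.2 hk)
          simp at this
          omega
        have h2 : 1 < v (algebraMap _ FunField (MvPolynomial.X i * s)) := by
          rw [map_mul, map_mul, hX]
          calc (1 : WithZero (Multiplicative ℤ)) < WithZero.exp 1 := by
                rw [← WithZero.exp_zero, WithZero.exp_lt_exp]; omega
            _ = WithZero.exp 1 * 1 := (mul_one _).symm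
            _ ≤ _ := by gcongr
        rw [← hdec, map_add, Valuation.map_add_eq_of_lt_left _ (hr'.trans_lt h2)]
        exact h2.le
  refine hind (p.degreeOf i + 1) p (fun k hk => ?_) hp
  exact Nat.lt_succ_of_le (MvPolynomial.monomial_le_degreeOf i hk)

theorem ord_std_eqn {Q : PrimeDivisor} (hQ : Q.MeetsTorus) (i : Fin 3) :
    (toric (Frame.std.e i)).ord Q.eqn = 0 := by
  have h1 := isAdic_frame (isToric_toric (Frame.std.e i))
  rw [← Frame.chartEquiv_X, isAdic_std] at h1
  rw [← val_eq_one_iff _ hQ.eqn_ne_zero]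
  refine h1.map_of_not_dvd _ fun hd => ?_
  exact not_meetsTorus_of_dvd hQ.isAdic_poly
    (h1.prime.associated_of_dvd hQ.isAdic_poly.prime hd).symm.dvd hQ

theorem ord_flip_eqn {Q : PrimeDivisor} (hQ : Q.MeetsTorus) (i : Fin 3) :
    (toric ((Frame.flip i).e i)).ord Q.eqn ≤ 0 := by
  have h1 := one_le_val_flip i hQ.isAdic_poly.prime.ne_zero
  have h2 := val_eq_exp (toric ((Frame.flip i).e i)) hQ.eqn_ne_zero
  rw [eqn] at h2
  rw [h2, ← WithZero.exp_zero, WithZero.exp_le_exp] at h1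
  exact neg_nonneg.1 h1

/-- Effective divisors on the complement of `E₁ + E₂` have nonnegative degree. -/
theorem primeDegree_weightM_nonneg (P : PrimeDivisor) (i : Fin 3) :
    0 ≤ primeDegree weightM P i := by
  rcases P.toric_or_meetsTorus with ⟨ρ, rfl⟩ | hP
  · rw [primeDegree_toric]
    revert ρ i
    decide
  · rw [primeDegree_meetsTorus _ hP, sum_weightM]
    have h0 := ord_std_eqn hP i
    have h1 := ord_flip_eqn hP i
    fin_cases i <;> simp [Frame.std, Frame.flip] at h0 h1 ⊢ <;> omega

open PrimeDivisor

/-! ### The log canonical class -/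

/-- The universal derivation of the function field. -/
noncomputable abbrev dif : Derivation ℚ FunField Ω[FunField⁄ℚ] := KaehlerDifferential.D ℚ FunField

/-- Elements of a top exterior power are multiples of the exterior product of a basis. -/
theorem ιMulti_eq_det_smul {K V : Type*} [Field K] [AddCommGroup V] [Module K V] {n : ℕ}
    (b : Module.Basis (Fin n) K V) (v : Fin n → V) :
    exteriorPower.ιMulti K n v = b.det v • exteriorPower.ιMulti K n b := by
  let g : V [⋀^Fin n]→ₗ[K] ⋀[K]^n V :=
    (LinearMap.toSpanSingleton K _ (exteriorPower.ιMulti K n b)).compAlternatingMap b.det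
  change exteriorPower.ιMulti K n v = g v
  congr 1
  refine b.ext_alternating fun σ hσ => ?_
  let e : Equiv.Perm (Fin n) := Equiv.ofBijective σ (Finite.injective_iff_bijective.1 hσ)
  change exteriorPower.ιMulti K n (⇑b ∘ e) = g (⇑b ∘ e)
  rw [AlternatingMap.map_perm, AlternatingMap.map_perm]
  congr 1
  simp [g, b.det_self]

theorem ιMulti_basis_ne_zero {K V : Type*} [Field K] [AddCommGroup V] [Module K V] {n : ℕ}
    (b : Module.Basis (Fin n) K V) : exteriorPower.ιMulti K n b ≠ 0 := by
  intro h
  have h1 := exteriorPower.alternatingMapLinearEquiv_apply_ιMulti b.det b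
  rw [h, map_zero, b.det_self] at h1
  exact zero_ne_one h1

theorem exists_eq_smul_ιMulti {K V : Type*} [Field K] [AddCommGroup V] [Module K V] {n : ℕ}
    (b : Module.Basis (Fin n) K V) (x : ⋀[K]^n V) :
    ∃ c : K, x = c • exteriorPower.ιMulti K n b := by
  have hx : x ∈ Submodule.span K (Set.range (exteriorPower.ιMulti K n (M := V))) := by
    rw [exteriorPower.ιMulti_span]; trivial
  induction hx using Submodule.span_induction with
  | mem x hx =>
    obtain ⟨v, rfl⟩ := hx
    exact ⟨_, ιMulti_eq_det_smul b v⟩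
  | zero => exact ⟨0, (zero_smul _ _).symm⟩
  | add x y _ _ hx hy =>
    obtain ⟨c, rfl⟩ := hx
    obtain ⟨d, rfl⟩ := hy
    exact ⟨c + d, (add_smul _ _ _).symm⟩
  | smul a x _ hx =>
    obtain ⟨c, rfl⟩ := hx
    exact ⟨a * c, smul_smul _ _ _⟩

/-- The differentials of the coordinates form a basis of the differentials of the function field. -/
noncomputable def basisX : Module.Basis (Fin 3) FunField Ω[FunField⁄ℚ] :=
  (KaehlerDifferential.mvPolynomialBasis ℚ (Fin 3)).ofIsLocalizedModule FunField
    (nonZeroDivisors (MvPolynomial (Fin 3) ℚ))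
    (KaehlerDifferential.map ℚ ℚ (MvPolynomial (Fin 3) ℚ) FunField)

namespace Frame

variable (F : Frame)

/-- Differentials of regular functions on the chart are combinations of the differentials of
the coordinates, with regular coefficients. -/
theorem exists_dif_eq_of_mem {f : FunField} (hf : f ∈ chartRing F.cone) :
    ∃ c : Fin 3 → FunField, (∀ i, c i ∈ chartRing F.cone) ∧
      dif f = ∑ i, c i • dif (F.coord i) := by
  rw [← F.range_param] at hf
  obtain ⟨p, rfl⟩ := hf
  change ∃ c : Fin 3 → FunField, _ ∧ dif (F.param p) = _
  induction p using MvPolynomial.induction_on with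
  | C a =>
    refine ⟨0, fun i => zero_mem _, ?_⟩
    have : F.param (MvPolynomial.C a) = algebraMap ℚ FunField a := MvPolynomial.aeval_C _ _
    rw [this, Derivation.map_algebraMap]
    simp
  | add p q hp hq =>
    obtain ⟨c, hc, h⟩ := hp
    obtain ⟨d, hd, h'⟩ := hq
    exact ⟨c + d, fun i => add_mem (hc i) (hd i), by
      simp only [map_add, h, h', Pi.add_apply, add_smul, Finset.sum_add_distrib]⟩
  | mul_X p j hp =>
    obtain ⟨c, hc, h⟩ := hp
    refine ⟨F.coord j • c + Pi.single j (F.param p), fun i => ?_, ?_⟩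
    · refine add_mem (mul_mem (F.coord_mem j) (hc i)) ?_
      by_cases hij : i = j
      · subst hij
        rw [Pi.single_eq_same, ← F.range_param]
        exact ⟨p, rfl⟩
      · rw [Pi.single_eq_of_ne hij]
        exact zero_mem _
    · rw [map_mul, param_X, Derivation.leibniz, h]
      simp only [Pi.add_apply, Pi.smul_apply, add_smul, Finset.sum_add_distrib, Finset.smul_sum,
        smul_smul, smul_eq_mul]
      rw [add_comm]
      congr 1
      rw [Finset.sum_eq_single j]
      · simp
      · intro i _ hij
        simp [Pi.single_eq_of_ne hij]
      · simp

theorem exists_dif_eq_of_mul_eq {f g h : FunField} (hh : h ≠ 0) (hfg : f * h = g)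
    {c d : Fin 3 → FunField} (hg : dif g = ∑ i, c i • dif (F.coord i))
    (hh' : dif h = ∑ i, d i • dif (F.coord i)) :
    dif f = ∑ i, (h⁻¹ * (c i - f * d i)) • dif (F.coord i) := by
  have h1 : h • dif f = dif g - f • dif h := by
    rw [← hfg, Derivation.leibniz]; abel
  have h2 : dif f = h⁻¹ • (dif g - f • dif h) := by
    rw [← h1, smul_smul, inv_mul_cancel₀ hh, one_smul]
  rw [h2, hg, hh']
  simp only [Finset.smul_sum, ← Finset.sum_sub_distrib, smul_smul, ← sub_smul]

theorem span_dif_coord : ⊤ ≤ Submodule.span FunField (Set.range fun i => dif (F.coord i)) := by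
  rw [← KaehlerDifferential.span_range_derivation, Submodule.span_le]
  rintro _ ⟨f, rfl⟩
  obtain ⟨g, h, hh, rfl⟩ := IsFractionRing.div_surjective (A := chartRing F.cone) f
  obtain ⟨c, -, hc⟩ := F.exists_dif_eq_of_mem g.2
  obtain ⟨d, -, hd⟩ := F.exists_dif_eq_of_mem h.2
  have hh0 : (h : FunField) ≠ 0 := IsFractionRing.to_map_ne_zero_of_mem_nonZeroDivisors hh
  change dif ((g : FunField) / (h : FunField)) ∈ _
  rw [F.exists_dif_eq_of_mul_eq hh0 (div_mul_cancel₀ _ hh0) hc hd]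
  exact Submodule.sum_mem _ fun i _ => Submodule.smul_mem _ _ (Submodule.subset_span ⟨i, rfl⟩)

/-- The differentials of the coordinates of a chart, as a basis. -/
noncomputable def basis : Module.Basis (Fin 3) FunField Ω[FunField⁄ℚ] :=
  basisOfTopLeSpanOfCardEqFinrank (fun i => dif (F.coord i)) F.span_dif_coord
    (by rw [Module.finrank_eq_card_basis basisX])

theorem basis_apply (i : Fin 3) : F.basis i = dif (F.coord i) := by
  simp [basis]

/-- The form `dy₀ ∧ dy₁ ∧ dy₂` in the coordinates of the chart. -/
noncomputable def form : ⋀[FunField]^3 Ω[FunField⁄ℚ] := exteriorPower.ιMulti FunField 3 F.basis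

theorem form_ne_zero : F.form ≠ 0 := ιMulti_basis_ne_zero _

theorem exists_dif_eq {P : PrimeDivisor} (hP : P.HasChart F.cone) {f : FunField}
    (hf : P.val f ≤ 1) :
    ∃ c : Fin 3 → FunField, (∀ i, P.val (c i) ≤ 1) ∧ dif f = ∑ i, c i • dif (F.coord i) := by
  obtain ⟨g, hg, h, hh, hv, hfg⟩ := hP.2 f hf
  obtain ⟨c, hc, hc'⟩ := F.exists_dif_eq_of_mem hg
  obtain ⟨d, hd, hd'⟩ := F.exists_dif_eq_of_mem hh
  have hh0 : h ≠ 0 := by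
    rintro rfl
    simp at hv
  refine ⟨_, fun i => ?_, F.exists_dif_eq_of_mul_eq hh0 hfg hc' hd'⟩
  rw [map_mul, map_inv₀, hv, inv_one, one_mul]
  refine (P.val.map_sub _ _).trans (max_le (hP.1 _ (hc i)) ?_)
  rw [map_mul]
  exact mul_le_one' hf (hP.1 _ (hd i))

/-- The stalk of the canonical sheaf at a prime divisor is generated by `dy₀ ∧ dy₁ ∧ dy₂`. -/
theorem mem_canonicalStalk_iff {P : PrimeDivisor} (hP : P.HasChart F.cone) (f : FunField) :
    f • F.form ∈ canonicalStalk P ↔ P.val f ≤ 1 := by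
  constructor
  · have key : ∀ x ∈ canonicalStalk P, ∃ u, P.val u ≤ 1 ∧ x = u • F.form := by
      intro x hx
      induction hx using Submodule.span_induction with
      | mem x hx =>
        obtain ⟨f, rfl⟩ := hx
        choose c hc hc' using fun i => F.exists_dif_eq hP (f i).2
        refine ⟨_, ?_, ιMulti_eq_det_smul F.basis _⟩
        let M : Matrix (Fin 3) (Fin 3) P.val.integer := fun i j => ⟨c j i, hc j i⟩
        have : F.basis.det (fun i => dif (f i : FunField)) = ((M.det : P.val.integer) : FunField) := by
          rw [Module.Basis.det_apply]
          have h1 : ((M.det : P.val.integer) : FunField) = P.val.integer.subtype M.det := rfl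
          rw [h1, RingHom.map_det]
          congr 1
          ext i j
          rw [Module.Basis.toMatrix_apply, hc' j]
          simp only [← F.basis_apply, map_sum, map_smul, Module.Basis.repr_self]
          simp [M, Finsupp.single_apply]
          rfl
        rw [this]
        exact M.det.2
      | zero => exact ⟨0, by simp, (zero_smul _ _).symm⟩
      | add x y _ _ hx hy =>
        obtain ⟨c, hc, rfl⟩ := hx
        obtain ⟨d, hd, rfl⟩ := hy
        exact ⟨c + d, (P.val.map_add c d).trans (max_le hc hd), (add_smul _ _ _).symm⟩
      | smul a x _ hx =>
        obtain ⟨c, hc, rfl⟩ := hx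
        refine ⟨a * c, ?_, smul_smul (a : FunField) _ _⟩
        rw [map_mul]
        exact mul_le_one' a.2 hc
    intro h
    obtain ⟨u, hu, e⟩ := key _ h
    rwa [smul_left_injective _ F.form_ne_zero e]
  · intro hf
    have : f • F.form = (⟨f, hf⟩ : P.val.integer) • F.form := rfl
    rw [this]
    refine Submodule.smul_mem _ _ (Submodule.subset_span ?_)
    refine ⟨fun i => ⟨F.coord i, hP.1 _ (F.coord_mem i)⟩, ?_⟩
    rw [form]
    congr 1
    ext i
    exact F.basis_apply i

end Frame

/-- The logarithmic differential of characters. -/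
noncomputable def dlog : (Fin 3 → ℤ) →+ Ω[FunField⁄ℚ] where
  toFun n := (character n)⁻¹ • dif (character n)
  map_zero' := by simp [character_zero]
  map_add' n m := by
    have h1 := character_ne_zero n
    have h2 := character_ne_zero m
    rw [character_add, Derivation.leibniz, smul_add, smul_smul, smul_smul, add_comm]
    congr 2 <;> field_simp

theorem dif_character (n : Fin 3 → ℤ) : dif (character n) = character n • dlog n := by
  change dif (character n) = character n • ((character n)⁻¹ • dif (character n))
  rw [smul_smul, mul_inv_cancel₀ (character_ne_zero n), one_smul]

/-- Change of charts for the top forms. -/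
theorem Frame.form_eq (F : Frame) : ∃ c : ℚ, c ≠ 0 ∧
    F.form = (algebraMap ℚ FunField c * character (∑ i, F.m i - 1)) • Frame.std.form := by
  have hdet : (Matrix.of F.m).det ≠ 0 := by
    intro h
    have := congrArg Matrix.det F.mul_eq_one
    rw [Matrix.det_mul, h, zero_mul, Matrix.det_one] at this
    exact zero_ne_one this
  refine ⟨((Matrix.of F.m).det : ℤ), Int.cast_ne_zero.2 hdet, ?_⟩
  rw [Frame.form, ιMulti_eq_det_smul Frame.std.basis]
  congr 1
  have hd : ∀ i, dif (F.coord i) =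
      ∑ j, (F.coord i * ((F.m i j : ℤ) : FunField) * (Frame.std.coord j)⁻¹) • Frame.std.basis j := by
    intro i
    rw [Frame.coord, dif_character]
    have hm : F.m i = ∑ j, F.m i j • Pi.single j (1 : ℤ) := by
      ext k
      simp [Finset.sum_apply, Pi.single_apply]
    conv_lhs => rw [hm]
    rw [map_sum, ← hm, Finset.smul_sum]
    refine Finset.sum_congr rfl fun j _ => ?_
    rw [map_zsmul, Frame.basis_apply, Frame.coord, mul_assoc, mul_smul, mul_smul]
    have : Frame.std.m j = Pi.single j 1 := rfl
    rw [this]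
    congr 1
    rw [Int.cast_smul_eq_zsmul]
    rfl
  rw [Module.Basis.det_apply]
  have hM : Frame.std.basis.toMatrix F.basis =
      Matrix.diagonal (fun j => (Frame.std.coord j)⁻¹) *
        (Matrix.of F.m).transpose.map (Int.cast : ℤ → FunField) *
          Matrix.diagonal (fun i => F.coord i) := by
    ext j i
    rw [Module.Basis.toMatrix_apply, F.basis_apply, hd, Matrix.mul_diagonal, Matrix.diagonal_mul]
    simp only [map_sum, map_smul, Module.Basis.repr_self]
    simp [Finsupp.single_apply]
    ring
  rw [hM, Matrix.det_mul, Matrix.det_mul, Matrix.det_diagonal, Matrix.det_diagonal]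
  have h2 : ((Matrix.of F.m).transpose.map (Int.cast : ℤ → FunField)).det =
      (((Matrix.of F.m).det : ℤ) : FunField) := by
    have := RingHom.map_det (Int.castRingHom FunField) (Matrix.of F.m).transpose
    rw [Matrix.det_transpose] at this
    exact this.symm
  have h3 : ∏ i, F.coord i = character (∑ i, F.m i) := by
    have := character_sum_smul Finset.univ (fun _ => 1) F.m
    simp only [one_smul, zpow_one] at this
    exact this.symm
  have h4 : ∏ i, (Frame.std.coord i)⁻¹ = character (-1) := by
    have := character_sum_smul Finset.univ (fun _ => -1) Frame.std.m
    simp only [zpow_neg, zpow_one] at this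
    rw [show (fun i => (Frame.std.coord i)⁻¹) = fun i => (character (Frame.std.m i))⁻¹ from rfl,
      ← this]
    congr 1
    ext k
    fin_cases k <;> simp [Frame.std]
  rw [h2, h3, h4, sub_eq_add_neg, character_add]
  simp only [map_intCast]
  ring

/-- The order of the form `dX₀ ∧ dX₁ ∧ dX₂` along the prime divisors of `X`. -/
theorem smul_form_mem_canonicalStalk_iff (P : PrimeDivisor) {f : FunField} (hf : f ≠ 0) :
    f • Frame.std.form ∈ canonicalStalk P ↔
      0 ≤ P.ord f + toricDivisor (fun ρ => pair 1 ρ - 1) P := by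
  obtain ⟨F, -, hF⟩ := P.exists_frame_hasChart
  obtain ⟨c, hc, e⟩ := F.form_eq
  have hc' : algebraMap ℚ FunField c ≠ 0 := by rwa [Ne, map_eq_zero]
  have hu := mul_ne_zero hc' (character_ne_zero (∑ i, F.m i - 1))
  have h1 : f • Frame.std.form =
      (f * (algebraMap ℚ FunField c * character (∑ i, F.m i - 1))⁻¹) • F.form := by
    rw [e, smul_smul, mul_assoc, inv_mul_cancel₀ hu, mul_one]
  rw [h1, F.mem_canonicalStalk_iff hF, P.val_le_one_iff (mul_ne_zero hf (inv_ne_zero hu)),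
    P.ord_mul hf (inv_ne_zero hu), P.ord_inv, P.ord_mul hc' (character_ne_zero _),
    ← isDivisorOf_const hc, Finsupp.zero_apply, zero_add]
  rcases P.toric_or_meetsTorus with ⟨ρ, rfl⟩ | hP
  · obtain ⟨i, rfl⟩ := exists_mem_of_isToric (isToric_toric ρ) hF
    rw [toricDivisor_toric, ord_toric_character, sub_eq_add_neg, pair_add, pair_neg]
    have : pair (∑ j, F.m j) (F.e i) = 1 := by
      have := pair_sum_smul Finset.univ (fun _ => 1) F.m (F.e i)
      simp only [one_smul, one_mul, F.dual] at this
      simpa using this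
    rw [this]
    constructor <;> intro h <;> linarith
  · rw [toricDivisor_meetsTorus _ hP, hP.ord_character, neg_zero]

theorem PrimeDivisor.exists_ord_eq (P : PrimeDivisor) (n : ℤ) : ∃ f, f ≠ 0 ∧ P.ord f = n := by
  obtain ⟨f, hf⟩ := P.surjective (WithZero.exp (-n))
  refine ⟨f, ?_, by rw [ord, hf, WithZero.log_exp, neg_neg]⟩
  rintro rfl
  rw [map_zero] at hf
  exact WithZero.exp_ne_zero hf.symm

open Classical in
theorem toricDivisor_formExp (P : PrimeDivisor) :
    toricDivisor formExp P =
      toricDivisor (fun ρ => pair 1 ρ - 1) P + if P.IsComponent boundary then 1 else 0 := by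
  have h1 : ∀ ρ, pair ![1, 1, 1] ρ = pair 1 ρ := fun ρ => by
    congr 1
    ext i
    fin_cases i <;> rfl
  rcases P.toric_or_meetsTorus with ⟨ρ, rfl⟩ | hP
  · simp only [toricDivisor_toric, formExp, isComponent_toric, h1]
  · rw [toricDivisor_meetsTorus _ hP, toricDivisor_meetsTorus _ hP, if_neg (hP.not_isComponent _),
      add_zero]

theorem isLogCanonicalDivisor_formExp : IsLogCanonicalDivisor (toricDivisor formExp) := by
  refine ⟨Frame.std.form, Frame.std.form_ne_zero, fun P f hf => ?_⟩
  rw [smul_form_mem_canonicalStalk_iff P hf, toricDivisor_formExp]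
  constructor <;> intro h <;> linarith

/-- All log canonical divisors are linearly equivalent. -/
theorem IsLogCanonicalDivisor.exists_isDivisorOf {L : PrimeDivisor →₀ ℤ}
    (h : IsLogCanonicalDivisor L) :
    ∃ g : FunField, g ≠ 0 ∧ IsDivisorOf (L - toricDivisor formExp) g := by
  classical
  obtain ⟨ω, hω, hL⟩ := h
  obtain ⟨g, rfl⟩ := exists_eq_smul_ιMulti Frame.std.basis ω
  have hg : g ≠ 0 := by
    rintro rfl
    exact hω (zero_smul _ _)
  refine ⟨g, hg, fun P => ?_⟩
  have key : ∀ f, f ≠ 0 → (0 ≤ P.ord f + (P.ord g + toricDivisor (fun ρ => pair 1 ρ - 1) P) ↔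
      0 ≤ P.ord f + (L P - if P.IsComponent boundary then 1 else 0)) := by
    intro f hf
    have h1 := hL P f hf
    rw [smul_smul] at h1
    have h2 := smul_form_mem_canonicalStalk_iff P (mul_ne_zero hf hg)
    rw [P.ord_mul hf hg] at h2
    rw [← add_assoc, ← h2, ← add_sub_assoc]
    exact h1
  obtain ⟨f₁, hf₁, e₁⟩ := P.exists_ord_eq (-(P.ord g + toricDivisor (fun ρ => pair 1 ρ - 1) P))
  obtain ⟨f₂, hf₂, e₂⟩ := P.exists_ord_eq (-(L P - if P.IsComponent boundary then 1 else 0))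
  have k1 := key f₁ hf₁
  have k2 := key f₂ hf₂
  rw [e₁] at k1
  rw [e₂] at k2
  rw [Finsupp.sub_apply, toricDivisor_formExp]
  have := k1.1 (by simp)
  have := k2.2 (by simp)
  linarith

theorem picEquiv_logAnticanonicalClass :
    isGrading_weightM.picEquiv (logAnticanonicalClass faceM) = ![1, 2, 2] := by
  obtain ⟨g, hg, h⟩ := (Classical.epsilon_spec
    ⟨_, isLogCanonicalDivisor_formExp⟩ :
      IsLogCanonicalDivisor (Classical.epsilon IsLogCanonicalDivisor)).exists_isDivisorOf
  obtain ⟨L', hL', h0⟩ := exists_isDivisorOf weightM isGrading_weightM.pair_smul hg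
  have e : L' = Classical.epsilon IsLogCanonicalDivisor - toricDivisor formExp := by
    ext P
    rw [hL', h]
  rw [e, map_sub, sub_eq_zero] at h0
  rw [logAnticanonicalClass, isGrading_weightM.picEquiv_mk, map_neg,
    degreeOn_restrict _ isGrading_weightM.eq_zero, h0, degree_toricDivisor, sum_weightM]
  decide

open PrimeDivisor

/-! ### The constant `α_M` -/

/-- The integral of a product of functions of one variable. -/
theorem lintegral_pi_prod {α : Type*} [MeasurableSpace α] (μ : Measure α) [SigmaFinite μ] :
    ∀ {n : ℕ} (f : Fin n → α → ℝ≥0∞), (∀ i, Measurable (f i)) →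
      ∫⁻ x, ∏ i, f i (x i) ∂(Measure.pi fun _ : Fin n => μ) = ∏ i, ∫⁻ x, f i x ∂μ
  | 0, f, _ => by simp
  | n + 1, f, hf => by
    have ih := lintegral_pi_prod μ (fun i => f (Fin.succ i)) fun i => hf _
    have h := (measurePreserving_piFinSuccAbove (fun _ : Fin (n + 1) => μ) 0).symm
    rw [← h.lintegral_comp]
    · simp only [Fin.prod_univ_succ]
      rw [← ih, ← lintegral_prod_mul (hf 0).aemeasurable]
      · rfl
      · exact (Finset.measurable_prod _ fun i _ =>
          (hf _).comp (measurable_pi_apply i)).aemeasurable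
    · exact Finset.measurable_prod _ fun i _ => (hf i).comp (measurable_pi_apply i)

theorem lintegral_exp_neg_mul {k : ℝ} (hk : 0 < k) :
    ∫⁻ s in Set.Ici (0 : ℝ), ENNReal.ofReal (Real.exp (-(k * s))) = ENNReal.ofReal (1 / k) := by
  rw [setLIntegral_congr Ioi_ae_eq_Ici.symm]
  have hneg : ∀ s : ℝ, -(k * s) = -k * s := fun s => by ring
  simp only [hneg]
  rw [← ofReal_integral_eq_lintegral_ofReal]
  · rw [integral_exp_mul_Ioi (by linarith)]
    simp
  · exact exp_neg_integrableOn_Ioi 0 hk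
  · exact Filter.Eventually.of_forall fun s => (Real.exp_pos _).le

theorem lintegral_orthant :
    ∫⁻ s in {s : Fin 3 → ℝ | ∀ i, 0 ≤ s i},
      ENNReal.ofReal (Real.exp (-(s 0 + 2 * s 1 + 2 * s 2))) = ENNReal.ofReal (1 / 4) := by
  have hset : {s : Fin 3 → ℝ | ∀ i, 0 ≤ s i} = Set.univ.pi fun _ => Set.Ici 0 := by
    ext s
    simp [Pi.le_def]
  let k : Fin 3 → ℝ := ![1, 2, 2]
  have hfun : ∀ s : Fin 3 → ℝ, ENNReal.ofReal (Real.exp (-(s 0 + 2 * s 1 + 2 * s 2))) =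
      ∏ i, ENNReal.ofReal (Real.exp (-(k i * s i))) := by
    intro s
    rw [← ENNReal.ofReal_prod_of_nonneg fun _ _ => (Real.exp_pos _).le, ← Real.exp_sum]
    congr 2
    simp [k, Fin.sum_univ_three, add_comm]
  rw [hset, volume_pi, Measure.restrict_pi_pi]
  simp only [hfun]
  rw [lintegral_pi_prod _ (fun i s => ENNReal.ofReal (Real.exp (-(k i * s))))]
  · have h0 : k 0 = 1 := rfl
    have h1 : k 1 = 2 := rfl
    have h2 : k 2 = 2 := rfl
    rw [Fin.prod_univ_three, h0, h1, h2, lintegral_exp_neg_mul one_pos,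
      lintegral_exp_neg_mul two_pos, ← ENNReal.ofReal_mul (by norm_num),
      ← ENNReal.ofReal_mul (by norm_num)]
    norm_num
  · intro i
    fun_prop

section Lattice

variable {Λ : Type*} [AddCommGroup Λ]

theorem linearForm_tmul {n : ℕ} (B : Module.Basis (Fin n) ℤ Λ) (s : Fin n → ℝ) (x : Λ) :
    linearForm B s ((1 : ℝ) ⊗ₜ[ℤ] x) = ∑ i, (B.repr x i : ℝ) * s i := by
  have h : (1 : ℝ) ⊗ₜ[ℤ] x = ∑ i, (B.repr x i : ℝ) • Algebra.TensorProduct.basis ℝ B i := by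
    conv_lhs => rw [← B.sum_repr x, TensorProduct.tmul_sum]
    refine Finset.sum_congr rfl fun i _ => ?_
    rw [Algebra.TensorProduct.basis_apply, TensorProduct.tmul_smul]
    exact (Int.cast_smul_eq_zsmul ℝ (B.repr x i) ((1 : ℝ) ⊗ₜ[ℤ] B i)).symm
  rw [h, map_sum]
  refine Finset.sum_congr rfl fun i _ => ?_
  rw [map_smul, linearForm, Module.Basis.constr_basis, smul_eq_mul]

/-- The characteristic function of a cone does not depend on the choice of a basis. -/
theorem characteristicFunction_eq {n : ℕ} (B B₀ : Module.Basis (Fin n) ℤ Λ)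
    (C : Set (ℝ ⊗[ℤ] Λ)) (x : ℝ ⊗[ℤ] Λ) :
    characteristicFunction B C x = characteristicFunction B₀ C x := by
  -- the base change matrix has determinant `±1`
  let Q : Matrix (Fin n) (Fin n) ℤ := (B.toMatrix B₀).transpose
  let A : Matrix (Fin n) (Fin n) ℝ := Q.map (Int.cast : ℤ → ℝ)
  have hQ : |Q.det| = 1 := by
    rw [← Int.isUnit_iff_abs_eq, Matrix.det_transpose, ← Module.Basis.det_apply]
    exact B.isUnit_det B₀
  have hA : A.det = (Q.det : ℝ) := (RingHom.map_det (Int.castRingHom ℝ) Q).symm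
  have hA1 : |A.det| = 1 := by
    rw [hA, ← Int.cast_abs, hQ, Int.cast_one]
  have hA0 : A.det ≠ 0 := by
    intro h
    rw [h] at hA1
    simp at hA1
  have hform : ∀ s, linearForm B s = linearForm B₀ (Matrix.toLin' A s) := by
    intro s
    refine (Algebra.TensorProduct.basis ℝ B₀).ext fun j => ?_
    have h1 : linearForm B₀ (Matrix.toLin' A s) (Algebra.TensorProduct.basis ℝ B₀ j) =
        Matrix.toLin' A s j := Module.Basis.constr_basis _ _ _ _
    rw [h1, Algebra.TensorProduct.basis_apply, linearForm_tmul, Matrix.toLin'_apply,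
      Matrix.mulVec, dotProduct]
    rfl
  have hmp : MeasurePreserving (Matrix.toLin' A) (volume : Measure (Fin n → ℝ)) volume := by
    refine ⟨(LinearMap.continuous_of_finiteDimensional _).measurable, ?_⟩
    rw [Real.map_matrix_volume_pi_eq_smul_volume_pi hA0, abs_inv, hA1]
    simp
  have hemb : MeasurableEmbedding (Matrix.toLin' A) := by
    have hu : IsUnit A.det := isUnit_iff_ne_zero.2 hA0
    let e := Matrix.toLinearEquiv' A (Matrix.invertibleOfIsUnitDet A hu)
    exact e.toContinuousLinearEquiv.toHomeomorph.measurableEmbedding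
  rw [characteristicFunction, characteristicFunction,
    ← hmp.setLIntegral_comp_preimage_emb hemb _ {s | ∀ v ∈ C, 0 ≤ linearForm B₀ s v}]
  simp only [hform]
  rfl

end Lattice

theorem effectiveCone_dual {n : ℕ} (h : n = 3) (B : Module.Basis (Fin n) ℤ (PicA faceM)) :
    characteristicFunction B (effectiveCone faceM : Set (ℝ ⊗[ℤ] PicA faceM))
      ((1 : ℝ) ⊗ₜ[ℤ] logAnticanonicalClass faceM) = ENNReal.ofReal (1 / 4) := by
  subst h
  let B₀ : Module.Basis (Fin 3) ℤ (PicA faceM) :=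
    Module.Basis.ofEquivFun isGrading_weightM.picEquiv.toIntLinearEquiv
  have hrepr : ∀ x i, B₀.repr x i = isGrading_weightM.picEquiv x i := fun x i => by
    simp [B₀]
  rw [characteristicFunction_eq B B₀, ← lintegral_orthant, characteristicFunction]
  have hset : {s : Fin 3 → ℝ | ∀ v ∈ (effectiveCone faceM : Set (ℝ ⊗[ℤ] PicA faceM)),
      0 ≤ linearForm B₀ s v} = {s | ∀ i, 0 ≤ s i} := by
    ext s
    constructor
    · intro h i
      let ρ : Ray := ![.a0, .b0, .c0] i
      have hdeg : degreeOn weightM (boundary \ faceM) (restrict (boundary \ faceM)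
          (toricDivisor (Pi.single ρ 1))) = Pi.single i 1 := by
        rw [degreeOn_restrict _ isGrading_weightM.eq_zero, degree_toricDivisor]
        revert i
        simp only [sum_weightM]
        decide
      have h1 := h ((1 : ℝ) ⊗ₜ[ℤ] (QuotientAddGroup.mk (restrict (boundary \ faceM)
          (toricDivisor (Pi.single ρ 1))) : PicA faceM)) (by
        refine Submodule.subset_span ⟨_, fun P => ?_, rfl⟩
        rw [restrict, Finsupp.subtypeDomain_apply, Finsupp.zero_apply]
        rcases P.1.toric_or_meetsTorus with ⟨ρ', hρ'⟩ | hP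
        · rw [hρ', toricDivisor_toric]
          by_cases hρ : ρ' = ρ
          · rw [hρ, Pi.single_eq_same]; exact zero_le_one
          · rw [Pi.single_eq_of_ne hρ]
        · rw [toricDivisor_meetsTorus _ hP])
      rw [linearForm_tmul] at h1
      simp only [hrepr, isGrading_weightM.picEquiv_mk] at h1
      rw [hdeg, Finset.sum_eq_single i] at h1
      · simpa using h1
      · intro j _ hj
        simp [Pi.single_eq_of_ne hj]
      · simp
    · intro h v hv
      induction hv using Submodule.span_induction with
      | mem v hv =>
        obtain ⟨L, hL, rfl⟩ := hv
        rw [linearForm_tmul]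
        refine Finset.sum_nonneg fun i _ => mul_nonneg ?_ (h i)
        rw [hrepr, isGrading_weightM.picEquiv_mk, Int.cast_nonneg_iff, degreeOn,
          Finsupp.linearCombination_apply, Finsupp.sum, Finset.sum_apply]
        exact Finset.sum_nonneg fun P _ => mul_nonneg (hL P) (primeDegree_weightM_nonneg _ _)
      | zero => simp
      | add v w _ _ hv hw => rw [map_add]; exact add_nonneg hv hw
      | smul a v _ hv =>
        have : linearForm B₀ s (a • v) = (a : ℝ) * linearForm B₀ s v := map_smul _ (a : ℝ) v
        rw [this]
        exact mul_nonneg a.2 hv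
  rw [hset]
  have hx : ∀ s, linearForm B₀ s ((1 : ℝ) ⊗ₜ[ℤ] logAnticanonicalClass faceM) =
      s 0 + 2 * s 1 + 2 * s 2 := by
    intro s
    rw [linearForm_tmul]
    simp only [hrepr, picEquiv_logAnticanonicalClass, Fin.sum_univ_three]
    simp
  simp only [hx]

theorem alpha_faceM : alpha faceM = 1 / 8 := by
  have h : Nonempty (Module.Basis (Fin (bInv' faceM)) ℤ (PicA faceM)) := by
    rw [bInv'_faceM]
    exact ⟨Module.Basis.ofEquivFun isGrading_weightM.picEquiv.toIntLinearEquiv⟩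
  rw [alpha, dif_pos h, effectiveCone_dual bInv'_faceM, bInv'_faceM,
    ENNReal.toReal_ofReal (by norm_num)]
  norm_num [Nat.factorial]

/-! ### Faces of the Clemens complex -/

theorem isFace_iff {A : Finset Ray} : IsFace A ↔ A ⊆ boundary ∧ ∃ σ ∈ fan, A ⊆ σ := by
  refine and_congr_right fun _ => ?_
  constructor
  · rintro ⟨P, z, -, hz⟩
    obtain ⟨σ, hσ, h⟩ := z.2
    refine ⟨σ, hσ, fun ρ hρ => ?_⟩
    by_contra hn
    exact h ρ hn (hz ρ hρ)
  · rintro ⟨σ, hσ, h⟩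
    refine ⟨_, ⟨fun ρ => if ρ ∈ A then 0 else 1, σ, hσ, fun ρ hρ => ?_⟩, rfl, fun ρ hρ => ?_⟩
    · simp only [if_neg fun hA => hρ (h hA)]
      exact one_ne_zero
    · exact if_pos hρ

theorem isMaximalFace_faceM : IsMaximalFace faceM := by
  refine ⟨isFace_iff.2 ⟨by decide, {.a0, .b0, .c0}, by decide, by decide⟩, fun A hA hle => ?_⟩
  obtain ⟨hb, σ, hσ, h⟩ := isFace_iff.1 hA
  have h0 : Ray.a0 ∈ A := hle (Finset.mem_singleton_self _)
  intro ρ hρ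
  have h1 := (fan_disjoint σ hσ).1
  have hρσ := h hρ
  have h0σ := h h0
  have hρb := hb hρ
  cases ρ <;> first
    | exact Finset.mem_singleton_self _
    | exact absurd hρb (by decide)
    | exact absurd ⟨h0σ, by simp [hρσ]⟩ h1

theorem isFace_exceptional : IsFace {.x, .y} :=
  isFace_iff.2 ⟨by decide, {.a1, .x, .y}, by decide, by decide⟩

/-! ### Coordinates on the torus -/

section Points

variable {K : Type*} [Field K]

/-- The relations between the coordinates of the Néron--Severi torus. -/
theorem prod_zpow_pair_eq_one_iff (l : Ray → Kˣ) :
    (∀ m : Fin 3 → ℤ, ∏ ρ, l ρ ^ pair m ρ = 1) ↔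
      l .a0 = l .a1 * l .x * l .y ∧ l .b0 = l .b1 * l .x ∧ l .c0 = l .c1 * l .y := by
  have hprod : ∀ m : Fin 3 → ℤ, ∏ ρ, l ρ ^ pair m ρ =
      (l .a0 * (l .a1 * l .x * l .y)⁻¹) ^ m 0 * (l .b0 * (l .b1 * l .x)⁻¹) ^ m 1 *
        (l .c0 * (l .c1 * l .y)⁻¹) ^ m 2 := by
    intro m
    rw [prod_zpow_pair]
    simp only [pair_eq, gen, mul_zpow, inv_zpow]
    simp only [Matrix.cons_val_zero, Matrix.cons_val_one, Matrix.cons_val, mul_zero, mul_one,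
      add_zero, zero_add, mul_neg, zpow_add, zpow_neg, mul_inv]
    ac_rfl
  simp only [hprod]
  constructor
  · intro h
    have h0 := h ![1, 0, 0]
    have h1 := h ![0, 1, 0]
    have h2 := h ![0, 0, 1]
    simp only [Matrix.cons_val_zero, Matrix.cons_val_one, Matrix.cons_val, zpow_one, zpow_zero,
      mul_one, one_mul] at h0 h1 h2
    exact ⟨mul_inv_eq_one.1 h0, mul_inv_eq_one.1 h1, mul_inv_eq_one.1 h2⟩
  · rintro ⟨h0, h1, h2⟩ m
    rw [mul_inv_eq_one.2 h0, mul_inv_eq_one.2 h1, mul_inv_eq_one.2 h2]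
    simp

/-- The affine coordinates `(a, b, c)` of the point with given Cox coordinates. -/
def affine (z : Ray → K) : Fin 3 → K :=
  ![z .a0 / (z .a1 * z .x * z .y), z .b0 / (z .b1 * z .x), z .c0 / (z .c1 * z .y)]

/-- The point with Cox coordinates `z` lies in the image of `chart`. -/
def InChart (z : Ray → K) : Prop :=
  z .a1 ≠ 0 ∧ z .b1 ≠ 0 ∧ z .c1 ≠ 0 ∧ z .x ≠ 0 ∧ z .y ≠ 0

theorem mk_eq_mk_iff {z w : TorsorPoint K} : Points.mk z = Points.mk w ↔
    ∃ l : Ray → Kˣ, (l .a0 = l .a1 * l .x * l .y ∧ l .b0 = l .b1 * l .x ∧ l .c0 = l .c1 * l .y) ∧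
      ∀ ρ, w.1 ρ = l ρ * z.1 ρ := by
  simp only [← prod_zpow_pair_eq_one_iff]
  exact Quotient.eq

theorem InChart.mk_eq_chart {z : TorsorPoint K} (h : InChart z.1) :
    Points.mk z = chart (affine z.1) := by
  obtain ⟨h1, h2, h3, h4, h5⟩ := h
  rw [chart, mk_eq_mk_iff]
  let u : ∀ ρ, z.1 ρ ≠ 0 → Kˣ := fun ρ hρ => (Units.mk0 _ hρ)⁻¹
  refine ⟨fun ρ => match ρ with
    | .a0 => u _ h1 * u _ h4 * u _ h5
    | .a1 => u _ h1
    | .b0 => u _ h2 * u _ h4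
    | .b1 => u _ h2
    | .c0 => u _ h3 * u _ h5
    | .c1 => u _ h3
    | .x => u _ h4
    | .y => u _ h5, ⟨rfl, rfl, rfl⟩, fun ρ => ?_⟩
  cases ρ <;> simp [chartCoord, affine, u, h1, h2, h3, h4, h5] <;> field_simp

theorem inChart_of_mk_eq_chart {z : TorsorPoint K} {t : Fin 3 → K} (h : Points.mk z = chart t) :
    InChart z.1 ∧ affine z.1 = t := by
  obtain ⟨l, ⟨ha, hb, hc⟩, hl⟩ := mk_eq_mk_iff.1 h
  have hne : ∀ ρ, chartCoord t ρ = 1 → z.1 ρ ≠ 0 := by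
    intro ρ hρ h0
    have h1 := hl ρ
    rw [h0, mul_zero] at h1
    exact one_ne_zero (hρ.symm.trans h1)
  have h1 := hne .a1 rfl
  have h2 := hne .b1 rfl
  have h3 := hne .c1 rfl
  have h4 := hne .x rfl
  have h5 := hne .y rfl
  refine ⟨⟨h1, h2, h3, h4, h5⟩, ?_⟩
  have e1 : (1 : K) = l .a1 * z.1 .a1 := hl .a1
  have e2 : (1 : K) = l .b1 * z.1 .b1 := hl .b1
  have e3 : (1 : K) = l .c1 * z.1 .c1 := hl .c1
  have e4 : (1 : K) = l .x * z.1 .x := hl .x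
  have e5 : (1 : K) = l .y * z.1 .y := hl .y
  have f1 : t 0 = (l .a1 * l .x * l .y) * z.1 .a0 := by
    have := hl .a0
    rw [ha] at this
    simpa [chartCoord] using this
  have f2 : t 1 = (l .b1 * l .x) * z.1 .b0 := by
    have := hl .b0
    rw [hb] at this
    simpa [chartCoord] using this
  have f3 : t 2 = (l .c1 * l .y) * z.1 .c0 := by
    have := hl .c0
    rw [hc] at this
    simpa [chartCoord] using this
  ext i
  fin_cases i
  · simp only [affine, Fin.zero_eta, Matrix.cons_val_zero, f1]
    rw [div_eq_iff (by simp [h1, h4, h5])]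
    calc z.1 .a0 = z.1 .a0 * 1 * 1 * 1 := by ring
      _ = z.1 .a0 * (l .a1 * z.1 .a1) * (l .x * z.1 .x) * (l .y * z.1 .y) := by
        rw [← e1, ← e4, ← e5]
      _ = _ := by ring
  · simp only [affine, Fin.mk_one, Matrix.cons_val_one, Matrix.cons_val_zero, f2]
    rw [div_eq_iff (by simp [h2, h4])]
    calc z.1 .b0 = z.1 .b0 * 1 * 1 := by ring
      _ = z.1 .b0 * (l .b1 * z.1 .b1) * (l .x * z.1 .x) := by rw [← e2, ← e4]
      _ = _ := by ring
  · simp only [affine, Fin.reduceFinMk, Matrix.cons_val, f3]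
    rw [div_eq_iff (by simp [h3, h5])]
    calc z.1 .c0 = z.1 .c0 * 1 * 1 := by ring
      _ = z.1 .c0 * (l .c1 * z.1 .c1) * (l .y * z.1 .y) := by rw [← e3, ← e5]
      _ = _ := by ring

theorem chart_injective : Function.Injective (chart (K := K)) := by
  intro t t' h
  have h1 : ∀ t : Fin 3 → K, affine (chartCoord t) = t := fun t => by
    ext i
    fin_cases i <;> simp [affine, chartCoord]
  have h2 := (inChart_of_mk_eq_chart h).2
  exact (h1 t).symm.trans h2

theorem mem_torus_iff {P : Points K} : P ∈ torus K ↔ ∃ t : Fin 3 → K, (∀ i, t i ≠ 0) ∧ P = chart t := by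
  constructor
  · rintro ⟨z, rfl, hz⟩
    refine ⟨affine z.1, fun i => ?_, InChart.mk_eq_chart ⟨hz _, hz _, hz _, hz _, hz _⟩⟩
    fin_cases i <;> simp [affine, hz]
  · rintro ⟨t, ht, rfl⟩
    refine ⟨_, rfl, fun ρ => ?_⟩
    cases ρ <;> simp [chartCoord, ht]

theorem blowDown_mk (z : TorsorPoint K) : blowDown (Points.mk z) =
    (Projectivization.mk K _ (blowDown_ne_zero z).1,
      Projectivization.mk K _ (blowDown_ne_zero z).2.1,
      Projectivization.mk K _ (blowDown_ne_zero z).2.2) := rfl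

theorem coord_inChart (t : Fin 3 → K) :
    InChart (chart t).coord ∧ affine (chart t).coord = t := by
  refine inChart_of_mk_eq_chart (z := Quotient.out (chart t)) ?_
  exact Quotient.out_eq (s := coxSetoid K) (chart t)

end Points

/-! ### The local norms -/

section Norm

variable {K : Type*} [NormedField K]

/-- The norm of `1_D ⊗ da ∧ db ∧ dc` in terms of the affine coordinates. -/
noncomputable def formNorm (t : Fin 3 → K) : ℝ :=
  ‖t 0‖ * max (max ‖t 1‖ 1 ^ 2 * max ‖t 2‖ 1 ^ 2) (‖t 0‖ ^ 2) / max ‖t 0‖ 1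

theorem norm_vec_two (a b : K) : ‖(![a, b] : Fin 2 → K)‖ = max ‖a‖ ‖b‖ := by
  refine le_antisymm ((pi_norm_le_iff_of_nonneg (by positivity)).2 fun i => ?_) (max_le ?_ ?_)
  · fin_cases i <;> simp
  · exact norm_le_pi_norm (![a, b] : Fin 2 → K) 0
  · exact norm_le_pi_norm (![a, b] : Fin 2 → K) 1

theorem norm_sectionsL1_chartCoord (t : Fin 3 → K) : ‖sectionsL1 (chartCoord t)‖ =
    max (max ‖t 1‖ 1 ^ 2 * max ‖t 2‖ 1 ^ 2) (‖t 0‖ ^ 2) := by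
  have hv : ∀ i, ‖sectionsL1 (chartCoord t) i‖ = ![‖t 1‖ ^ 2 * ‖t 2‖ ^ 2, ‖t 2‖ ^ 2, ‖t 1‖ ^ 2,
      1, ‖t 0‖ ^ 2] i := by
    intro i
    fin_cases i <;> simp [sectionsL1, chartCoord]
  have h1 : ∀ s : K, ‖s‖ ^ 2 ≤ max ‖s‖ 1 ^ 2 := fun s => by gcongr; exact le_max_left _ _
  have h2 : ∀ s : K, (1 : ℝ) ≤ max ‖s‖ 1 ^ 2 := fun s => one_le_pow₀ (le_max_right _ _)
  refine le_antisymm ((pi_norm_le_iff_of_nonneg (by positivity)).2 fun i => ?_) (max_le ?_ ?_)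
  · rw [hv]
    fin_cases i
    · exact le_max_of_le_left (mul_le_mul (h1 _) (h1 _) (by positivity) (by positivity))
    · exact le_max_of_le_left (by
        simpa using mul_le_mul (h2 (t 1)) (h1 (t 2)) (by positivity) (by positivity))
    · exact le_max_of_le_left (by
        simpa using mul_le_mul (h1 (t 1)) (h2 (t 2)) (by positivity) (by positivity))
    · exact le_max_of_le_left (by
        simpa using mul_le_mul (h2 (t 1)) (h2 (t 2)) (by positivity) (by positivity))
    · exact le_max_right _ _
  · have hn : ∀ i, ![‖t 1‖ ^ 2 * ‖t 2‖ ^ 2, ‖t 2‖ ^ 2, ‖t 1‖ ^ 2, 1, ‖t 0‖ ^ 2] i ≤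
        ‖sectionsL1 (chartCoord t)‖ := fun i => hv i ▸ norm_le_pi_norm _ i
    rcases le_total ‖t 1‖ 1 with h | h <;> rcases le_total ‖t 2‖ 1 with h' | h'
    · rw [max_eq_right h, max_eq_right h']; simpa using hn 3
    · rw [max_eq_right h, max_eq_left h']; simpa using hn 1
    · rw [max_eq_left h, max_eq_right h']; simpa using hn 2
    · rw [max_eq_left h, max_eq_left h']; simpa using hn 0
  · have := norm_le_pi_norm (sectionsL1 (chartCoord t)) 4
    rwa [hv] at this

theorem norm_sectionsL2_chartCoord (t : Fin 3 → K) :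
    ‖sectionsL2 (chartCoord t)‖ = max ‖t 0‖ 1 := by
  rw [sectionsL2, norm_vec_two]
  simp [chartCoord]

theorem prod_ray {M : Type*} [CommMonoid M] (f : Ray → M) :
    ∏ ρ, f ρ = f .a0 * f .a1 * f .b0 * f .b1 * f .c0 * f .c1 * f .x * f .y := by
  have : (Finset.univ : Finset Ray) = {.a0, .a1, .b0, .b1, .c0, .c1, .x, .y} := rfl
  rw [this]
  simp [mul_assoc]

theorem formExp_eq : formExp .a0 = 1 ∧ formExp .a1 = -2 ∧ formExp .b0 = 0 ∧ formExp .b1 = -2 ∧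
    formExp .c0 = 0 ∧ formExp .c1 = -2 ∧ formExp .x = -2 ∧ formExp .y = -2 := by decide

theorem prod_zpow_formExp (z : Ray → K) : ∏ ρ, z ρ ^ formExp ρ =
    z .a0 * (z .a1 ^ 2)⁻¹ * (z .b1 ^ 2)⁻¹ * (z .c1 ^ 2)⁻¹ * (z .x ^ 2)⁻¹ * (z .y ^ 2)⁻¹ := by
  obtain ⟨h1, h2, h3, h4, h5, h6, h7, h8⟩ := formExp_eq
  have h : ∀ s : K, s ^ (-2 : ℤ) = (s ^ 2)⁻¹ := fun s => by rw [zpow_neg]; norm_cast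
  rw [prod_ray, h1, h2, h3, h4, h5, h6, h7, h8]
  simp [h]

theorem sectionNorm_formExp_chartCoord (t : Fin 3 → K) :
    sectionNorm formExp (chartCoord t) = formNorm t := by
  rw [sectionNorm, norm_sectionsL1_chartCoord, norm_sectionsL2_chartCoord, prod_zpow_formExp]
  simp [chartCoord, formNorm]

/-- The norm only depends on the point, not on the choice of Cox coordinates. -/
theorem sectionNorm_formExp {z : Ray → K} (hz : InChart z) :
    sectionNorm formExp z = formNorm (affine z) := by
  rw [← sectionNorm_formExp_chartCoord]
  obtain ⟨h1, h2, h3, h4, h5⟩ := hz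
  have e1 : sectionsL1 z =
      (z .a1 * z .b1 * z .c1 * z .x * z .y) ^ 2 • sectionsL1 (chartCoord (affine z)) := by
    ext i
    fin_cases i <;> simp [sectionsL1, chartCoord, affine] <;> field_simp
  have e2 : sectionsL2 z = (z .a1 * z .x * z .y) • sectionsL2 (chartCoord (affine z)) := by
    ext i
    fin_cases i <;> simp [sectionsL2, chartCoord, affine]
    field_simp
  have e3 : ∏ ρ, z ρ ^ formExp ρ = (z .a1 * z .x * z .y) *
      ((z .a1 * z .b1 * z .c1 * z .x * z .y) ^ 2)⁻¹ * ∏ ρ, chartCoord (affine z) ρ ^ formExp ρ := by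
    rw [prod_zpow_formExp, prod_zpow_formExp]
    simp [chartCoord, affine]
    field_simp
  rw [sectionNorm, sectionNorm, e1, e2, e3, norm_smul, norm_smul, norm_mul, norm_mul, norm_inv]
  have n1 : ‖z .a1 * z .x * z .y‖ ≠ 0 := by simp [h1, h4, h5]
  have n2 : ‖(z .a1 * z .b1 * z .c1 * z .x * z .y) ^ 2‖ ≠ 0 := by simp [h1, h2, h3, h4, h5]
  field_simp

end Norm

/-! ### Integral points and their height -/

section IntegralRep

variable {K : Type*} [Field K] {R : Type*} [CommRing R] [Algebra R K]

/-- Being an integral representative, expressed in Cox coordinates. -/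
theorem isIntegralRep_mk_iff (z : TorsorPoint K) (a b c : Fin 2 → R) :
    IsIntegralRep (Points.mk z) a b c ↔
      IsCoprime (a 0) (a 1) ∧ IsCoprime (b 0) (b 1) ∧ IsCoprime (c 0) (c 1) ∧
      IsUnit (a 0) ∧ IsCoprime (a 1) (b 1) ∧ IsCoprime (a 1) (c 1) ∧
      (∃ s : K, z.1 .a0 = s * algebraMap R K (a 0) ∧
        z.1 .a1 * z.1 .x * z.1 .y = s * algebraMap R K (a 1)) ∧
      (∃ s : K, z.1 .b0 = s * algebraMap R K (b 0) ∧ z.1 .b1 * z.1 .x = s * algebraMap R K (b 1)) ∧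
      (∃ s : K, z.1 .c0 = s * algebraMap R K (c 0) ∧
        z.1 .c1 * z.1 .y = s * algebraMap R K (c 1)) := by
  rw [IsIntegralRep]
  have key : ∀ (u v : K) (huv : (![u, v] : Fin 2 → K) ≠ 0) (d : Fin 2 → R),
      (∃ s : K, u = s * algebraMap R K (d 0) ∧ v = s * algebraMap R K (d 1)) ↔
        ∃ hd : (fun i => algebraMap R K (d i)) ≠ 0,
          Projectivization.mk K _ huv = Projectivization.mk K _ hd := by
    intro u v huv d
    constructor
    · rintro ⟨s, rfl, rfl⟩
      have e : (![s * algebraMap R K (d 0), s * algebraMap R K (d 1)] : Fin 2 → K) =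
          s • fun i => algebraMap R K (d i) := by
        ext i
        fin_cases i <;> simp
      have hd : (fun i => algebraMap R K (d i)) ≠ 0 := by
        intro h
        rw [e, h, smul_zero] at huv
        exact huv rfl
      exact ⟨hd, (Projectivization.mk_eq_mk_iff' K _ _ _ _).2 ⟨s, e.symm⟩⟩
    · rintro ⟨hd, h⟩
      obtain ⟨s, hs⟩ := (Projectivization.mk_eq_mk_iff' K _ _ _ _).1 h
      exact ⟨s, (congrFun hs 0).symm, (congrFun hs 1).symm⟩
  obtain ⟨h1, h2, h3⟩ := blowDown_ne_zero z
  rw [key _ _ h1, key _ _ h2, key _ _ h3, blowDown_mk]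
  simp only [Prod.mk.injEq]
  constructor
  · rintro ⟨k1, k2, k3, k4, k5, k6, ha, hb, hc, e1, e2, e3⟩
    exact ⟨k1, k2, k3, k4, k5, k6, ⟨ha, e1⟩, ⟨hb, e2⟩, ⟨hc, e3⟩⟩
  · rintro ⟨k1, k2, k3, k4, k5, k6, ⟨ha, e1⟩, ⟨hb, e2⟩, ⟨hc, e3⟩⟩
    exact ⟨k1, k2, k3, k4, k5, k6, ha, hb, hc, e1, e2, e3⟩

/-- Integral representatives of points of the torus. -/
theorem isIntegralRep_chart_iff (t : Fin 3 → K) (a b c : Fin 2 → R) :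
    IsIntegralRep (chart t) a b c ↔
      IsCoprime (a 0) (a 1) ∧ IsCoprime (b 0) (b 1) ∧ IsCoprime (c 0) (c 1) ∧
      IsUnit (a 0) ∧ IsCoprime (a 1) (b 1) ∧ IsCoprime (a 1) (c 1) ∧
      (algebraMap R K (a 1) ≠ 0 ∧ t 0 = algebraMap R K (a 0) / algebraMap R K (a 1)) ∧
      (algebraMap R K (b 1) ≠ 0 ∧ t 1 = algebraMap R K (b 0) / algebraMap R K (b 1)) ∧
      (algebraMap R K (c 1) ≠ 0 ∧ t 2 = algebraMap R K (c 0) / algebraMap R K (c 1)) := by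
  have key : ∀ (u p q : K), (∃ s : K, u = s * p ∧ 1 = s * q) ↔ (q ≠ 0 ∧ u = p / q) := by
    intro u p q
    constructor
    · rintro ⟨s, rfl, h⟩
      have hq : q ≠ 0 := by
        rintro rfl
        simp at h
      refine ⟨hq, ?_⟩
      rw [eq_div_iff hq]
      linear_combination -p * h
    · rintro ⟨hq, rfl⟩
      exact ⟨q⁻¹, by field_simp, by field_simp⟩
  rw [chart, isIntegralRep_mk_iff]
  simp only [chartCoord, mul_one, key]

end IntegralRep

theorem finite_padic_norm_ne_one {n : ℕ} (hn : n ≠ 0) :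
    {p : Nat.Primes | ‖(n : ℚ_[p])‖ ≠ 1}.Finite := by
  refine Set.Finite.subset (s := {p : Nat.Primes | (p : ℕ) ∈ n.primeFactors}) ?_ ?_
  · exact Set.Finite.preimage Subtype.val_injective.injOn (Finset.finite_toSet _)
  · intro p hp
    have h1 : ‖((n : ℤ) : ℚ_[p])‖ < 1 := by
      refine lt_of_le_of_ne (Padic.norm_int_le_one _) ?_
      simpa using hp
    rw [Padic.norm_intCast_lt_one_iff] at h1
    exact Nat.mem_primeFactors.2 ⟨p.2, Int.natCast_dvd_natCast.1 h1, hn⟩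

/-- The product formula. -/
theorem finprod_padic_norm {n : ℕ} (hn : n ≠ 0) :
    ∏ᶠ p : Nat.Primes, (‖(n : ℚ_[p])‖ ^ 2)⁻¹ = (n : ℝ) ^ 2 := by
  induction n using Nat.recOnMul with
  | zero => exact absurd rfl hn
  | one => simp
  | prime q hq =>
    rw [finprod_eq_single _ ⟨q, hq⟩]
    · have := factPrime ⟨q, hq⟩
      have h := Padic.norm_p (p := q)
      rw [show ‖((q : ℕ) : ℚ_[((⟨q, hq⟩ : Nat.Primes) : ℕ)])‖ = (q : ℝ)⁻¹ from h]
      simp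
    · intro p hp
      have h1 : ‖((q : ℤ) : ℚ_[p])‖ = 1 := by
        refine le_antisymm (Padic.norm_int_le_one _) ?_
        by_contra! h
        rw [Padic.norm_intCast_lt_one_iff, Int.natCast_dvd_natCast,
          Nat.prime_dvd_prime_iff_eq p.2 hq] at h
        exact hp (Subtype.ext h)
      rw [Int.cast_natCast] at h1
      simp [h1]
  | mul m k ihm ihk =>
    rw [mul_ne_zero_iff] at hn
    have h : ∀ j : ℕ, j ≠ 0 →
        (Function.mulSupport fun p : Nat.Primes => (‖(j : ℚ_[p])‖ ^ 2)⁻¹).Finite := by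
      intro j hj
      refine (finite_padic_norm_ne_one hj).subset fun p hp h1 => hp ?_
      simp [h1]
    rw [Nat.cast_mul, mul_pow, ← ihm hn.1, ← ihk hn.2,
      ← finprod_mul_distrib (h m hn.1) (h k hn.2)]
    refine finprod_congr fun p => ?_
    rw [Nat.cast_mul, norm_mul, mul_pow, mul_inv]

theorem padic_norm_of_isCoprime {p : ℕ} [Fact p.Prime] {m n : ℤ} (h : IsCoprime m n) :
    ‖(m : ℚ_[p])‖ = 1 ∨ ‖(n : ℚ_[p])‖ = 1 := by
  by_contra! hcon
  have h1 := (Padic.norm_intCast_lt_one_iff (k := m)).1 (lt_of_le_of_ne (Padic.norm_int_le_one _) hcon.1)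
  have h2 := (Padic.norm_intCast_lt_one_iff (k := n)).1 (lt_of_le_of_ne (Padic.norm_int_le_one _) hcon.2)
  have h3 := h.isUnit_of_dvd' h1 h2
  exact (Nat.prime_iff_prime_int.1 (Fact.out : p.Prime)).not_isUnit h3

theorem height_chart (t : Fin 3 → ℚ) : height (chart t) =
    formNorm (fun i => (t i : ℝ)) * ∏ᶠ p : Nat.Primes, formNorm (fun i => (t i : ℚ_[p])) := by
  obtain ⟨⟨h1, h2, h3, h4, h5⟩, ht⟩ := coord_inChart t
  have key : ∀ (K : Type) [NormedField K] [CharZero K],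
      sectionNorm formExp (fun ρ => ((chart t).coord ρ : K)) = formNorm (fun i => (t i : K)) := by
    intro K _ _
    rw [sectionNorm_formExp ⟨by simpa using h1, by simpa using h2, by simpa using h3,
      by simpa using h4, by simpa using h5⟩]
    congr 1
    ext i
    conv_rhs => rw [← ht]
    fin_cases i <;> simp [affine]
  rw [height, key ℝ]
  congr 1
  exact finprod_congr fun p => key ℚ_[p]

/-- The contribution of a finite place to the height of an integral point. -/
theorem formNorm_padic (p : ℕ) [Fact p.Prime] {a b c : Fin 2 → ℤ} (ha : IsUnit (a 0))
    (ha1 : a 1 ≠ 0) (hb1 : b 1 ≠ 0) (hc1 : c 1 ≠ 0) (hb : IsCoprime (b 0) (b 1))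
    (hc : IsCoprime (c 0) (c 1)) (hab : IsCoprime (a 1) (b 1)) (hac : IsCoprime (a 1) (c 1)) :
    formNorm ![(a 0 : ℚ_[p]) / a 1, (b 0 : ℚ_[p]) / b 1, (c 0 : ℚ_[p]) / c 1] =
      (‖((a 1 * b 1 * c 1 : ℤ) : ℚ_[p])‖ ^ 2)⁻¹ := by
  have hpos : ∀ n : ℤ, n ≠ 0 → 0 < ‖(n : ℚ_[p])‖ := fun n hn => by simpa using hn
  have hle : ∀ n : ℤ, ‖(n : ℚ_[p])‖ ≤ 1 := fun n => Padic.norm_int_le_one n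
  have hmax : ∀ m n : ℤ, n ≠ 0 → IsCoprime m n →
      max ‖(m : ℚ_[p]) / n‖ 1 = ‖(n : ℚ_[p])‖⁻¹ := by
    intro m n hn hmn
    have h0 := hpos n hn
    rw [norm_div]
    rcases padic_norm_of_isCoprime (p := p) hmn with h | h
    · rw [h, one_div]
      exact max_eq_left (one_le_inv_iff₀.2 ⟨h0, hle n⟩)
    · rw [h, div_one, inv_one]
      exact max_eq_right (hle m)
  have ha0 : ‖((a 0 : ℤ) : ℚ_[p])‖ = 1 := by
    rcases Int.isUnit_iff.1 ha with h | h <;> simp [h]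
  have hA := hpos _ ha1
  have hB := hpos _ hb1
  have hC := hpos _ hc1
  have e0 : max ‖(a 0 : ℚ_[p]) / a 1‖ 1 = ‖(a 1 : ℚ_[p])‖⁻¹ :=
    hmax _ _ ha1 (by obtain ⟨u, hu⟩ := ha.exists_left_inv; exact ⟨u, 0, by simp [hu]⟩)
  have e0' : ‖(a 0 : ℚ_[p]) / a 1‖ = ‖(a 1 : ℚ_[p])‖⁻¹ := by rw [norm_div, ha0, one_div]
  rw [formNorm]
  simp only [Matrix.cons_val_zero, Matrix.cons_val_one, Matrix.cons_val]
  rw [e0, e0', hmax _ _ hb1 hb, hmax _ _ hc1 hc, mul_div_assoc, mul_comm,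
    div_mul_cancel₀ _ (inv_ne_zero hA.ne')]
  rw [Int.cast_mul, Int.cast_mul, norm_mul, norm_mul]
  simp only [inv_pow, mul_pow, mul_inv]
  rcases padic_norm_of_isCoprime (p := p) hab with h | h
  · rw [h]
    simp only [one_pow, inv_one, one_mul]
    refine max_eq_left ?_
    rw [← mul_inv]
    exact one_le_inv_iff₀.2 ⟨by positivity,
      mul_le_one₀ (pow_le_one₀ hB.le (hle _)) (by positivity) (pow_le_one₀ hC.le (hle _))⟩
  · rcases padic_norm_of_isCoprime (p := p) hac with h' | h'
    · rw [h, h']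
      simp only [one_pow, inv_one, one_mul]
      exact max_eq_left (one_le_inv_iff₀.2 ⟨by positivity, pow_le_one₀ hC.le (hle _)⟩)
    · rw [h, h']
      simp only [one_pow, inv_one, mul_one]
      exact max_eq_right (one_le_inv_iff₀.2 ⟨by positivity, pow_le_one₀ hA.le (hle _)⟩)

/-- The contribution of the infinite place to the height of an integral point. -/
theorem formNorm_real {a b c : Fin 2 → ℤ} (ha : IsUnit (a 0))
    (ha1 : a 1 ≠ 0) (hb1 : b 1 ≠ 0) (hc1 : c 1 ≠ 0) :
    formNorm ![(a 0 : ℝ) / a 1, (b 0 : ℝ) / b 1, (c 0 : ℝ) / c 1] * ((a 1 * b 1 * c 1 : ℤ) : ℝ) ^ 2 =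
      |(a 1 : ℝ)| * max |(b 0 : ℝ)| |(b 1 : ℝ)| ^ 2 * max |(c 0 : ℝ)| |(c 1 : ℝ)| ^ 2 := by
  have hmax : ∀ m n : ℤ, n ≠ 0 →
      max ‖(m : ℝ) / n‖ 1 = max |(m : ℝ)| |(n : ℝ)| / |(n : ℝ)| := by
    intro m n hn
    have h0 : 0 < |(n : ℝ)| := by simpa using hn
    rw [Real.norm_eq_abs, abs_div, ← max_div_div_right h0.le, div_self h0.ne']
  have ha0 : |((a 0 : ℤ) : ℝ)| = 1 := by
    rcases Int.isUnit_iff.1 ha with h | h <;> simp [h]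
  have hone : ∀ n : ℤ, n ≠ 0 → 1 ≤ |(n : ℝ)| := fun n hn => by
    rw [← Int.cast_abs]
    exact_mod_cast Int.one_le_abs hn
  have hA := hone _ ha1
  have e0' : ‖(a 0 : ℝ) / a 1‖ = |(a 1 : ℝ)|⁻¹ := by
    rw [Real.norm_eq_abs, abs_div, ha0, one_div]
  have e0 : max ‖(a 0 : ℝ) / a 1‖ 1 = 1 := by
    rw [e0']
    exact max_eq_right (inv_le_one_of_one_le₀ hA)
  have hb := hone _ hb1
  have hc := hone _ hc1
  have hge : ∀ m n : ℤ, 1 ≤ |(n : ℝ)| → 1 ≤ max |(m : ℝ)| |(n : ℝ)| / |(n : ℝ)| := by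
    intro m n hn
    rw [one_le_div (by linarith)]
    exact le_max_right _ _
  rw [formNorm]
  simp only [Matrix.cons_val_zero, Matrix.cons_val_one, Matrix.cons_val]
  rw [e0, e0', hmax _ _ hb1, hmax _ _ hc1, max_eq_left]
  · push_cast
    have e1 : ((a 1 : ℝ) * b 1 * c 1) ^ 2 = (|(a 1 : ℝ)| * |(b 1 : ℝ)| * |(c 1 : ℝ)|) ^ 2 := by
      rw [← abs_mul, ← abs_mul, sq_abs]
    rw [e1]
    have : |(a 1 : ℝ)| ≠ 0 := by linarith
    have : |(b 1 : ℝ)| ≠ 0 := by linarith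
    have : |(c 1 : ℝ)| ≠ 0 := by linarith
    field_simp
  · calc (|(a 1 : ℝ)|⁻¹) ^ 2 ≤ 1 ^ 2 := by gcongr; exact inv_le_one_of_one_le₀ hA
      _ = 1 ^ 2 * 1 ^ 2 := by norm_num
      _ ≤ _ := by gcongr <;> exact hge _ _ (by assumption)

/-- The height of an integral point of the torus. -/
theorem height_eq {P : Points ℚ} (hP : P ∈ torus ℚ) {a b c : Fin 2 → ℤ}
    (h : IsIntegralRep P a b c) :
    height P = |(a 1 : ℝ)| * max |(b 0 : ℝ)| |(b 1 : ℝ)| ^ 2 * max |(c 0 : ℝ)| |(c 1 : ℝ)| ^ 2 := by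
  obtain ⟨t, ht, rfl⟩ := mem_torus_iff.1 hP
  rw [isIntegralRep_chart_iff] at h
  obtain ⟨-, hb, hc, ha, hab, hac, ⟨ha1, e0⟩, ⟨hb1, e1⟩, ⟨hc1, e2⟩⟩ := h
  simp only [algebraMap_int_eq, eq_intCast, Ne, Int.cast_eq_zero] at ha1 hb1 hc1 e0 e1 e2
  have ht' : t = ![(a 0 : ℚ) / a 1, (b 0 : ℚ) / b 1, (c 0 : ℚ) / c 1] := by
    ext i
    fin_cases i <;> simp [e0, e1, e2]
  have hcast : ∀ (K : Type) [NormedField K] [CharZero K], (fun i => (t i : K)) =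
      ![(a 0 : K) / a 1, (b 0 : K) / b 1, (c 0 : K) / c 1] := by
    intro K _ _
    ext i
    fin_cases i <;> simp [ht']
  rw [height_chart, hcast ℝ, ← formNorm_real ha ha1 hb1 hc1]
  congr 1
  have hn : (a 1 * b 1 * c 1).natAbs ≠ 0 := by simp [ha1, hb1, hc1]
  have e : (((a 1 * b 1 * c 1 : ℤ) : ℝ)) ^ 2 = (((a 1 * b 1 * c 1).natAbs : ℕ) : ℝ) ^ 2 := by
    rw [Nat.cast_natAbs, Int.cast_abs, sq_abs]
  rw [e, ← finprod_padic_norm hn]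
  refine finprod_congr fun p => ?_
  rw [hcast ℚ_[p], formNorm_padic p ha ha1 hb1 hc1 hb hc hab hac]
  congr 2
  rcases Int.natAbs_eq (a 1 * b 1 * c 1) with h | h
  · conv_lhs => rw [h, Int.cast_natCast]
  · conv_lhs => rw [h, Int.cast_neg, norm_neg, Int.cast_natCast]

/-! ### Arithmetic functions supported on squarefree numbers -/

open ArithmeticFunction in
/-- The multiplicative function, supported on squarefree numbers, with value `-f p` at each
prime `p`. -/
noncomputable def moebiusTwist (f : ℕ → ℝ) : ArithmeticFunction ℝ :=
  ((moebius : ArithmeticFunction ℤ) : ArithmeticFunction ℝ).pmul (prodPrimeFactors f)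

theorem moebiusTwist_apply (f : ℕ → ℝ) {n : ℕ} (hn : n ≠ 0) :
    moebiusTwist f n = ArithmeticFunction.moebius n * ∏ p ∈ n.primeFactors, f p := by
  rw [moebiusTwist, ArithmeticFunction.pmul_apply, ArithmeticFunction.intCoe_apply,
    ArithmeticFunction.prodPrimeFactors_apply hn]

theorem isMultiplicative_moebiusTwist (f : ℕ → ℝ) : (moebiusTwist f).IsMultiplicative :=
  ArithmeticFunction.isMultiplicative_moebius.intCast.pmul
    (ArithmeticFunction.IsMultiplicative.prodPrimeFactors f)

theorem moebiusTwist_prime (f : ℕ → ℝ) {p : ℕ} (hp : p.Prime) : moebiusTwist f p = - f p := by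
  rw [moebiusTwist_apply f hp.ne_zero, ArithmeticFunction.moebius_apply_prime hp,
    hp.primeFactors, Finset.prod_singleton]
  simp

theorem moebiusTwist_prime_pow (f : ℕ → ℝ) {p : ℕ} (hp : p.Prime) {k : ℕ} (hk : 2 ≤ k) :
    moebiusTwist f (p ^ k) = 0 := by
  rw [moebiusTwist_apply f (pow_ne_zero k hp.ne_zero),
    ArithmeticFunction.moebius_apply_prime_pow hp (by omega), if_neg (by omega)]
  simp

theorem sum_divisors_moebiusTwist (f : ℕ → ℝ) {n : ℕ} (hn : n ≠ 0) :
    ∑ d ∈ n.divisors, moebiusTwist f d = ∏ p ∈ n.primeFactors, (1 - f p) := by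
  rw [← ArithmeticFunction.coe_mul_zeta_apply,
    ← ArithmeticFunction.prodPrimeFactors_apply (f := fun p => 1 - f p) hn]
  have h : moebiusTwist f * (ArithmeticFunction.zeta : ArithmeticFunction ℕ) =
      ArithmeticFunction.prodPrimeFactors fun p => 1 - f p := by
    refine (ArithmeticFunction.IsMultiplicative.eq_iff_eq_on_prime_powers _
      ((isMultiplicative_moebiusTwist f).mul ArithmeticFunction.isMultiplicative_zeta.natCast) _
      (ArithmeticFunction.IsMultiplicative.prodPrimeFactors _)).2 fun p i hp => ?_
    rw [ArithmeticFunction.coe_mul_zeta_apply, Nat.sum_divisors_prime_pow hp,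
      ArithmeticFunction.prodPrimeFactors_apply (pow_ne_zero _ hp.ne_zero)]
    rcases Nat.eq_zero_or_pos i with rfl | hi
    · simp [(isMultiplicative_moebiusTwist f).1]
    · rw [Nat.primeFactors_prime_pow hi.ne' hp, Finset.prod_singleton,
        show i + 1 = (i - 1) + 1 + 1 by omega, Finset.sum_range_succ', Finset.sum_range_succ',
        Finset.sum_eq_zero fun k _ => moebiusTwist_prime_pow f hp (by omega)]
      simp only [zero_add, pow_one, pow_zero, moebiusTwist_prime f hp,
        (isMultiplicative_moebiusTwist f).1]
      ring
  rw [h]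

/-- The Euler product of a function supported on squarefree numbers. -/
theorem hasProd_one_sub (f : ℕ → ℝ) (hf : Summable fun d => ‖moebiusTwist f d‖) :
    HasProd (fun p : Nat.Primes => 1 - f p) (∑' d, moebiusTwist f d) := by
  convert! (isMultiplicative_moebiusTwist f).eulerProduct_hasProd hf using 2 with p
  rw [tsum_eq_sum (s := Finset.range 2)]
  · rw [Finset.sum_range_succ, Finset.sum_range_one, pow_zero, pow_one,
      moebiusTwist_prime f p.2, (isMultiplicative_moebiusTwist f).1]
    ring
  · intro k hk
    exact moebiusTwist_prime_pow f p.2 (by simpa [Nat.succ_le_iff] using hk)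

theorem moebiusTwist_eq_mul (f F : ℕ → ℝ) (hF : ∀ n, Squarefree n → ∏ p ∈ n.primeFactors, f p = F n)
    (n : ℕ) : moebiusTwist f n = ArithmeticFunction.moebius n * F n := by
  rcases eq_or_ne n 0 with rfl | hn
  · simp
  · rw [moebiusTwist_apply f hn]
    by_cases h : Squarefree n
    · rw [hF n h]
    · rw [ArithmeticFunction.moebius_eq_zero_of_not_squarefree h]
      simp

theorem prod_primeFactors_comp (F : ℕ →* ℝ) {n : ℕ} (hn : Squarefree n) :
    ∏ p ∈ n.primeFactors, F p = F n := by
  rw [← map_prod, Nat.prod_primeFactors_of_squarefree hn]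

theorem abs_moebius_le_one (n : ℕ) : |(ArithmeticFunction.moebius n : ℝ)| ≤ 1 := by
  rw [← Int.cast_abs]
  exact_mod_cast ArithmeticFunction.abs_moebius_le_one

/-- A multiplicative function supported on squarefree numbers is bounded by a completely
multiplicative function if this holds at the primes. -/
theorem abs_moebiusTwist_le (f : ℕ → ℝ) (F : ℕ →* ℝ) (hF : ∀ n, 0 ≤ F n)
    (h : ∀ p : ℕ, p.Prime → |f p| ≤ F p) (n : ℕ) : |moebiusTwist f n| ≤ F n := by
  rcases eq_or_ne n 0 with rfl | hn
  · simpa using hF 0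
  · rw [moebiusTwist_apply f hn]
    by_cases hs : Squarefree n
    · rw [abs_mul, Finset.abs_prod, ← prod_primeFactors_comp F hs]
      refine (mul_le_of_le_one_left (by positivity) (abs_moebius_le_one n)).trans ?_
      exact Finset.prod_le_prod (fun _ _ => abs_nonneg _)
        fun p hp => h p (Nat.prime_of_mem_primeFactors hp)
    · rw [ArithmeticFunction.moebius_eq_zero_of_not_squarefree hs]
      simpa using hF n

/-! ### Counting coprime pairs -/

/-- The number of positive integers up to `n` that are coprime to `a`. -/
def coprimeCount (a n : ℕ) : ℕ := {k ∈ Finset.Ioc 0 n | a.Coprime k}.card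

/-- The number of coprime pairs of positive integers up to `n` whose second entry is coprime
to `a`. -/
def pairCount (a n : ℕ) : ℕ :=
  {q ∈ Finset.Ioc 0 n ×ˢ Finset.Ioc 0 n | q.1.Coprime q.2 ∧ a.Coprime q.2}.card

theorem ite_coprime_eq_sum {m n : ℕ} {s : Finset ℕ} (hs : ∀ d, d ∣ m → d ∣ n → d ∈ s)
    (hmn : m ≠ 0) : (if m.Coprime n then (1 : ℝ) else 0) =
      ∑ d ∈ s with d ∣ m ∧ d ∣ n, (ArithmeticFunction.moebius d : ℝ) := by
  have h : {d ∈ s | d ∣ m ∧ d ∣ n} = (m.gcd n).divisors := by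
    ext d
    simp only [Finset.mem_filter, Nat.mem_divisors, Nat.dvd_gcd_iff]
    constructor
    · rintro ⟨-, h1, h2⟩
      exact ⟨⟨h1, h2⟩, Nat.gcd_ne_zero_left hmn⟩
    · rintro ⟨⟨h1, h2⟩, -⟩
      exact ⟨hs d h1 h2, h1, h2⟩
  have h2 := congrArg (fun f : ArithmeticFunction ℝ => f (m.gcd n))
    (ArithmeticFunction.coe_moebius_mul_coe_zeta (R := ℝ))
  simp only [ArithmeticFunction.coe_mul_zeta_apply, ArithmeticFunction.intCoe_apply,
    ArithmeticFunction.one_apply] at h2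
  rw [h, h2]

theorem coprimeCount_le (a n : ℕ) : coprimeCount a n ≤ n := by
  simpa [coprimeCount] using Finset.card_filter_le (Finset.Ioc 0 n) fun k => a.Coprime k

theorem coprimeCount_eq_sum {a : ℕ} (ha : a ≠ 0) (n : ℕ) : (coprimeCount a n : ℝ) =
    ∑ d ∈ a.divisors, (ArithmeticFunction.moebius d : ℝ) * (n / d : ℕ) := by
  rw [coprimeCount, Finset.card_filter, Nat.cast_sum]
  simp only [Nat.cast_ite, Nat.cast_one, Nat.cast_zero]
  have h : ∀ k ∈ Finset.Ioc 0 n, (if a.Coprime k then (1 : ℝ) else 0) =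
      ∑ d ∈ a.divisors, if d ∣ k then (ArithmeticFunction.moebius d : ℝ) else 0 := by
    intro k hk
    rw [ite_coprime_eq_sum (s := a.divisors) (fun d hd _ => Nat.mem_divisors.2 ⟨hd, ha⟩) ha,
      ← Finset.sum_filter]
    refine Finset.sum_congr (Finset.filter_congr fun d hd => ?_) fun _ _ => rfl
    simp [Nat.dvd_of_mem_divisors hd]
  rw [Finset.sum_congr rfl h, Finset.sum_comm]
  refine Finset.sum_congr rfl fun d _ => ?_
  rw [← Finset.sum_filter, Finset.sum_const, Nat.Ioc_filter_dvd_card_eq_div, nsmul_eq_mul, mul_comm]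

/-- The numbers up to `n` that are divisible by `d` and coprime to `a`. -/
theorem sum_ite_dvd_coprime (a n : ℕ) {d : ℕ} (hd : d ≠ 0) :
    (∑ k ∈ Finset.Ioc 0 n, if d ∣ k ∧ a.Coprime k then (1 : ℝ) else 0) =
      if a.Coprime d then (coprimeCount a (n / d) : ℝ) else 0 := by
  rw [← Finset.sum_filter, Finset.sum_const, nsmul_eq_mul, mul_one]
  have hd' := Nat.pos_of_ne_zero hd
  split_ifs with h
  · rw [coprimeCount]
    norm_cast
    symm
    refine Finset.card_bij (fun k _ => d * k) ?_ ?_ ?_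
    · intro k hk
      simp only [Finset.mem_filter, Finset.mem_Ioc] at hk ⊢
      exact ⟨⟨Nat.mul_pos hd' hk.1.1, by
          rw [mul_comm]
          exact (Nat.le_div_iff_mul_le hd').1 hk.1.2⟩,
        dvd_mul_right _ _, h.mul_right hk.2⟩
    · intro k _ l _ hkl
      exact Nat.eq_of_mul_eq_mul_left hd' hkl
    · rintro _ hk
      simp only [Finset.mem_filter, Finset.mem_Ioc] at hk
      obtain ⟨⟨h1, h2⟩, ⟨k, rfl⟩, h3⟩ := hk
      refine ⟨k, ?_, rfl⟩
      simp only [Finset.mem_filter, Finset.mem_Ioc]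
      exact ⟨⟨Nat.pos_of_mul_pos_left h1, (Nat.le_div_iff_mul_le hd').2 (by rwa [mul_comm])⟩,
        h3.coprime_mul_left_right⟩
  · rw [Finset.filter_false_of_mem]
    · simp
    · rintro k - ⟨⟨l, rfl⟩, h2⟩
      exact h h2.coprime_mul_right_right

theorem pairCount_eq_sum (a n : ℕ) : (pairCount a n : ℝ) =
    ∑ d ∈ Finset.Ioc 0 n, (if a.Coprime d then (ArithmeticFunction.moebius d : ℝ) else 0) *
      ((n / d : ℕ) * coprimeCount a (n / d)) := by
  rw [pairCount, Finset.card_filter, Nat.cast_sum]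
  have h : ∀ q ∈ Finset.Ioc 0 n ×ˢ Finset.Ioc 0 n,
      (((if q.1.Coprime q.2 ∧ a.Coprime q.2 then 1 else 0 : ℕ)) : ℝ) =
        ∑ d ∈ Finset.Ioc 0 n, (ArithmeticFunction.moebius d : ℝ) *
          ((if d ∣ q.1 then 1 else 0) * (if d ∣ q.2 ∧ a.Coprime q.2 then 1 else 0)) := by
    intro q hq
    simp only [Finset.mem_product, Finset.mem_Ioc] at hq
    have h1 := ite_coprime_eq_sum (m := q.1) (n := q.2) (s := Finset.Ioc 0 n) (fun d hd _ =>
      Finset.mem_Ioc.2 ⟨Nat.pos_of_dvd_of_pos hd hq.1.1, (Nat.le_of_dvd hq.1.1 hd).trans hq.1.2⟩)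
      hq.1.1.ne'
    by_cases ha : a.Coprime q.2
    · simp only [and_iff_left ha, Nat.cast_ite, Nat.cast_one, Nat.cast_zero]
      rw [h1, Finset.sum_filter]
      refine Finset.sum_congr rfl fun d _ => ?_
      by_cases h2 : d ∣ q.1 <;> by_cases h3 : d ∣ q.2 <;> simp [h2, h3]
    · simp [ha]
  rw [Finset.sum_congr rfl h, Finset.sum_comm]
  refine Finset.sum_congr rfl fun d hd => ?_
  have hd0 : d ≠ 0 := (Finset.mem_Ioc.1 hd).1.ne'
  rw [← Finset.mul_sum, Finset.sum_product, ← Finset.sum_mul_sum (f := fun k => if d ∣ k then (1 : ℝ) else 0)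
    (g := fun k => if d ∣ k ∧ a.Coprime k then (1 : ℝ) else 0), sum_ite_dvd_coprime a n hd0,
    ← Finset.sum_filter, Finset.sum_const, Nat.Ioc_filter_dvd_card_eq_div, nsmul_eq_mul, mul_one]
  split_ifs <;> simp

/-- The factor by which error terms depend on `a`. -/
noncomputable def divisorSum (a : ℕ) : ℝ := ∑ d ∈ a.divisors, (√(d : ℝ))⁻¹

theorem one_le_divisorSum {a : ℕ} (ha : a ≠ 0) : 1 ≤ divisorSum a := by
  have h : (1 : ℝ) = (√((1 : ℕ) : ℝ))⁻¹ := by simp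
  rw [h, divisorSum]
  exact Finset.single_le_sum (f := fun d : ℕ => (√(d : ℝ))⁻¹) (fun _ _ => by positivity)
    (Nat.one_mem_divisors.2 ha)

theorem abs_floor_sub_le_sqrt {z : ℝ} (hz : 0 ≤ z) : |(⌊z⌋₊ : ℝ) - z| ≤ √z := by
  have h1 := Nat.floor_le hz
  have h2 := Nat.lt_floor_add_one z
  rw [abs_sub_comm, abs_of_nonneg (by linarith)]
  rcases lt_or_ge z 1 with h | h
  · rw [Nat.floor_eq_zero.2 h]
    simp only [Nat.cast_zero, sub_zero]
    exact Real.le_sqrt_of_sq_le (by nlinarith)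
  · have := Real.one_le_sqrt.2 h
    linarith

theorem abs_coprimeCount_sub_le {a : ℕ} (ha : a ≠ 0) {z : ℝ} (hz : 0 ≤ z) :
    |(coprimeCount a ⌊z⌋₊ : ℝ) - z * ∏ p ∈ a.primeFactors, (1 - (p : ℝ)⁻¹)| ≤
      √z * divisorSum a := by
  have h1 := sum_divisors_moebiusTwist (fun p => (p : ℝ)⁻¹) ha
  have h2 := moebiusTwist_eq_mul (fun p => (p : ℝ)⁻¹) (fun n => (n : ℝ)⁻¹) fun n hn => by
    rw [Finset.prod_inv_distrib, ← Nat.cast_prod, Nat.prod_primeFactors_of_squarefree hn]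
  rw [← h1, coprimeCount_eq_sum ha, Finset.mul_sum, ← Finset.sum_sub_distrib, divisorSum,
    Finset.mul_sum]
  refine (Finset.abs_sum_le_sum_abs _ _).trans (Finset.sum_le_sum fun d _ => ?_)
  rw [h2, ← Nat.floor_div_natCast, show ∀ m w : ℝ, m * w - z * (m * (d : ℝ)⁻¹) =
    m * (w - z / d) by intros; ring, abs_mul]
  refine (mul_le_of_le_one_left (abs_nonneg _) (abs_moebius_le_one d)).trans ?_
  refine (abs_floor_sub_le_sqrt (by positivity)).trans_eq ?_
  rw [Real.sqrt_div hz, div_eq_mul_inv]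

/-- The density of coprime pairs whose second entry is coprime to `a`. -/
noncomputable def pairDensity (a : ℕ) : ℝ :=
  (∏ p ∈ a.primeFactors, (1 - (p : ℝ)⁻¹)) *
    ∑' d, moebiusTwist (fun p => if p ∣ a then 0 else ((p : ℝ) ^ 2)⁻¹) d

theorem moebiusTwist_coprime (a d : ℕ) :
    moebiusTwist (fun p => if p ∣ a then 0 else ((p : ℝ) ^ 2)⁻¹) d =
      (if a.Coprime d then (ArithmeticFunction.moebius d : ℝ) else 0) * ((d : ℝ) ^ 2)⁻¹ := by
  rw [moebiusTwist_eq_mul _ fun n => (if a.Coprime n then 1 else 0) * ((n : ℝ) ^ 2)⁻¹]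
  · split_ifs <;> simp
  · intro n hn
    split_ifs with h
    · rw [one_mul, Finset.prod_congr rfl (g := fun p : ℕ => ((p : ℝ) ^ 2)⁻¹)]
      · rw [Finset.prod_inv_distrib, Finset.prod_pow, ← Nat.cast_prod,
          Nat.prod_primeFactors_of_squarefree hn]
      · intro p hp
        rw [if_neg]
        intro hpa
        exact Nat.not_coprime_of_dvd_of_dvd (Nat.prime_of_mem_primeFactors hp).one_lt hpa
          (Nat.dvd_of_mem_primeFactors hp) h
    · obtain ⟨p, hp, h1, h2⟩ := Nat.Prime.not_coprime_iff_dvd.1 h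
      rw [zero_mul]
      refine Finset.prod_eq_zero (i := p) ?_ (if_pos h1)
      exact Nat.mem_primeFactors.2 ⟨hp, h2, hn.ne_zero⟩

theorem summable_moebiusTwist_coprime (a : ℕ) :
    Summable fun d => ‖moebiusTwist (fun p => if p ∣ a then 0 else ((p : ℝ) ^ 2)⁻¹) d‖ := by
  refine (Real.summable_nat_pow_inv.2 one_lt_two).of_nonneg_of_le (fun _ => norm_nonneg _) fun d => ?_
  rw [moebiusTwist_coprime, norm_mul, norm_inv, norm_pow, Real.norm_natCast]
  refine mul_le_of_le_one_left (by positivity) ?_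
  split_ifs
  · exact abs_moebius_le_one d
  · simp

theorem prod_one_sub_inv_mem (a : ℕ) : (∏ p ∈ a.primeFactors, (1 - (p : ℝ)⁻¹)) ∈ Set.Icc 0 1 := by
  have h : ∀ p : ℕ, 0 ≤ 1 - (p : ℝ)⁻¹ := fun p => sub_nonneg.2 p.cast_inv_le_one
  exact ⟨Finset.prod_nonneg fun p _ => h p,
    Finset.prod_le_one (fun p _ => h p) fun p _ => sub_le_self _ (by positivity)⟩

theorem abs_floor_mul_coprimeCount_sub_le {a : ℕ} (ha : a ≠ 0) {z : ℝ} (hz : 0 ≤ z) :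
    |(⌊z⌋₊ : ℝ) * coprimeCount a ⌊z⌋₊ - z ^ 2 * ∏ p ∈ a.primeFactors, (1 - (p : ℝ)⁻¹)| ≤
      2 * divisorSum a * (z * √z) := by
  set δ := ∏ p ∈ a.primeFactors, (1 - (p : ℝ)⁻¹)
  have h1 := abs_coprimeCount_sub_le ha hz
  have h2 := abs_floor_sub_le_sqrt hz
  have h3 : (coprimeCount a ⌊z⌋₊ : ℝ) ≤ z :=
    (Nat.cast_le.2 (coprimeCount_le a _)).trans (Nat.floor_le hz)
  have h4 := one_le_divisorSum ha
  calc |(⌊z⌋₊ : ℝ) * coprimeCount a ⌊z⌋₊ - z ^ 2 * δ|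
      = |(⌊z⌋₊ - z) * coprimeCount a ⌊z⌋₊ + z * (coprimeCount a ⌊z⌋₊ - z * δ)| := by ring_nf
    _ ≤ |(⌊z⌋₊ - z) * coprimeCount a ⌊z⌋₊| + |z * (coprimeCount a ⌊z⌋₊ - z * δ)| := abs_add_le _ _
    _ ≤ √z * z + z * (√z * divisorSum a) := by
      rw [abs_mul, abs_mul, abs_of_nonneg hz, Nat.abs_cast]
      gcongr
    _ ≤ 2 * divisorSum a * (z * √z) := by
      have : 0 ≤ z * √z := by positivity
      nlinarith

theorem summable_inv_mul_sqrt : Summable fun d : ℕ => ((d : ℝ) * √d)⁻¹ := by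
  refine (Real.summable_nat_rpow_inv (p := 3 / 2).2 (by norm_num)).congr fun d => ?_
  rcases d.eq_zero_or_pos with rfl | hd
  · simp [Real.zero_rpow]
  · rw [Real.sqrt_eq_rpow, ← Real.rpow_one_add' (by positivity) (by norm_num)]
    norm_num

/-- Coprime pairs are counted by Möbius inversion, uniformly in `a`. -/
theorem exists_abs_pairCount_sub_le : ∃ C : ℝ, 0 ≤ C ∧ ∀ {a : ℕ}, a ≠ 0 → ∀ {z : ℝ}, 0 ≤ z →
    |(pairCount a ⌊z⌋₊ : ℝ) - pairDensity a * z ^ 2| ≤ C * divisorSum a * (z * √z) := by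
  refine ⟨2 * ∑' d : ℕ, ((d : ℝ) * √d)⁻¹, by positivity, fun {a} ha {z} hz => ?_⟩
  set δ := ∏ p ∈ a.primeFactors, (1 - (p : ℝ)⁻¹)
  let m : ℕ → ℝ := fun d => if a.Coprime d then (ArithmeticFunction.moebius d : ℝ) else 0
  have hm : ∀ d, |m d| ≤ 1 := by
    intro d
    simp only [m]
    split_ifs
    · exact abs_moebius_le_one d
    · simp
  have h1 : HasSum (fun d : ℕ => m d * ((⌊z / d⌋₊ : ℝ) * coprimeCount a ⌊z / d⌋₊))
      (pairCount a ⌊z⌋₊) := by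
    rw [pairCount_eq_sum]
    simp only [Nat.floor_div_natCast]
    refine hasSum_sum_of_ne_finset_zero fun d hd => ?_
    have : ⌊z⌋₊ / d = 0 := by
      rw [Finset.mem_Ioc, not_and_or] at hd
      rw [Nat.div_eq_zero_iff]
      omega
    simp [this]
  have h2 : HasSum (fun d : ℕ => m d * ((z / d) ^ 2 * δ)) (pairDensity a * z ^ 2) := by
    convert! (summable_moebiusTwist_coprime a).of_norm.hasSum.mul_left (δ * z ^ 2) using 1
    · ext d
      rw [moebiusTwist_coprime]
      simp only [m]
      ring
    · rw [pairDensity]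
      ring
  have h3 : HasSum (fun d : ℕ => 2 * divisorSum a * (z * √z) * ((d : ℝ) * √d)⁻¹)
      (2 * (∑' d : ℕ, ((d : ℝ) * √d)⁻¹) * divisorSum a * (z * √z)) := by
    convert! summable_inv_mul_sqrt.hasSum.mul_left (2 * divisorSum a * (z * √z)) using 1
    ring
  refine (h1.sub h2).norm_le_of_bounded h3 fun d => ?_
  rw [← mul_sub, norm_mul]
  refine (mul_le_of_le_one_left (norm_nonneg _) (hm d)).trans ?_
  refine (abs_floor_mul_coprimeCount_sub_le ha (by positivity)).trans_eq ?_
  rw [Real.sqrt_div hz, mul_inv]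
  ring

/-! ### Partial summation -/

theorem sum_Ioc_mul_eq (r w : ℕ → ℝ) (N : ℕ) : ∑ n ∈ Finset.Ioc 0 N, r n * w n =
    (∑ n ∈ Finset.Ioc 0 N, r n) * w (N + 1) +
      ∑ n ∈ Finset.Ioc 0 N, (∑ m ∈ Finset.Ioc 0 n, r m) * (w n - w (n + 1)) := by
  induction N with
  | zero => simp
  | succ N ih =>
    simp only [Finset.sum_Ioc_succ_top N.zero_le]
    rw [ih]
    ring

theorem abs_sum_inv_sub_log_le {x : ℝ} (hx : 1 ≤ x) :
    |∑ n ∈ Finset.Ioc 0 ⌊x⌋₊, (n : ℝ)⁻¹ - Real.log x| ≤ 1 := by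
  have h : ((harmonic ⌊x⌋₊ : ℚ) : ℝ) = ∑ n ∈ Finset.Ioc 0 ⌊x⌋₊, (n : ℝ)⁻¹ := by
    rw [harmonic_eq_sum_Icc]
    push_cast
    rfl
  have h1 := log_le_harmonic_floor x (by linarith)
  have h2 := harmonic_floor_le_one_add_log x hx
  rw [h] at h1 h2
  rw [abs_le]
  constructor <;> linarith

theorem sum_inv_sqrt_le (N : ℕ) : ∑ n ∈ Finset.Ioc 0 N, (√(n : ℝ))⁻¹ ≤ 2 * √N := by
  induction N with
  | zero => simp
  | succ N ih =>
    rw [Finset.sum_Ioc_succ_top N.zero_le]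
    have h1 : √((N + 1 : ℕ) : ℝ) ^ 2 = √(N : ℝ) ^ 2 + 1 := by
      rw [Real.sq_sqrt (by positivity), Real.sq_sqrt (by positivity)]
      push_cast
      rfl
    have h2 : 0 < √((N + 1 : ℕ) : ℝ) := Real.sqrt_pos.2 (by positivity)
    have h3 := Real.sqrt_nonneg (N : ℝ)
    generalize √((N + 1 : ℕ) : ℝ) = s at *
    generalize √(N : ℝ) = t at *
    have h4 : s⁻¹ ≤ 2 * s - 2 * t := by
      rw [inv_le_iff_one_le_mul₀ h2]
      nlinarith [sq_nonneg (s - t)]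
    linarith

/-! ### Counting pairs of coprime pairs -/

/-- The number of coprime pairs of positive integers with maximum `n` whose second entry is
coprime to `a`. -/
def maxCount (a n : ℕ) : ℕ :=
  {q ∈ Finset.Ioc 0 n ×ˢ Finset.Ioc 0 n |
    (q.1.Coprime q.2 ∧ a.Coprime q.2) ∧ max q.1 q.2 = n}.card

/-- The number of pairs of coprime pairs, with second entries coprime to `a`, such that the product
of their maxima is at most `N`. -/
def quadCount (a N : ℕ) : ℕ := ∑ n ∈ Finset.Ioc 0 N, maxCount a n * pairCount a (N / n)

theorem sum_maxCount (a N : ℕ) : ∑ n ∈ Finset.Ioc 0 N, maxCount a n = pairCount a N := by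
  rw [pairCount, Finset.card_eq_sum_card_fiberwise (f := fun q : ℕ × ℕ => max q.1 q.2)
    (t := Finset.Ioc 0 N)]
  · refine Finset.sum_congr rfl fun n hn => ?_
    rw [maxCount]
    congr 1
    ext q
    simp only [Finset.mem_filter, Finset.mem_product, Finset.mem_Ioc] at hn ⊢
    constructor
    · rintro ⟨h1, h2, h3⟩
      exact ⟨⟨⟨⟨h1.1.1, h1.1.2.trans hn.2⟩, h1.2.1, h1.2.2.trans hn.2⟩, h2⟩, h3⟩
    · rintro ⟨⟨h1, h2⟩, h3⟩
      exact ⟨⟨⟨h1.1.1, h3 ▸ le_max_left _ _⟩, h1.2.1, h3 ▸ le_max_right _ _⟩, h2, h3⟩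
  · intro q hq
    simp only [Finset.coe_filter, Finset.mem_product, Finset.mem_Ioc, Set.mem_ofPred_eq,
      Finset.coe_Ioc, Set.mem_Ioc] at hq ⊢
    exact ⟨lt_max_of_lt_left hq.1.1.1, max_le hq.1.1.2 hq.1.2.2⟩

theorem maxCount_le (a n : ℕ) : maxCount a n ≤ 2 * n := by
  calc maxCount a n ≤ (({n} : Finset ℕ) ×ˢ Finset.Ioc 0 n ∪ Finset.Ioc 0 n ×ˢ ({n} : Finset ℕ)).card := by
        refine Finset.card_le_card fun q hq => ?_
        simp only [Finset.mem_filter, Finset.mem_product, Finset.mem_union,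
          Finset.mem_singleton] at hq ⊢
        rcases max_choice q.1 q.2 with h | h
        · exact Or.inl ⟨h ▸ hq.2.2, hq.1.2⟩
        · exact Or.inr ⟨hq.1.1, h ▸ hq.2.2⟩
    _ ≤ _ := Finset.card_union_le _ _
    _ = 2 * n := by simp [two_mul]

theorem pairCount_le (a n : ℕ) : pairCount a n ≤ n ^ 2 := by
  refine (Finset.card_filter_le _ _).trans_eq ?_
  simp [sq]

theorem exists_abs_pairDensity_le : ∃ C : ℝ, 0 ≤ C ∧ ∀ a, |pairDensity a| ≤ C := by
  refine ⟨∑' d : ℕ, ((d : ℝ) ^ 2)⁻¹, by positivity, fun a => ?_⟩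
  rw [pairDensity, abs_mul]
  refine (mul_le_of_le_one_left (abs_nonneg _) ?_).trans ?_
  · rw [abs_of_nonneg (prod_one_sub_inv_mem a).1]
    exact (prod_one_sub_inv_mem a).2
  · rw [← Real.norm_eq_abs]
    refine tsum_of_norm_bounded (Real.summable_nat_pow_inv.2 one_lt_two).hasSum fun d => ?_
    rw [moebiusTwist_coprime, norm_mul, norm_inv, norm_pow, Real.norm_natCast]
    refine mul_le_of_le_one_left (by positivity) ?_
    split_ifs
    · exact abs_moebius_le_one d
    · simp

theorem inv_sq_le_inv_mul_sqrt (n : ℕ) : ((n : ℝ) ^ 2)⁻¹ ≤ ((n : ℝ) * √n)⁻¹ := by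
  rcases n.eq_zero_or_pos with rfl | hn
  · simp
  · have h : (1 : ℝ) ≤ n := by exact_mod_cast hn
    have : √(n : ℝ) ≤ n := Real.sqrt_le_iff.2 ⟨by linarith, by nlinarith⟩
    rw [sq]
    have : 0 < √(n : ℝ) := Real.sqrt_pos.2 (by linarith)
    gcongr

/-- Summing `maxCount a n / n ^ 2` by parts. -/
theorem exists_abs_sum_maxCount_div_sub_le : ∃ C : ℝ, 0 ≤ C ∧ ∀ {a : ℕ}, a ≠ 0 → ∀ {x : ℝ}, 1 ≤ x →
    |∑ n ∈ Finset.Ioc 0 ⌊x⌋₊, (maxCount a n : ℝ) * ((n : ℝ) ^ 2)⁻¹ -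
      2 * pairDensity a * Real.log x| ≤ C * divisorSum a := by
  obtain ⟨C, hC, hG⟩ := exists_abs_pairCount_sub_le
  obtain ⟨D, hD, hκ⟩ := exists_abs_pairDensity_le
  set S := ∑' d : ℕ, ((d : ℝ) * √d)⁻¹
  have hS : 0 ≤ S := by positivity
  refine ⟨1 + (3 * D + 2 * C) * S + 2 * D, by positivity, fun {a} ha {x} hx => ?_⟩
  set κ := pairDensity a
  set h := divisorSum a
  have hh : 1 ≤ h := one_le_divisorSum ha
  have hκ := hκ a
  set N := ⌊x⌋₊
  have hsum : ∀ n, ∑ m ∈ Finset.Ioc 0 n, (maxCount a m : ℝ) = pairCount a n := fun n => by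
    exact_mod_cast sum_maxCount a n
  have e1 := sum_Ioc_mul_eq (fun n => (maxCount a n : ℝ)) (fun n => ((n : ℝ) ^ 2)⁻¹) N
  simp only [hsum] at e1
  have e2 : |(pairCount a N : ℝ) * (((N + 1 : ℕ) : ℝ) ^ 2)⁻¹| ≤ 1 := by
    rw [abs_of_nonneg (by positivity), mul_inv_le_iff₀ (by positivity), one_mul]
    have : (pairCount a N : ℝ) ≤ (N : ℝ) ^ 2 := by exact_mod_cast pairCount_le a N
    refine this.trans ?_
    push_cast
    gcongr
    linarith
  have e3 : |∑ n ∈ Finset.Ioc 0 N, (pairCount a n : ℝ) *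
        (((n : ℝ) ^ 2)⁻¹ - (((n + 1 : ℕ) : ℝ) ^ 2)⁻¹) -
      2 * κ * ∑ n ∈ Finset.Ioc 0 N, (n : ℝ)⁻¹| ≤ (3 * D + 2 * C * h) * S := by
    rw [Finset.mul_sum, ← Finset.sum_sub_distrib]
    refine (Finset.abs_sum_le_sum_abs _ _).trans ?_
    refine le_trans (Finset.sum_le_sum (g := fun n : ℕ => (3 * D + 2 * C * h) * ((n : ℝ) * √n)⁻¹)
      fun n hn => ?_) ?_
    · have hn1 : (1 : ℝ) ≤ n := by exact_mod_cast (Finset.mem_Ioc.1 hn).1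
      have hn0 : (0 : ℝ) < n := by linarith
      have g1 := hG ha hn0.le
      rw [Nat.floor_natCast] at g1
      set w := ((n : ℝ) ^ 2)⁻¹ - (((n + 1 : ℕ) : ℝ) ^ 2)⁻¹ with hw
      have w1 : (n : ℝ) ^ 2 * w = 2 / (n + 1) - 1 / (n + 1) ^ 2 := by
        rw [hw]
        push_cast
        field_simp
        ring
      have w0 : 0 ≤ w := by
        rw [hw, sub_nonneg]
        gcongr
        simp
      have w2 : (n : ℝ) * √n * w ≤ 2 * ((n : ℝ) * √n)⁻¹ := by
        have hs : √(n : ℝ) * √n = n := Real.mul_self_sqrt hn0.le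
        have hs0 : 0 < √(n : ℝ) := Real.sqrt_pos.2 hn0
        rw [← div_eq_mul_inv, le_div_iff₀ (by positivity)]
        calc (n : ℝ) * √n * w * (n * √n) = (n : ℝ) ^ 2 * w * (√n * √n) := by ring
          _ = (2 / (n + 1) - 1 / (n + 1) ^ 2) * n := by rw [w1, hs]
          _ ≤ 2 := by
            have : 2 / ((n : ℝ) + 1) * n ≤ 2 := by
              rw [div_mul_eq_mul_div, div_le_iff₀ (by positivity)]
              linarith
            have : 0 ≤ 1 / ((n : ℝ) + 1) ^ 2 * n := by positivity
            linarith
      have w3 : |(n : ℝ) ^ 2 * w - 2 * (n : ℝ)⁻¹| ≤ 3 * ((n : ℝ) ^ 2)⁻¹ := by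
        rw [w1, abs_le]
        have k1 : ((n : ℝ) ^ 2)⁻¹ = (n : ℝ)⁻¹ * (n : ℝ)⁻¹ := by rw [sq, mul_inv]
        have k2 : (n : ℝ)⁻¹ - 1 / (n + 1) = (n : ℝ)⁻¹ * (1 / (n + 1)) := by field_simp; ring
        have k3 : 1 / ((n : ℝ) + 1) ^ 2 = 1 / (n + 1) * (1 / (n + 1)) := by field_simp
        have k4 : 2 / ((n : ℝ) + 1) = 2 * (1 / (n + 1)) := by ring
        have k5 : 1 / ((n : ℝ) + 1) ≤ (n : ℝ)⁻¹ := by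
          rw [one_div]
          gcongr
          linarith
        have k6 : 0 ≤ 1 / ((n : ℝ) + 1) := by positivity
        rw [k1, k3, k4]
        generalize (n : ℝ)⁻¹ = u at *
        generalize 1 / ((n : ℝ) + 1) = v at *
        constructor <;> nlinarith
      calc |(pairCount a n : ℝ) * w - 2 * κ * (n : ℝ)⁻¹|
          = |(pairCount a n - κ * (n : ℝ) ^ 2) * w + κ * ((n : ℝ) ^ 2 * w - 2 * (n : ℝ)⁻¹)| := by
            ring_nf
        _ ≤ |(pairCount a n - κ * (n : ℝ) ^ 2) * w| + |κ * ((n : ℝ) ^ 2 * w - 2 * (n : ℝ)⁻¹)| :=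
            abs_add_le _ _
        _ ≤ C * h * (n * √n) * w + D * (3 * ((n : ℝ) ^ 2)⁻¹) := by
            rw [abs_mul, abs_mul, abs_of_nonneg w0]
            gcongr
        _ ≤ C * h * (2 * ((n : ℝ) * √n)⁻¹) + D * (3 * ((n : ℝ) * √n)⁻¹) := by
            rw [mul_assoc (C * h)]
            have := inv_sq_le_inv_mul_sqrt n
            gcongr
        _ = _ := by ring
    · rw [← Finset.mul_sum]
      have := summable_inv_mul_sqrt.sum_le_tsum (Finset.Ioc 0 N) fun n _ => by positivity
      gcongr
  have e4 := abs_sum_inv_sub_log_le hx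
  calc |∑ n ∈ Finset.Ioc 0 N, (maxCount a n : ℝ) * ((n : ℝ) ^ 2)⁻¹ - 2 * κ * Real.log x|
      = |(pairCount a N : ℝ) * (((N + 1 : ℕ) : ℝ) ^ 2)⁻¹ + (∑ n ∈ Finset.Ioc 0 N, (pairCount a n : ℝ) *
        (((n : ℝ) ^ 2)⁻¹ - (((n + 1 : ℕ) : ℝ) ^ 2)⁻¹) - 2 * κ * ∑ n ∈ Finset.Ioc 0 N, (n : ℝ)⁻¹) +
          2 * κ * (∑ n ∈ Finset.Ioc 0 N, (n : ℝ)⁻¹ - Real.log x)| := by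
        rw [e1]
        ring_nf
    _ ≤ 1 + (3 * D + 2 * C * h) * S + 2 * D * 1 := by
        refine (abs_add_three _ _ _).trans ?_
        rw [abs_mul (2 * κ), abs_mul 2, abs_two]
        gcongr
    _ ≤ (1 + (3 * D + 2 * C) * S + 2 * D) * h := by
        have p1 : D * S * 1 ≤ D * S * h := by gcongr
        have p2 : D * 1 ≤ D * h := by gcongr
        nlinarith

/-- The contribution of a fixed `a₁ = a` to the number of points. -/
theorem exists_abs_quadCount_sub_le : ∃ C : ℝ, 0 ≤ C ∧ ∀ {a : ℕ}, a ≠ 0 → ∀ {x : ℝ}, 1 ≤ x →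
    |(quadCount a ⌊x⌋₊ : ℝ) - 2 * pairDensity a ^ 2 * x ^ 2 * Real.log x| ≤
      C * divisorSum a * x ^ 2 := by
  obtain ⟨C, hC, hG⟩ := exists_abs_pairCount_sub_le
  obtain ⟨D, hD, hκ⟩ := exists_abs_pairDensity_le
  obtain ⟨E, hE, hT⟩ := exists_abs_sum_maxCount_div_sub_le
  refine ⟨4 * C + D * E, by positivity, fun {a} ha {x} hx => ?_⟩
  have hT := hT ha hx
  have hκ := hκ a
  set κ := pairDensity a
  set h := divisorSum a
  have hh : 1 ≤ h := one_le_divisorSum ha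
  have hx0 : 0 < x := by linarith
  have hs : √x * √x = x := Real.mul_self_sqrt hx0.le
  set T := ∑ n ∈ Finset.Ioc 0 ⌊x⌋₊, (maxCount a n : ℝ) * ((n : ℝ) ^ 2)⁻¹
  have e1 : |(quadCount a ⌊x⌋₊ : ℝ) - κ * x ^ 2 * T| ≤ 4 * C * h * x ^ 2 := by
    rw [quadCount, Finset.mul_sum]
    push_cast
    rw [← Finset.sum_sub_distrib]
    refine (Finset.abs_sum_le_sum_abs _ _).trans ?_
    refine le_trans (Finset.sum_le_sum (g := fun n : ℕ => 2 * C * h * (x * √x) * (√(n : ℝ))⁻¹)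
      fun n hn => ?_) ?_
    · have hn1 : (1 : ℝ) ≤ n := by exact_mod_cast (Finset.mem_Ioc.1 hn).1
      have hn0 : (0 : ℝ) < n := by linarith
      have hs0 : 0 < √(n : ℝ) := Real.sqrt_pos.2 hn0
      have g1 := hG ha (z := x / n) (by positivity)
      rw [Nat.floor_div_natCast, Real.sqrt_div hx0.le] at g1
      have g2 : (maxCount a n : ℝ) ≤ 2 * n := by exact_mod_cast maxCount_le a n
      calc |(maxCount a n : ℝ) * pairCount a (⌊x⌋₊ / n) - κ * x ^ 2 * (maxCount a n * ((n : ℝ) ^ 2)⁻¹)|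
          = |(maxCount a n : ℝ) * (pairCount a (⌊x⌋₊ / n) - κ * (x / n) ^ 2)| := by
            congr 1
            rw [div_pow]
            ring
        _ ≤ 2 * n * (C * h * (x / n * (√x / √n))) := by
            rw [abs_mul, Nat.abs_cast]
            gcongr
        _ = _ := by
            field_simp
    · rw [← Finset.mul_sum]
      calc 2 * C * h * (x * √x) * ∑ n ∈ Finset.Ioc 0 ⌊x⌋₊, (√(n : ℝ))⁻¹
          ≤ 2 * C * h * (x * √x) * (2 * √x) := by
            gcongr
            refine (sum_inv_sqrt_le _).trans ?_
            gcongr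
            exact Nat.floor_le hx0.le
        _ = 4 * C * h * x * (√x * √x) := by ring
        _ = _ := by rw [hs]; ring
  calc |(quadCount a ⌊x⌋₊ : ℝ) - 2 * κ ^ 2 * x ^ 2 * Real.log x|
      = |((quadCount a ⌊x⌋₊ : ℝ) - κ * x ^ 2 * T) + κ * x ^ 2 * (T - 2 * κ * Real.log x)| := by
        ring_nf
    _ ≤ 4 * C * h * x ^ 2 + D * x ^ 2 * (E * h) := by
        refine (abs_add_le _ _).trans ?_
        rw [abs_mul, abs_mul, abs_of_nonneg (by positivity : 0 ≤ x ^ 2)]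
        gcongr
    _ = _ := by ring

/-! ### The mean value of the squared densities -/

/-- The value at a prime of the squarefree convolution factor of `a ↦ pairDensity a ^ 2`. -/
noncomputable def densityDefect (p : ℕ) : ℝ := 1 - ((1 + (p : ℝ)⁻¹) ^ 2)⁻¹

/-- The density of all coprime pairs. -/
noncomputable def coprimeDensity : ℝ := ∑' d, moebiusTwist (fun p => ((p : ℝ) ^ 2)⁻¹) d

/-- The mean value of `(pairDensity a / coprimeDensity) ^ 2`. -/
noncomputable def meanDensity : ℝ := ∑' d, moebiusTwist (fun p => densityDefect p * (p : ℝ)⁻¹) d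

theorem moebiusTwist_inv_sq (d : ℕ) :
    moebiusTwist (fun p => ((p : ℝ) ^ 2)⁻¹) d =
      moebiusTwist (fun p => if p ∣ 1 then 0 else ((p : ℝ) ^ 2)⁻¹) d := by
  rcases eq_or_ne d 0 with rfl | hd
  · simp
  · rw [moebiusTwist_apply _ hd, moebiusTwist_apply _ hd]
    congr 1
    refine Finset.prod_congr rfl fun p hp => ?_
    rw [if_neg (Nat.prime_of_mem_primeFactors hp).not_dvd_one]

theorem hasProd_coprimeDensity :
    HasProd (fun p : Nat.Primes => 1 - (((p : ℕ) : ℝ) ^ 2)⁻¹) coprimeDensity := by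
  refine hasProd_one_sub (fun p => ((p : ℝ) ^ 2)⁻¹) ?_
  simp only [moebiusTwist_inv_sq]
  exact summable_moebiusTwist_coprime 1

theorem prod_mul_tsum_coprime {a : ℕ} (ha : a ≠ 0) :
    (∏ p ∈ a.primeFactors, (1 - ((p : ℝ) ^ 2)⁻¹)) *
      ∑' d, moebiusTwist (fun p => if p ∣ a then 0 else ((p : ℝ) ^ 2)⁻¹) d = coprimeDensity := by
  have h1 := hasProd_one_sub _ (summable_moebiusTwist_coprime a)
  have h2 : HasProd (fun p : Nat.Primes => if (p : ℕ) ∣ a then 1 - (((p : ℕ) : ℝ) ^ 2)⁻¹ else 1)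
      (∏ p ∈ a.primeFactors, (1 - ((p : ℝ) ^ 2)⁻¹)) := by
    have h3 : ∏ p ∈ a.primeFactors, (1 - ((p : ℝ) ^ 2)⁻¹) =
        ∏ p ∈ a.primeFactors.subtype Nat.Prime,
          if (p : ℕ) ∣ a then 1 - (((p : ℕ) : ℝ) ^ 2)⁻¹ else 1 := by
      rw [Finset.prod_subtype_of_mem
        (f := fun p : ℕ => if p ∣ a then 1 - ((p : ℝ) ^ 2)⁻¹ else 1)
        fun p hp => Nat.prime_of_mem_primeFactors hp]
      exact Finset.prod_congr rfl fun p hp => (if_pos (Nat.dvd_of_mem_primeFactors hp)).symm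
    rw [h3]
    refine hasProd_prod_of_ne_finset_one fun p hp => if_neg fun hpa => hp ?_
    exact Finset.mem_subtype.2 (Nat.mem_primeFactors.2 ⟨p.2, hpa, ha⟩)
  refine (h2.mul h1).unique ?_
  convert! hasProd_coprimeDensity using 2 with p
  split_ifs <;> simp

theorem pairDensity_sq {a : ℕ} (ha : a ≠ 0) :
    pairDensity a ^ 2 = coprimeDensity ^ 2 * ∏ p ∈ a.primeFactors, (1 - densityDefect p) := by
  have h : ∏ p ∈ a.primeFactors, (1 - ((p : ℝ) ^ 2)⁻¹) =
      (∏ p ∈ a.primeFactors, (1 - (p : ℝ)⁻¹)) * ∏ p ∈ a.primeFactors, (1 + (p : ℝ)⁻¹) := by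
    rw [← Finset.prod_mul_distrib]
    refine Finset.prod_congr rfl fun p _ => ?_
    rw [← inv_pow]
    ring
  have h0 : ∏ p ∈ a.primeFactors, (1 + (p : ℝ)⁻¹) ≠ 0 :=
    Finset.prod_ne_zero_iff.2 fun p _ => by positivity
  simp only [densityDefect, sub_sub_cancel]
  rw [Finset.prod_inv_distrib, Finset.prod_pow, ← prod_mul_tsum_coprime ha, h, pairDensity]
  field_simp

theorem moebiusTwist_densityDefect (d : ℕ) :
    moebiusTwist (fun p => densityDefect p * (p : ℝ)⁻¹) d =
      moebiusTwist densityDefect d * (d : ℝ)⁻¹ := by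
  rcases eq_or_ne d 0 with rfl | hd
  · simp
  · rw [moebiusTwist_apply _ hd, moebiusTwist_apply _ hd]
    by_cases h : Squarefree d
    · rw [Finset.prod_mul_distrib, Finset.prod_inv_distrib, ← Nat.cast_prod,
        Nat.prod_primeFactors_of_squarefree h, mul_assoc]
    · rw [ArithmeticFunction.moebius_eq_zero_of_not_squarefree h]
      simp

theorem densityDefect_mem {p : ℕ} (hp : p ≠ 0) : densityDefect p ∈ Set.Icc 0 (√(p : ℝ))⁻¹ := by
  have h1 : (1 : ℝ) ≤ p := by exact_mod_cast Nat.one_le_iff_ne_zero.2 hp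
  have h2 : 1 ≤ √(p : ℝ) := Real.one_le_sqrt.2 h1
  have h3 : (p : ℝ) = √p ^ 2 := (Real.sq_sqrt (by positivity)).symm
  rw [densityDefect]
  constructor
  · rw [sub_nonneg]
    refine inv_le_one_of_one_le₀ (one_le_pow₀ ?_)
    linarith [inv_nonneg.2 (zero_le_one.trans h1)]
  · rw [h3, Real.sqrt_sq (by positivity)]
    generalize √(p : ℝ) = s at h2
    have hs : 0 < s := by linarith
    have e : (s : ℝ)⁻¹ - (1 - ((1 + (s ^ 2)⁻¹) ^ 2)⁻¹) =
        ((s ^ 2 - s) ^ 2 + (s ^ 2 - s) + 1) / (s * (s ^ 2 + 1) ^ 2) := by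
      field_simp
      ring
    have : 0 ≤ ((s ^ 2 - s) ^ 2 + (s ^ 2 - s) + 1) / (s * (s ^ 2 + 1) ^ 2) := by
      have : 0 ≤ s ^ 2 - s := by nlinarith
      positivity
    linarith

theorem abs_moebiusTwist_densityDefect_le (d : ℕ) :
    |moebiusTwist (fun p => densityDefect p * (p : ℝ)⁻¹) d| ≤ ((d : ℝ) * √d)⁻¹ := by
  let F : ℕ →* ℝ :=
    { toFun := fun d => ((d : ℝ) * √d)⁻¹
      map_one' := by simp
      map_mul' := fun m n => by
        rw [Nat.cast_mul, Real.sqrt_mul (by positivity), ← mul_inv]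
        congr 1
        ring }
  refine abs_moebiusTwist_le _ F (fun n => ?_) (fun p hp => ?_) d
  · change 0 ≤ ((n : ℝ) * √n)⁻¹
    positivity
  · change |densityDefect p * (p : ℝ)⁻¹| ≤ ((p : ℝ) * √p)⁻¹
    have h := densityDefect_mem hp.ne_zero
    rw [abs_of_nonneg (mul_nonneg h.1 (by positivity)), mul_inv, mul_comm]
    exact mul_le_mul_of_nonneg_left h.2 (by positivity)

theorem hasProd_meanDensity :
    HasProd (fun p : Nat.Primes => 1 - densityDefect p * ((p : ℕ) : ℝ)⁻¹) meanDensity :=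
  hasProd_one_sub (fun p => densityDefect p * (p : ℝ)⁻¹)
    (summable_inv_mul_sqrt.of_nonneg_of_le (fun _ => norm_nonneg _)
      abs_moebiusTwist_densityDefect_le)

theorem hasProd_explicitFactor :
    HasProd explicitFactor (coprimeDensity ^ 2 * meanDensity) := by
  convert! (hasProd_coprimeDensity.pow 2).mul hasProd_meanDensity using 2 with p
  have h : ((p : ℕ) : ℝ) ≠ 0 := by exact_mod_cast p.2.ne_zero
  have h1 : ((p : ℕ) : ℝ) + 1 ≠ 0 := by positivity
  rw [explicitFactor, densityDefect]
  field_simp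
  ring

theorem tprod_explicitFactor_ne_zero : ∏' p, explicitFactor p ≠ 0 := by
  have h : ∀ p : Nat.Primes, explicitFactor p = 1 + (explicitFactor p - 1) := fun p => by ring
  rw [tprod_congr h]
  refine tprod_one_add_ne_zero_of_summable (fun p => ?_) ?_
  · rw [← h, explicitFactor]
    have hp : (1 : ℝ) / ((p : ℕ) : ℝ) ≤ 1 / 2 :=
      one_div_le_one_div_of_le two_pos (by exact_mod_cast p.2.two_le)
    have hp0 : 0 < (1 : ℝ) / ((p : ℕ) : ℝ) := one_div_pos.2 (by exact_mod_cast p.2.pos)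
    rw [show (2 : ℝ) / ((p : ℕ) : ℝ) = 2 * (1 / ((p : ℕ) : ℝ)) by ring, ← one_div_pow,
      ← one_div_pow]
    generalize (1 : ℝ) / ((p : ℕ) : ℝ) = u at *
    have : 0 < 1 - u := by linarith
    have : 0 < 1 + 2 * u - u ^ 2 - u ^ 3 := by nlinarith [mul_pos hp0 hp0]
    positivity
  · have hs : Summable fun p : Nat.Primes => 16 * (((p : ℕ) : ℝ) ^ 2)⁻¹ :=
      ((Real.summable_nat_pow_inv.2 one_lt_two).comp_injective Subtype.val_injective).mul_left 16
    refine hs.of_nonneg_of_le (fun _ => norm_nonneg _) fun p => ?_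
    rw [explicitFactor, show (2 : ℝ) / ((p : ℕ) : ℝ) = 2 * (1 / ((p : ℕ) : ℝ)) by ring,
      ← one_div_pow, ← one_div_pow, ← inv_pow, ← one_div]
    have hp : (1 : ℝ) / ((p : ℕ) : ℝ) ≤ 1 := by
      rw [one_div]
      exact Nat.cast_inv_le_one _
    have hp0 : 0 ≤ (1 : ℝ) / ((p : ℕ) : ℝ) := by positivity
    generalize (1 : ℝ) / ((p : ℕ) : ℝ) = u at *
    rw [show (1 - u) ^ 2 * (1 + 2 * u - u ^ 2 - u ^ 3) - 1 =
      u ^ 2 * (-4 + 3 * u + u ^ 2 - u ^ 3) by ring, norm_mul, norm_pow, Real.norm_eq_abs,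
      sq_abs, mul_comm]
    refine mul_le_mul_of_nonneg_right ?_ (by positivity)
    rw [Real.norm_eq_abs, abs_le]
    have : u ^ 2 ≤ 1 := pow_le_one₀ hp0 hp
    have : u ^ 3 ≤ 1 := pow_le_one₀ hp0 hp
    have : 0 ≤ u ^ 2 := by positivity
    have : 0 ≤ u ^ 3 := by positivity
    constructor <;> linarith

/-! ### Summation over the last variable -/

/-- The arithmetic function `n ↦ 1 / n`. -/
noncomputable def invFun : ArithmeticFunction ℝ := ⟨fun n => (n : ℝ)⁻¹, by simp⟩

theorem invFun_apply (n : ℕ) : invFun n = (n : ℝ)⁻¹ := rfl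

theorem sum_invFun_le {N n : ℕ} (hN : N ≠ 0) :
    ∑ m ∈ Finset.Ioc 0 (N / n), invFun m ≤ 1 + Real.log N := by
  have h1 : (1 : ℝ) ≤ N := by exact_mod_cast Nat.one_le_iff_ne_zero.2 hN
  have h2 := (abs_le.1 (abs_sum_inv_sub_log_le h1)).2
  rw [Nat.floor_natCast] at h2
  calc ∑ m ∈ Finset.Ioc 0 (N / n), invFun m ≤ ∑ m ∈ Finset.Ioc 0 N, invFun m := by
        refine Finset.sum_le_sum_of_subset_of_nonneg
          (Finset.Ioc_subset_Ioc_right (Nat.div_le_self _ _)) fun m _ _ => ?_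
        rw [invFun_apply]
        positivity
    _ = ∑ m ∈ Finset.Ioc 0 N, (m : ℝ)⁻¹ := rfl
    _ ≤ 1 + Real.log N := by linarith

theorem exists_sum_divisorSum_div_le : ∃ C : ℝ, 0 ≤ C ∧ ∀ {N : ℕ}, N ≠ 0 →
    ∑ a ∈ Finset.Ioc 0 N, divisorSum a * (a : ℝ)⁻¹ ≤ C * (1 + Real.log N) := by
  refine ⟨∑' d : ℕ, ((d : ℝ) * √d)⁻¹, by positivity, fun {N} hN => ?_⟩
  let f : ArithmeticFunction ℝ := ⟨fun d => ((d : ℝ) * √d)⁻¹, by simp⟩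
  have hlog : 0 ≤ 1 + Real.log N := by
    have := Real.log_natCast_nonneg N
    linarith
  have h : ∀ a ∈ Finset.Ioc 0 N, divisorSum a * (a : ℝ)⁻¹ = (f * invFun) a := by
    intro a _
    rw [ArithmeticFunction.mul_apply, divisorSum, Finset.sum_mul,
      ← Nat.sum_divisorsAntidiagonal fun d _ => (√(d : ℝ))⁻¹ * (a : ℝ)⁻¹]
    refine Finset.sum_congr rfl fun q hq => ?_
    rw [← (Nat.mem_divisorsAntidiagonal.1 hq).1]
    change _ = ((q.1 : ℝ) * √q.1)⁻¹ * (q.2 : ℝ)⁻¹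
    rw [Nat.cast_mul, mul_inv, mul_inv]
    ring
  rw [Finset.sum_congr rfl h, ArithmeticFunction.sum_Ioc_mul_eq_sum_sum]
  calc ∑ n ∈ Finset.Ioc 0 N, f n * ∑ m ∈ Finset.Ioc 0 (N / n), invFun m
      ≤ ∑ n ∈ Finset.Ioc 0 N, ((n : ℝ) * √n)⁻¹ * (1 + Real.log N) := by
        refine Finset.sum_le_sum fun n _ => ?_
        change ((n : ℝ) * √n)⁻¹ * _ ≤ _
        exact mul_le_mul_of_nonneg_left (sum_invFun_le hN) (by positivity)
    _ ≤ _ := by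
        rw [← Finset.sum_mul]
        exact mul_le_mul_of_nonneg_right
          (summable_inv_mul_sqrt.sum_le_tsum _ fun n _ => by positivity) hlog

theorem summable_inv_mul_sqrt_mul_log :
    Summable fun d : ℕ => ((d : ℝ) * √d)⁻¹ * (1 + Real.log d) := by
  have h := (Real.summable_nat_rpow_inv (p := 5 / 4)).2 (by norm_num)
  refine (h.mul_left 5).of_nonneg_of_le (fun d => ?_) fun d => ?_
  · have := Real.log_natCast_nonneg d
    positivity
  · rcases d.eq_zero_or_pos with rfl | hd
    · simp [Real.zero_rpow]
    · have hd1 : (1 : ℝ) ≤ d := by exact_mod_cast hd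
      have hd0 : (0 : ℝ) < d := by linarith
      have h1 := Real.log_le_rpow_div hd0.le (ε := 1 / 4) (by norm_num)
      have h2 : (1 : ℝ) ≤ (d : ℝ) ^ (1 / 4 : ℝ) := Real.one_le_rpow hd1 (by norm_num)
      have h3 : (d : ℝ) * √d = (d : ℝ) ^ (5 / 4 : ℝ) * (d : ℝ) ^ (1 / 4 : ℝ) := by
        rw [Real.sqrt_eq_rpow, ← Real.rpow_one_add' hd0.le (by norm_num),
          ← Real.rpow_add hd0]
        norm_num
      have h4 : 0 < (d : ℝ) ^ (5 / 4 : ℝ) := by positivity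
      rw [h3, mul_inv, mul_assoc, mul_comm 5]
      refine mul_le_mul_of_nonneg_left ?_ (by positivity)
      rw [inv_mul_le_iff₀ (by positivity)]
      linarith

theorem prod_mul_inv_eq_mul_apply {a : ℕ} (ha : a ≠ 0) :
    (∏ p ∈ a.primeFactors, (1 - densityDefect p)) * (a : ℝ)⁻¹ =
      (moebiusTwist (fun p => densityDefect p * (p : ℝ)⁻¹) * invFun) a := by
  rw [ArithmeticFunction.mul_apply, ← sum_divisors_moebiusTwist densityDefect ha, Finset.sum_mul,
    ← Nat.sum_divisorsAntidiagonal fun d _ => moebiusTwist densityDefect d * (a : ℝ)⁻¹]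
  refine Finset.sum_congr rfl fun q hq => ?_
  rw [moebiusTwist_densityDefect, ← (Nat.mem_divisorsAntidiagonal.1 hq).1, invFun_apply,
    Nat.cast_mul, mul_inv, mul_assoc]

/-- The logarithmic mean of the densities. -/
theorem exists_abs_sum_prod_div_sub_le : ∃ C : ℝ, 0 ≤ C ∧ ∀ {N : ℕ}, N ≠ 0 →
    |∑ a ∈ Finset.Ioc 0 N, (∏ p ∈ a.primeFactors, (1 - densityDefect p)) * (a : ℝ)⁻¹ -
      meanDensity * Real.log N| ≤ C := by
  have hs := summable_inv_mul_sqrt_mul_log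
  refine ⟨∑' d : ℕ, ((d : ℝ) * √d)⁻¹ * (1 + Real.log d), tsum_nonneg fun d => ?_,
    fun {N} hN => ?_⟩
  · have := Real.log_natCast_nonneg d
    positivity
  have hN1 : (1 : ℝ) ≤ N := by exact_mod_cast Nat.one_le_iff_ne_zero.2 hN
  rw [Finset.sum_congr rfl fun a ha => prod_mul_inv_eq_mul_apply (Finset.mem_Ioc.1 ha).1.ne',
    ArithmeticFunction.sum_Ioc_mul_eq_sum_sum]
  have hb := abs_moebiusTwist_densityDefect_le
  have h0 : HasSum (moebiusTwist fun p => densityDefect p * (p : ℝ)⁻¹) meanDensity :=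
    (Summable.of_norm (summable_inv_mul_sqrt.of_nonneg_of_le (fun _ => norm_nonneg _) hb)).hasSum
  generalize (moebiusTwist fun p => densityDefect p * (p : ℝ)⁻¹) = t at *
  have h1 : HasSum (fun d : ℕ => t d * ∑ m ∈ Finset.Ioc 0 (N / d), invFun m)
      (∑ d ∈ Finset.Ioc 0 N, t d * ∑ m ∈ Finset.Ioc 0 (N / d), invFun m) := by
    refine hasSum_sum_of_ne_finset_zero fun d hd => ?_
    have : N / d = 0 := by
      rw [Finset.mem_Ioc, not_and_or] at hd
      rw [Nat.div_eq_zero_iff]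
      omega
    simp [this]
  have h2 : HasSum (fun d : ℕ => t d * Real.log N) (meanDensity * Real.log N) :=
    h0.mul_right _
  refine (h1.sub h2).norm_le_of_bounded hs.hasSum fun d => ?_
  rw [← mul_sub, norm_mul, Real.norm_eq_abs, Real.norm_eq_abs]
  rcases d.eq_zero_or_pos with rfl | hd
  · simp
  have hd1 : (1 : ℝ) ≤ d := by exact_mod_cast hd
  have hd0 : (0 : ℝ) < d := by linarith
  refine mul_le_mul (hb d) ?_ (abs_nonneg _) (by positivity)
  have hlogd : 0 ≤ Real.log d := Real.log_nonneg hd1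
  rcases le_or_gt d N with hdN | hdN
  · have hx : (1 : ℝ) ≤ (N : ℝ) / d := by
      rw [one_le_div hd0]
      exact_mod_cast hdN
    have h3 := abs_sum_inv_sub_log_le hx
    rw [Nat.floor_div_natCast, Nat.floor_natCast, Real.log_div (by linarith) hd0.ne'] at h3
    simp only [invFun_apply]
    rw [abs_le] at h3 ⊢
    constructor <;> linarith
  · rw [Nat.div_eq_of_lt hdN]
    have h3 : Real.log N ≤ Real.log d := Real.log_le_log (by linarith) (by exact_mod_cast hdN.le)
    have h4 : 0 ≤ Real.log N := Real.log_nonneg hN1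
    rw [Finset.Ioc_self, Finset.sum_empty, zero_sub, abs_neg, abs_of_nonneg h4]
    linarith

/-- If the partial sums of `u` grow like `K log n`, then summation by parts
gives `∑ u(a) log (x / a) ∼ K / 2 * (log x) ^ 2`. -/
theorem exists_abs_sum_mul_log_sub_le {u : ℕ → ℝ} {K C : ℝ}
    (hu : ∀ N : ℕ, N ≠ 0 → |∑ a ∈ Finset.Ioc 0 N, u a - K * Real.log N| ≤ C) :
    ∃ D : ℝ, 0 ≤ D ∧ ∀ {x : ℝ}, 1 ≤ x →
      |∑ a ∈ Finset.Ioc 0 ⌊x⌋₊, u a * Real.log (x / a) - K / 2 * Real.log x ^ 2| ≤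
        D * (1 + Real.log x) := by
  have hC : 0 ≤ C := (abs_nonneg _).trans (hu 1 one_ne_zero)
  refine ⟨3 * |K| + 3 * C, by positivity, fun {x} hx => ?_⟩
  set N := ⌊x⌋₊ with hN
  have hx0 : 0 < x := by linarith
  have hN0 : N ≠ 0 := (Nat.floor_pos.2 hx).ne'
  have hN1 : (1 : ℝ) ≤ N := by exact_mod_cast Nat.one_le_iff_ne_zero.2 hN0
  have hNx : (N : ℝ) ≤ x := Nat.floor_le hx0.le
  have hxN : x ≤ N + 1 := (Nat.lt_floor_add_one x).le
  have hlogx : 0 ≤ Real.log x := Real.log_nonneg hx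
  have hΔ : ∀ n : ℕ, n ≠ 0 → 0 ≤ Real.log ((n + 1 : ℕ) : ℝ) - Real.log n ∧
      Real.log ((n + 1 : ℕ) : ℝ) - Real.log n ≤ 1 := by
    intro n hn
    have h1 : (1 : ℝ) ≤ n := by exact_mod_cast Nat.one_le_iff_ne_zero.2 hn
    rw [← Real.log_div (by positivity) (by positivity)]
    have h2 : (((n + 1 : ℕ) : ℝ)) / n = 1 + 1 / n := by
      push_cast
      field_simp
    have h3 : (1 : ℝ) / n ≤ 1 := by
      rw [div_le_one (by linarith)]
      exact h1
    constructor
    · refine Real.log_nonneg ?_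
      rw [h2]
      have : (0 : ℝ) ≤ 1 / n := by positivity
      linarith
    · refine (Real.log_le_sub_one_of_pos (by positivity)).trans ?_
      rw [h2]
      linarith
  have htel : ∀ f : ℕ → ℝ, ∑ n ∈ Finset.Ioc 0 N, (f (n + 1) - f n) = f (N + 1) - f 1 := by
    intro f
    generalize N = M
    induction M with
    | zero => simp
    | succ M ih =>
      rw [Finset.sum_Ioc_succ_top M.zero_le, ih]
      ring
  set L := Real.log ((N + 1 : ℕ) : ℝ) with hL
  have hL1 : Real.log x ≤ L := Real.log_le_log hx0 (by push_cast; exact hxN)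
  have hL2 : L ≤ Real.log x + 1 := by
    have h1 := (hΔ N hN0).2
    have h2 : Real.log N ≤ Real.log x := Real.log_le_log (by linarith) hNx
    linarith
  have e1 := sum_Ioc_mul_eq u (fun a => Real.log x - Real.log a) N
  have e0 : ∑ a ∈ Finset.Ioc 0 N, u a * Real.log (x / a) =
      ∑ a ∈ Finset.Ioc 0 N, u a * (Real.log x - Real.log a) := by
    refine Finset.sum_congr rfl fun a ha => ?_
    have ha0 : (a : ℝ) ≠ 0 := by exact_mod_cast (Finset.mem_Ioc.1 ha).1.ne'
    rw [Real.log_div hx0.ne' ha0]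
  simp only [sub_sub_sub_cancel_left] at e1
  -- the main term is a telescoping sum of `(log (n + 1) ^ 2 - log n ^ 2) / 2`
  have e2 : |∑ n ∈ Finset.Ioc 0 N, (∑ m ∈ Finset.Ioc 0 n, u m) *
      (Real.log ((n + 1 : ℕ) : ℝ) - Real.log n) - K / 2 * L ^ 2| ≤ (C + |K| / 2) * L := by
    have h1 := htel fun n => Real.log n ^ 2
    have h2 := htel fun n => Real.log n
    simp only [Nat.cast_one, Real.log_one, ne_eq, OfNat.ofNat_ne_zero, not_false_eq_true, zero_pow,
      sub_zero] at h1 h2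
    rw [hL, ← h1, Finset.mul_sum, ← Finset.sum_sub_distrib]
    refine (Finset.abs_sum_le_sum_abs _ _).trans ?_
    rw [← h2, Finset.mul_sum]
    refine Finset.sum_le_sum fun n hn => ?_
    have hn0 : n ≠ 0 := (Finset.mem_Ioc.1 hn).1.ne'
    obtain ⟨d0, d1⟩ := hΔ n hn0
    have h3 := hu n hn0
    generalize ∑ m ∈ Finset.Ioc 0 n, u m = U at *
    generalize Real.log ((n + 1 : ℕ) : ℝ) = l' at *
    generalize Real.log (n : ℝ) = l at *
    calc |U * (l' - l) - K / 2 * (l' ^ 2 - l ^ 2)|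
        = |(U - K * l) * (l' - l) - K / 2 * ((l' - l) * (l' - l))| := by ring_nf
      _ ≤ |(U - K * l) * (l' - l)| + |K / 2 * ((l' - l) * (l' - l))| := abs_sub _ _
      _ ≤ C * (l' - l) + |K| / 2 * ((l' - l) * 1) := by
        rw [abs_mul, abs_mul, abs_mul, abs_div, abs_two, abs_of_nonneg d0]
        gcongr
      _ = _ := by ring
  have e3 : |(∑ n ∈ Finset.Ioc 0 N, u n) * (Real.log x - L)| ≤ |K| * Real.log x + C := by
    have h1 := hu N hN0
    have h2 : |Real.log x - L| ≤ 1 := by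
      rw [abs_le]
      constructor <;> linarith
    have h3 : Real.log N ≤ Real.log x := Real.log_le_log (by linarith) hNx
    have h4 : 0 ≤ Real.log N := Real.log_nonneg hN1
    rw [abs_mul]
    refine (mul_le_of_le_one_right (abs_nonneg _) h2).trans ?_
    calc |∑ n ∈ Finset.Ioc 0 N, u n| = |K * Real.log N +
          (∑ n ∈ Finset.Ioc 0 N, u n - K * Real.log N)| := by ring_nf
      _ ≤ |K * Real.log N| + |∑ n ∈ Finset.Ioc 0 N, u n - K * Real.log N| := abs_add_le _ _
      _ ≤ |K| * Real.log x + C := by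
        rw [abs_mul, abs_of_nonneg h4]
        gcongr
  have e4 : |K / 2 * (L ^ 2 - Real.log x ^ 2)| ≤ |K| / 2 * (2 * Real.log x + 1) := by
    rw [abs_mul, abs_div, abs_two,
      abs_of_nonneg (by nlinarith : 0 ≤ L ^ 2 - Real.log x ^ 2)]
    gcongr
    nlinarith
  rw [e0, e1, ← hL]
  have e5 : (C + |K| / 2) * L ≤ (C + |K| / 2) * (Real.log x + 1) := by gcongr
  have hK := abs_nonneg K
  calc _ = |(∑ n ∈ Finset.Ioc 0 N, u n) * (Real.log x - L) +
        (∑ n ∈ Finset.Ioc 0 N, (∑ m ∈ Finset.Ioc 0 n, u m) *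
          (Real.log ((n + 1 : ℕ) : ℝ) - Real.log n) - K / 2 * L ^ 2) +
        K / 2 * (L ^ 2 - Real.log x ^ 2)| := by
        congr 1
        ring
    _ ≤ (|K| * Real.log x + C) + (C + |K| / 2) * (Real.log x + 1) +
        |K| / 2 * (2 * Real.log x + 1) := by
        refine (abs_add_three _ _ _).trans ?_
        linarith
    _ ≤ _ := by nlinarith [mul_nonneg hK hlogx, mul_nonneg hC hlogx]

/-- The number of tuples of positive integers `a`, `b₀`, `b₁`, `c₀`, `c₁` satisfying the coprimality
conditions and the height condition. -/
noncomputable def tupleCount (B : ℝ) : ℕ := ∑ a ∈ Finset.Ioc 0 ⌊B⌋₊, quadCount a ⌊√(B / a)⌋₊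

theorem exists_abs_tupleCount_sub_le : ∃ C : ℝ, 0 ≤ C ∧ ∀ {B : ℝ}, 1 ≤ B →
    |(tupleCount B : ℝ) - coprimeDensity ^ 2 * meanDensity / 2 * B * Real.log B ^ 2| ≤
      C * B * (1 + Real.log B) := by
  obtain ⟨C₁, hC₁, h1⟩ := exists_abs_quadCount_sub_le
  obtain ⟨C₂, hC₂, h2⟩ := exists_sum_divisorSum_div_le
  obtain ⟨C₃, -, h3⟩ := exists_abs_sum_prod_div_sub_le
  obtain ⟨C₄, hC₄, h4⟩ := exists_abs_sum_mul_log_sub_le fun N hN => h3 hN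
  set E := coprimeDensity
  refine ⟨C₁ * C₂ + E ^ 2 * C₄, by positivity, fun {B} hB => ?_⟩
  have hB0 : 0 < B := by linarith
  have hN0 : ⌊B⌋₊ ≠ 0 := (Nat.floor_pos.2 hB).ne'
  set u : ℕ → ℝ := fun a => (∏ p ∈ a.primeFactors, (1 - densityDefect p)) * (a : ℝ)⁻¹
  have e1 : |(tupleCount B : ℝ) - E ^ 2 * B * ∑ a ∈ Finset.Ioc 0 ⌊B⌋₊, u a * Real.log (B / a)| ≤
      C₁ * B * ∑ a ∈ Finset.Ioc 0 ⌊B⌋₊, divisorSum a * (a : ℝ)⁻¹ := by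
    rw [tupleCount, Nat.cast_sum, Finset.mul_sum, Finset.mul_sum, ← Finset.sum_sub_distrib]
    refine (Finset.abs_sum_le_sum_abs _ _).trans (Finset.sum_le_sum fun a ha => ?_)
    obtain ⟨ha0, haN⟩ := Finset.mem_Ioc.1 ha
    have ha1 : (0 : ℝ) < a := by exact_mod_cast ha0
    have haB : (1 : ℝ) ≤ B / a := by
      rw [one_le_div ha1]
      exact (Nat.le_floor_iff hB0.le).1 haN
    have h := h1 ha0.ne' (Real.one_le_sqrt.2 haB)
    rw [Real.sq_sqrt (by positivity), Real.log_sqrt (by positivity), pairDensity_sq ha0.ne'] at h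
    refine (le_of_eq ?_).trans (h.trans_eq ?_)
    · congr 1
      simp only [u]
      ring
    · ring
  have e2 : C₁ * B * ∑ a ∈ Finset.Ioc 0 ⌊B⌋₊, divisorSum a * (a : ℝ)⁻¹ ≤
      C₁ * B * (C₂ * (1 + Real.log B)) := by
    have h5 : Real.log ⌊B⌋₊ ≤ Real.log B :=
      Real.log_le_log (by exact_mod_cast Nat.pos_of_ne_zero hN0) (Nat.floor_le hB0.le)
    have h6 := h2 hN0
    have h7 : C₂ * (1 + Real.log ⌊B⌋₊) ≤ C₂ * (1 + Real.log B) := by gcongr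
    exact mul_le_mul_of_nonneg_left (h6.trans h7) (by positivity)
  have e3 := h4 hB
  calc _ = |((tupleCount B : ℝ) - E ^ 2 * B * ∑ a ∈ Finset.Ioc 0 ⌊B⌋₊, u a * Real.log (B / a)) +
        E ^ 2 * B * (∑ a ∈ Finset.Ioc 0 ⌊B⌋₊, u a * Real.log (B / a) -
          meanDensity / 2 * Real.log B ^ 2)| := by
        congr 1
        ring
    _ ≤ C₁ * B * (C₂ * (1 + Real.log B)) + E ^ 2 * B * (C₄ * (1 + Real.log B)) := by
        refine (abs_add_le _ _).trans (add_le_add (e1.trans e2) ?_)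
        rw [abs_mul, abs_of_nonneg (by positivity : 0 ≤ E ^ 2 * B)]
        exact mul_le_mul_of_nonneg_left e3 (by positivity)
    _ = _ := by ring

/-! ### Parametrization of the integral points -/

/-- The pairs of coprime pairs counted by `quadCount`. -/
def quadruples (a N : ℕ) : Finset ((ℕ × ℕ) × ℕ × ℕ) :=
  {q ∈ (Finset.Ioc 0 N ×ˢ Finset.Ioc 0 N) ×ˢ (Finset.Ioc 0 N ×ˢ Finset.Ioc 0 N) |
    (q.1.1.Coprime q.1.2 ∧ a.Coprime q.1.2) ∧ (q.2.1.Coprime q.2.2 ∧ a.Coprime q.2.2) ∧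
      max q.1.1 q.1.2 * max q.2.1 q.2.2 ≤ N}

theorem mem_quadruples {a N : ℕ} {q : (ℕ × ℕ) × ℕ × ℕ} : q ∈ quadruples a N ↔
    (0 < q.1.1 ∧ 0 < q.1.2 ∧ 0 < q.2.1 ∧ 0 < q.2.2) ∧
      (q.1.1.Coprime q.1.2 ∧ a.Coprime q.1.2) ∧ (q.2.1.Coprime q.2.2 ∧ a.Coprime q.2.2) ∧
      max q.1.1 q.1.2 * max q.2.1 q.2.2 ≤ N := by
  simp only [quadruples, Finset.mem_filter, Finset.mem_product, Finset.mem_Ioc]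
  constructor
  · rintro ⟨⟨⟨⟨h1, -⟩, h2, -⟩, ⟨h3, -⟩, h4, -⟩, h⟩
    exact ⟨⟨h1, h2, h3, h4⟩, h⟩
  · rintro ⟨⟨h1, h2, h3, h4⟩, h⟩
    have hN := h.2.2
    have k1 : max q.1.1 q.1.2 ≤ N :=
      (Nat.le_mul_of_pos_right _ (lt_max_of_lt_left h3)).trans hN
    have k2 : max q.2.1 q.2.2 ≤ N :=
      (Nat.le_mul_of_pos_left _ (lt_max_of_lt_left h1)).trans hN
    exact ⟨⟨⟨⟨h1, (le_max_left _ _).trans k1⟩, h2, (le_max_right _ _).trans k1⟩,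
      ⟨h3, (le_max_left _ _).trans k2⟩, h4, (le_max_right _ _).trans k2⟩, h⟩

theorem card_quadruples (a N : ℕ) : (quadruples a N).card = quadCount a N := by
  rw [quadCount, Finset.card_eq_sum_card_fiberwise
    (f := fun q : (ℕ × ℕ) × ℕ × ℕ => max q.1.1 q.1.2) (t := Finset.Ioc 0 N)]
  · refine Finset.sum_congr rfl fun n hn => ?_
    obtain ⟨hn0, hnN⟩ := Finset.mem_Ioc.1 hn
    rw [maxCount, pairCount, ← Finset.card_product]
    congr 1
    ext q
    simp only [Finset.mem_filter, mem_quadruples, Finset.mem_product, Finset.mem_Ioc]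
    constructor
    · rintro ⟨⟨⟨h1, h2, h3, h4⟩, h5, h6, h7⟩, rfl⟩
      have h8 : max q.2.1 q.2.2 ≤ N / max q.1.1 q.1.2 := by
        rwa [Nat.le_div_iff_mul_le hn0, mul_comm]
      exact ⟨⟨⟨⟨h1, le_max_left _ _⟩, h2, le_max_right _ _⟩, h5, rfl⟩,
        ⟨⟨h3, (le_max_left _ _).trans h8⟩, h4, (le_max_right _ _).trans h8⟩, h6⟩
    · rintro ⟨⟨⟨⟨h1, -⟩, h2, -⟩, h5, rfl⟩, ⟨⟨h3, h3'⟩, h4, h4'⟩, h6⟩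
      refine ⟨⟨⟨h1, h2, h3, h4⟩, h5, h6, ?_⟩, rfl⟩
      rw [mul_comm, ← Nat.le_div_iff_mul_le hn0]
      exact max_le h3' h4'
  · intro q hq
    obtain ⟨⟨h1, -, h3, -⟩, -, -, h⟩ := mem_quadruples.1 hq
    exact Finset.mem_coe.2 (Finset.mem_Ioc.2 ⟨lt_max_of_lt_left h1,
      (Nat.le_mul_of_pos_right _ (lt_max_of_lt_left h3)).trans h⟩)

/-- The tuples counted by `tupleCount`. -/
noncomputable def tuples (B : ℝ) : Finset (Σ _ : ℕ, (ℕ × ℕ) × ℕ × ℕ) :=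
  (Finset.Ioc 0 ⌊B⌋₊).sigma fun a => quadruples a ⌊√(B / a)⌋₊

theorem mem_tuples {B : ℝ} {q : Σ _ : ℕ, (ℕ × ℕ) × ℕ × ℕ} : q ∈ tuples B ↔ 0 < q.1 ∧
    (0 < q.2.1.1 ∧ 0 < q.2.1.2 ∧ 0 < q.2.2.1 ∧ 0 < q.2.2.2) ∧
    (q.2.1.1.Coprime q.2.1.2 ∧ q.1.Coprime q.2.1.2) ∧
    (q.2.2.1.Coprime q.2.2.2 ∧ q.1.Coprime q.2.2.2) ∧
    (q.1 : ℝ) * max (q.2.1.1 : ℝ) q.2.1.2 ^ 2 * max (q.2.2.1 : ℝ) q.2.2.2 ^ 2 ≤ B := by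
  obtain ⟨a, ⟨b0, b1⟩, c0, c1⟩ := q
  simp only [tuples, Finset.mem_sigma, Finset.mem_Ioc, mem_quadruples]
  have key : 0 < a → 0 < b0 → 0 < c0 →
      ((a ≤ ⌊B⌋₊ ∧ max b0 b1 * max c0 c1 ≤ ⌊√(B / a)⌋₊) ↔
        (a : ℝ) * max (b0 : ℝ) b1 ^ 2 * max (c0 : ℝ) c1 ^ 2 ≤ B) := by
    intro ha hb hc
    have ha' : (1 : ℝ) ≤ a := by exact_mod_cast ha
    have hb' : (1 : ℝ) ≤ max (b0 : ℝ) b1 := le_max_of_le_left (by exact_mod_cast hb)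
    have hc' : (1 : ℝ) ≤ max (c0 : ℝ) c1 := le_max_of_le_left (by exact_mod_cast hc)
    rw [Nat.le_floor_iff' ha.ne', Nat.le_floor_iff (Real.sqrt_nonneg _),
      Real.le_sqrt' (by positivity), le_div_iff₀ (by linarith), Nat.cast_mul, Nat.cast_max,
      Nat.cast_max]
    have e : (max (b0 : ℝ) b1 * max (c0 : ℝ) c1) ^ 2 * a =
        a * max (b0 : ℝ) b1 ^ 2 * max (c0 : ℝ) c1 ^ 2 := by ring
    rw [e]
    refine ⟨fun h => h.2, fun h => ⟨le_trans ?_ h, h⟩⟩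
    have h1 : (1 : ℝ) ≤ max (b0 : ℝ) b1 ^ 2 := one_le_pow₀ hb'
    have h2 : (1 : ℝ) ≤ max (c0 : ℝ) c1 ^ 2 := one_le_pow₀ hc'
    calc (a : ℝ) = a * 1 * 1 := by ring
      _ ≤ _ := by gcongr
  constructor
  · rintro ⟨⟨ha, ha'⟩, h1, h2, h3, h4⟩
    exact ⟨ha, h1, h2, h3, (key ha h1.1 h1.2.2.1).1 ⟨ha', h4⟩⟩
  · rintro ⟨ha, h1, h2, h3, h4⟩
    obtain ⟨h5, h6⟩ := (key ha h1.1 h1.2.2.1).2 h4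
    exact ⟨⟨ha, h5⟩, h1, h2, h3, h6⟩

theorem card_tuples (B : ℝ) : (tuples B).card = tupleCount B := by
  rw [tuples, Finset.card_sigma, tupleCount]
  exact Finset.sum_congr rfl fun a _ => card_quadruples _ _

/-- A nonzero rational number from its sign, numerator and denominator. -/
def signedQuot (e : ℤˣ) (m n : ℕ) : ℚ := ((e : ℤ) * (m : ℤ) : ℤ) / ((n : ℤ) : ℚ)

theorem signedQuot_inj {e e' : ℤˣ} {m n m' n' : ℕ} (hm : 0 < m) (hn : 0 < n) (hn' : 0 < n')
    (h : m.Coprime n) (h' : m'.Coprime n') (heq : signedQuot e m n = signedQuot e' m' n') :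
    e = e' ∧ m = m' ∧ n = n' := by
  have hnat : ∀ (e : ℤˣ) (m : ℕ), ((e : ℤ) * (m : ℤ)).natAbs = m := fun e m => by
    rw [Int.natAbs_mul, Int.units_natAbs, one_mul, Int.natAbs_natCast]
  obtain ⟨h1, h2⟩ := Rat.div_int_inj (by exact_mod_cast hn) (by exact_mod_cast hn')
    (by rwa [hnat, Int.natAbs_natCast]) (by rwa [hnat, Int.natAbs_natCast]) heq
  have h3 : m = m' := by rw [← hnat e m, h1, hnat]
  refine ⟨?_, h3, by exact_mod_cast h2⟩
  subst h3
  have hm' : (m : ℤ) ≠ 0 := by exact_mod_cast hm.ne'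
  exact Units.ext (mul_right_cancel₀ hm' h1)

theorem exists_signedQuot_eq {m n : ℤ} (hm : m ≠ 0) (hn : n ≠ 0) :
    ∃ e : ℤˣ, (m : ℚ) / n = signedQuot e m.natAbs n.natAbs := by
  have key : ∀ k : ℤ, k ≠ 0 → ∃ u : ℤˣ, (k : ℚ) = ((u : ℤ) : ℚ) * ((k.natAbs : ℤ) : ℚ) := by
    intro k hk
    rcases Int.natAbs_eq k with h | h
    · exact ⟨1, by rw [Units.val_one, Int.cast_one, one_mul, ← h]⟩
    · refine ⟨-1, ?_⟩
      conv_lhs => rw [h]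
      simp
  obtain ⟨u, hu⟩ := key m hm
  obtain ⟨v, hv⟩ := key n hn
  refine ⟨u * v, ?_⟩
  rw [hu, hv, signedQuot]
  have hv1 : ((v : ℤ) : ℚ) * ((v : ℤ) : ℚ) = 1 := by
    have := Int.units_coe_mul_self v
    exact_mod_cast this
  have hv0 : ((v : ℤ) : ℚ) ≠ 0 := left_ne_zero_of_mul_eq_one hv1
  have hn0 : ((n.natAbs : ℤ) : ℚ) ≠ 0 := by simpa using hn
  rw [Units.val_mul]
  push_cast at hn0 ⊢
  rw [div_eq_div_iff (mul_ne_zero hv0 hn0) hn0]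
  linear_combination (-(u : ℤ) : ℚ) * |(m : ℚ)| * |(n : ℚ)| * hv1

/-- The integral point belonging to a choice of signs and a tuple of positive integers. -/
noncomputable def tuplePoint (q : (ℤˣ × ℤˣ × ℤˣ) × Σ _ : ℕ, (ℕ × ℕ) × ℕ × ℕ) : Points ℚ :=
  chart ![signedQuot q.1.1 1 q.2.1, signedQuot q.1.2.1 q.2.2.1.1 q.2.2.1.2,
    signedQuot q.1.2.2 q.2.2.2.1 q.2.2.2.2]

theorem tuplePoint_injOn (B : ℝ) : Set.InjOn tuplePoint
    ((Finset.univ : Finset (ℤˣ × ℤˣ × ℤˣ)) ×ˢ tuples B : Finset _) := by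
  rintro ⟨⟨e, e', e''⟩, a, ⟨b0, b1⟩, c0, c1⟩ hq ⟨⟨d, d', d''⟩, a', ⟨b0', b1'⟩, c0', c1'⟩ hr h
  obtain ⟨ha, ⟨hb0, hb1, hc0, hc1⟩, ⟨hb, -⟩, ⟨hc, -⟩, -⟩ :=
    mem_tuples.1 (Finset.mem_product.1 (Finset.mem_coe.1 hq)).2
  obtain ⟨ha', ⟨hb0', hb1', hc0', hc1'⟩, ⟨hb', -⟩, ⟨hc', -⟩, -⟩ :=
    mem_tuples.1 (Finset.mem_product.1 (Finset.mem_coe.1 hr)).2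
  have h := chart_injective h
  have h0 := congrFun h 0
  have h1 := congrFun h 1
  have h2 := congrFun h 2
  simp only [Matrix.cons_val_zero, Matrix.cons_val_one, Matrix.cons_val] at h0 h1 h2
  obtain ⟨rfl, -, rfl⟩ := signedQuot_inj one_pos ha ha' (Nat.coprime_one_left _)
    (Nat.coprime_one_left _) h0
  obtain ⟨rfl, rfl, rfl⟩ := signedQuot_inj hb0 hb1 hb1' hb hb' h1
  obtain ⟨rfl, rfl, rfl⟩ := signedQuot_inj hc0 hc1 hc1' hc hc' h2
  rfl

theorem abs_units_mul (e : ℤˣ) (m : ℕ) : |(((e : ℤ) * (m : ℤ) : ℤ) : ℝ)| = m := by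
  rw [← Int.cast_abs, abs_mul, Int.abs_eq_natAbs, Int.units_natAbs]
  simp

theorem isCoprime_units_mul (e : ℤˣ) {m n : ℕ} (h : m.Coprime n) :
    IsCoprime ((e : ℤ) * (m : ℤ)) (n : ℤ) :=
  (isCoprime_mul_unit_left_left e.isUnit _ _).2 (Nat.isCoprime_iff_coprime.2 h)

theorem image_tuplePoint (B : ℝ) :
    tuplePoint '' ((Finset.univ : Finset (ℤˣ × ℤˣ × ℤˣ)) ×ˢ tuples B : Finset _) =
      {P | P ∈ integralPoints ℚ ℤ ∧ P ∈ torus ℚ ∧ height P ≤ B} := by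
  ext P
  constructor
  · rintro ⟨⟨⟨e, e', e''⟩, a, ⟨b0, b1⟩, c0, c1⟩, hq, rfl⟩
    obtain ⟨ha, ⟨hb0, hb1, hc0, hc1⟩, ⟨hb, hab⟩, ⟨hc, hac⟩, hB⟩ :=
      mem_tuples.1 (Finset.mem_product.1 (Finset.mem_coe.1 hq)).2
    simp only at ha hb0 hb1 hc0 hc1 hb hab hc hac hB
    have hrep : IsIntegralRep (tuplePoint ⟨⟨e, e', e''⟩, a, ⟨b0, b1⟩, c0, c1⟩)
        ![(e : ℤ) * ((1 : ℕ) : ℤ), (a : ℤ)] ![(e' : ℤ) * (b0 : ℤ), (b1 : ℤ)]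
        ![(e'' : ℤ) * (c0 : ℤ), (c1 : ℤ)] := by
      rw [tuplePoint, isIntegralRep_chart_iff]
      simp only [Matrix.cons_val_zero, Matrix.cons_val_one, Matrix.cons_val, signedQuot,
        algebraMap_int_eq, eq_intCast, and_true]
      refine ⟨isCoprime_units_mul e (Nat.coprime_one_left a), isCoprime_units_mul e' hb,
        isCoprime_units_mul e'' hc, ?_, Nat.isCoprime_iff_coprime.2 hab,
        Nat.isCoprime_iff_coprime.2 hac, ?_, ?_, ?_⟩
      · simp
      · exact_mod_cast ha.ne'
      · exact_mod_cast hb1.ne'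
      · exact_mod_cast hc1.ne'
    have htor : tuplePoint ⟨⟨e, e', e''⟩, a, ⟨b0, b1⟩, c0, c1⟩ ∈ torus ℚ := by
      refine mem_torus_iff.2 ⟨_, fun i => ?_, rfl⟩
      fin_cases i <;> simp [signedQuot] <;> omega
    refine ⟨⟨_, _, _, hrep⟩, htor, ?_⟩
    rw [height_eq htor hrep]
    simp only [Matrix.cons_val_zero, Matrix.cons_val_one, abs_units_mul, Int.cast_natCast,
      Nat.abs_cast]
    exact hB
  · rintro ⟨⟨a, b, c, hrep⟩, htor, hB⟩
    rw [height_eq htor hrep] at hB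
    obtain ⟨t, ht, rfl⟩ := mem_torus_iff.1 htor
    rw [isIntegralRep_chart_iff] at hrep
    obtain ⟨-, hb, hc, ha, hab, hac, ⟨ha1, e0⟩, ⟨hb1, e1⟩, ⟨hc1, e2⟩⟩ := hrep
    simp only [algebraMap_int_eq, eq_intCast, Ne, Int.cast_eq_zero] at ha1 hb1 hc1 e0 e1 e2
    have hb0 : b 0 ≠ 0 := fun h => ht 1 (by rw [e1, h, Int.cast_zero, zero_div])
    have hc0 : c 0 ≠ 0 := fun h => ht 2 (by rw [e2, h, Int.cast_zero, zero_div])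
    obtain ⟨e, he⟩ := exists_signedQuot_eq ha.ne_zero ha1
    obtain ⟨e', he'⟩ := exists_signedQuot_eq hb0 hb1
    obtain ⟨e'', he''⟩ := exists_signedQuot_eq hc0 hc1
    rw [Int.isUnit_iff_natAbs_eq.1 ha] at he
    refine ⟨⟨⟨e, e', e''⟩, (a 1).natAbs, ⟨(b 0).natAbs, (b 1).natAbs⟩, (c 0).natAbs,
      (c 1).natAbs⟩, ?_, ?_⟩
    · refine Finset.mem_coe.2 (Finset.mem_product.2 ⟨Finset.mem_univ _, mem_tuples.2 ?_⟩)
      simp only [Nat.cast_natAbs, Int.cast_abs, Int.natAbs_pos]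
      exact ⟨ha1, ⟨hb0, hb1, hc0, hc1⟩,
        ⟨Int.isCoprime_iff_gcd_eq_one.1 hb, Int.isCoprime_iff_gcd_eq_one.1 hab⟩,
        ⟨Int.isCoprime_iff_gcd_eq_one.1 hc, Int.isCoprime_iff_gcd_eq_one.1 hac⟩, hB⟩
    · rw [tuplePoint]
      congr 1
      ext i
      fin_cases i
      · exact (e0.trans he).symm
      · exact (e1.trans he').symm
      · exact (e2.trans he'').symm

/-- There are eight choices of signs. -/
theorem countingFunction_eq (B : ℝ) : countingFunction B = 8 * tupleCount B := by
  rw [countingFunction, ← image_tuplePoint, (tuplePoint_injOn B).ncard_image,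
    Set.ncard_coe_finset, Finset.card_product, card_tuples, Nat.cast_mul]
  simp

/-! ### Integration over the `p`-adic numbers -/

section PadicIntegral

variable (p : ℕ) [Fact p.Prime]

instance : (padicHaar p).IsAddHaarMeasure := by
  unfold padicHaar
  infer_instance

theorem padicHaar_unitBall : padicHaar p (Metric.closedBall 0 1) = 1 :=
  Measure.addHaarMeasure_self

theorem padic_closedBall_eq_iUnion (k : ℤ) : Metric.closedBall (0 : ℚ_[p]) ((p : ℝ) ^ (k + 1)) =
    ⋃ i ∈ Finset.range p, Metric.closedBall ((i : ℚ_[p]) * (p : ℚ_[p]) ^ (-(k + 1)))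
      ((p : ℝ) ^ k) := by
  have hp0 : (0 : ℝ) < p := by exact_mod_cast (Fact.out : p.Prime).pos
  have hp1 : (1 : ℝ) ≤ p := by exact_mod_cast (Fact.out : p.Prime).one_le
  set c : ℚ_[p] := (p : ℚ_[p]) ^ (-(k + 1))
  have hc : ‖c‖ = (p : ℝ) ^ (k + 1) := by rw [Padic.norm_p_zpow, neg_neg]
  have hc0 : c ≠ 0 := by
    rw [← norm_pos_iff, hc]
    positivity
  ext x
  simp only [Metric.mem_closedBall, Set.mem_iUnion, Finset.mem_range, exists_prop, dist_eq_norm,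
    sub_zero]
  constructor
  · intro hx
    have hy : ‖x / c‖ ≤ 1 := by
      rw [norm_div, hc]
      exact (div_le_one (by positivity)).2 hx
    refine ⟨PadicInt.zmodRepr ⟨x / c, hy⟩, PadicInt.zmodRepr_lt_p _, ?_⟩
    have h := PadicInt.norm_sub_zmodRepr_lt_one (⟨x / c, hy⟩ : ℤ_[p])
    rw [PadicInt.norm_def] at h
    generalize (PadicInt.zmodRepr ⟨x / c, hy⟩ : ℕ) = n at h
    rw [Padic.norm_le_pow_iff_norm_lt_pow_add_one]
    have e : x - n * c = (x / c - n) * c := by field_simp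
    rw [e, norm_mul, hc]
    exact mul_lt_of_lt_one_left (by positivity) h
  · rintro ⟨i, -, hi⟩
    have e : x = (x - i * c) + i * c := by ring
    rw [e]
    refine (Padic.nonarchimedean _ _).trans (max_le (hi.trans ?_) ?_)
    · exact zpow_le_zpow_right₀ hp1 (by omega)
    · rw [norm_mul, hc]
      have : ‖((i : ℤ) : ℚ_[p])‖ ≤ 1 := Padic.norm_int_le_one _
      rw [Int.cast_natCast] at this
      exact mul_le_of_le_one_left (by positivity) this

theorem padicHaar_closedBall_succ (k : ℤ) :
    padicHaar p (Metric.closedBall 0 ((p : ℝ) ^ (k + 1))) =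
      p * padicHaar p (Metric.closedBall 0 ((p : ℝ) ^ k)) := by
  have hp0 : (0 : ℝ) < p := by exact_mod_cast (Fact.out : p.Prime).pos
  rw [padic_closedBall_eq_iUnion, measure_biUnion_finset]
  · simp only [Measure.addHaar_closedBall_center]
    rw [Finset.sum_const, Finset.card_range, nsmul_eq_mul]
  · intro i hi j hj hij
    refine Set.disjoint_left.2 fun x hx hx' => hij ?_
    rw [Metric.mem_closedBall, dist_eq_norm] at hx hx'
    set c : ℚ_[p] := (p : ℚ_[p]) ^ (-(k + 1))
    have hc : ‖c‖ = (p : ℝ) ^ (k + 1) := by rw [Padic.norm_p_zpow, neg_neg]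
    have h1 : ‖((i - j : ℤ) : ℚ_[p]) * c‖ ≤ (p : ℝ) ^ k := by
      have e : ((i - j : ℤ) : ℚ_[p]) * c = (x - j * c) + -(x - i * c) := by
        push_cast
        ring
      rw [e]
      exact (Padic.nonarchimedean _ _).trans (max_le hx' (by rwa [norm_neg]))
    rw [Padic.norm_le_pow_iff_norm_lt_pow_add_one, norm_mul, hc,
      mul_lt_iff_lt_one_left (by positivity), Padic.norm_intCast_lt_one_iff] at h1
    have hi' := Finset.mem_range.1 (Finset.mem_coe.1 hi)
    have hj' := Finset.mem_range.1 (Finset.mem_coe.1 hj)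
    have h2 := Int.eq_zero_of_abs_lt_dvd h1 (by rw [abs_lt]; constructor <;> omega)
    omega
  · exact fun _ _ => Metric.isClosed_closedBall.measurableSet

theorem padicHaar_closedBall_pow (k : ℕ) :
    padicHaar p (Metric.closedBall 0 ((p : ℝ) ^ k)) = (p : ℝ≥0∞) ^ k := by
  induction k with
  | zero => simpa using padicHaar_unitBall p
  | succ k ih =>
    have h := padicHaar_closedBall_succ p k
    rw [zpow_natCast, ih] at h
    rw [pow_succ' (p : ℝ≥0∞), ← h]
    norm_cast

theorem padicHaar_unitSphere : padicHaar p {x | ‖x‖ = 1} = ENNReal.ofReal (1 - 1 / p) := by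
  have hp0 : (0 : ℝ) < p := by exact_mod_cast (Fact.out : p.Prime).pos
  have h1 := padicHaar_closedBall_succ p (-1)
  rw [neg_add_cancel, zpow_zero, padicHaar_unitBall] at h1
  have h2 : padicHaar p (Metric.closedBall 0 ((p : ℝ) ^ (-1 : ℤ))) = ENNReal.ofReal (1 / p) := by
    rw [one_div, ENNReal.ofReal_inv_of_pos hp0, ENNReal.ofReal_natCast]
    exact ENNReal.eq_inv_of_mul_eq_one_left (by rw [mul_comm]; exact h1.symm)
  have h3 : {x : ℚ_[p] | ‖x‖ = 1} =
      Metric.closedBall 0 1 \ Metric.closedBall 0 ((p : ℝ) ^ (-1 : ℤ)) := by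
    ext x
    simp only [Set.mem_sdiff, Metric.mem_closedBall, dist_zero_right, Set.mem_ofPred_eq,
      Padic.norm_le_pow_iff_norm_lt_pow_add_one, neg_add_cancel, zpow_zero, not_lt]
    exact le_antisymm_iff
  rw [h3, measure_sdiff _ Metric.isClosed_closedBall.measurableSet.nullMeasurableSet, h2,
    padicHaar_unitBall, ENNReal.ofReal_sub _ (by positivity), ENNReal.ofReal_one]
  · rw [h2]
    exact ENNReal.ofReal_ne_top
  · refine Metric.closedBall_subset_closedBall ?_
    rw [zpow_neg_one]
    exact Nat.cast_inv_le_one p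

theorem padicHaar_sphere (k : ℕ) : padicHaar p {x | ‖x‖ = (p : ℝ) ^ (k + 1)} =
    ENNReal.ofReal ((p : ℝ) ^ (k + 1) - (p : ℝ) ^ k) := by
  have hp0 : (0 : ℝ) < p := by exact_mod_cast (Fact.out : p.Prime).pos
  have hp1 : (1 : ℝ) ≤ p := by exact_mod_cast (Fact.out : p.Prime).one_le
  have h3 : {x : ℚ_[p] | ‖x‖ = (p : ℝ) ^ (k + 1)} =
      Metric.closedBall 0 ((p : ℝ) ^ (k + 1)) \ Metric.closedBall 0 ((p : ℝ) ^ k) := by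
    ext x
    have h : ‖x‖ ≤ (p : ℝ) ^ k ↔ ‖x‖ < (p : ℝ) ^ (k + 1) := by
      have := Padic.norm_le_pow_iff_norm_lt_pow_add_one x k
      rwa [← Nat.cast_succ, zpow_natCast, zpow_natCast] at this
    simp only [Set.mem_sdiff, Metric.mem_closedBall, dist_zero_right, Set.mem_ofPred_eq, h, not_lt]
    exact le_antisymm_iff
  rw [h3, measure_sdiff _ Metric.isClosed_closedBall.measurableSet.nullMeasurableSet,
    padicHaar_closedBall_pow, padicHaar_closedBall_pow, ENNReal.ofReal_sub _ (by positivity),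
    ENNReal.ofReal_pow hp0.le, ENNReal.ofReal_pow hp0.le, ENNReal.ofReal_natCast]
  · rw [padicHaar_closedBall_pow]
    exact ENNReal.pow_ne_top (ENNReal.natCast_ne_top p)
  · exact Metric.closedBall_subset_closedBall (pow_le_pow_right₀ hp1 (by omega))

theorem lintegral_inv_norm_sq : ∫⁻ x in {x | 1 < ‖x‖}, (ENNReal.ofReal (‖x‖ ^ 2))⁻¹ ∂padicHaar p =
    ENNReal.ofReal (1 / p) := by
  have hp0 : (0 : ℝ) < p := by exact_mod_cast (Fact.out : p.Prime).pos
  have hp1 : (1 : ℝ) < p := by exact_mod_cast (Fact.out : p.Prime).one_lt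
  have h1 : {x : ℚ_[p] | 1 < ‖x‖} = ⋃ k : ℕ, {x | ‖x‖ = (p : ℝ) ^ (k + 1)} := by
    ext x
    simp only [Set.mem_ofPred_eq, Set.mem_iUnion]
    constructor
    · intro hx
      have hx0 : x ≠ 0 := by
        rw [← norm_pos_iff]
        linarith
      have h := Padic.norm_eq_zpow_neg_valuation hx0
      rw [h] at hx
      have h2 : 0 < -x.valuation := (one_lt_zpow_iff_right₀ hp1).1 hx
      refine ⟨(-x.valuation).toNat - 1, ?_⟩
      rw [h, ← zpow_natCast]
      congr 1
      omega
    · rintro ⟨k, hk⟩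
      rw [hk]
      exact one_lt_pow₀ hp1 (by omega)
  have hmeas : ∀ k : ℕ, MeasurableSet {x : ℚ_[p] | ‖x‖ = (p : ℝ) ^ (k + 1)} := fun k =>
    (isClosed_eq continuous_norm continuous_const).measurableSet
  rw [h1, lintegral_iUnion hmeas]
  · have h2 : ∀ k : ℕ, ∫⁻ x in {x | ‖x‖ = (p : ℝ) ^ (k + 1)}, (ENNReal.ofReal (‖x‖ ^ 2))⁻¹ ∂padicHaar p =
        ENNReal.ofReal ((1 / p - 1 / (p : ℝ) ^ 2) * (1 / p) ^ k) := by
      intro k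
      rw [setLIntegral_congr_fun (g := fun _ => (ENNReal.ofReal (((p : ℝ) ^ (k + 1)) ^ 2))⁻¹)
        (hmeas k) fun x (hx : ‖x‖ = _) => by simp only [hx], setLIntegral_const, padicHaar_sphere,
        ← ENNReal.ofReal_inv_of_pos (by positivity), ← ENNReal.ofReal_mul (by positivity)]
      congr 1
      rw [one_div_pow]
      field_simp
      ring
    have h0 : 0 ≤ 1 / (p : ℝ) - 1 / (p : ℝ) ^ 2 := by
      rw [sub_nonneg]
      gcongr
      exact le_self_pow₀ hp1.le two_ne_zero
    have hlt : 1 / (p : ℝ) < 1 := (div_lt_one hp0).2 hp1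
    rw [tsum_congr h2, ← ENNReal.ofReal_tsum_of_nonneg, tsum_mul_left,
      tsum_geometric_of_lt_one (by positivity) hlt]
    · congr 1
      have : (p : ℝ) - 1 ≠ 0 := by linarith
      field_simp
    · exact fun k => by positivity
    · exact (summable_geometric_of_lt_one (by positivity) hlt).mul_left _
  · intro i j hij
    refine Set.disjoint_left.2 fun x hx hx' => hij ?_
    have h := (show ‖x‖ = _ from hx).symm.trans (show ‖x‖ = _ from hx')
    have := pow_right_injective₀ hp0 hp1.ne' h
    omega

theorem lintegral_inv_max_norm_sq : ∫⁻ x, (ENNReal.ofReal (max ‖x‖ 1 ^ 2))⁻¹ ∂padicHaar p =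
    ENNReal.ofReal (1 + 1 / p) := by
  have hm : MeasurableSet {x : ℚ_[p] | 1 < ‖x‖} :=
    (isOpen_lt continuous_const continuous_norm).measurableSet
  rw [← lintegral_add_compl _ hm]
  have h1 : ∫⁻ x in {x | 1 < ‖x‖}, (ENNReal.ofReal (max ‖x‖ 1 ^ 2))⁻¹ ∂padicHaar p =
      ENNReal.ofReal (1 / p) := by
    rw [← lintegral_inv_norm_sq]
    refine setLIntegral_congr_fun hm fun x hx => ?_
    simp only [max_eq_left (show 1 < ‖x‖ from hx).le]
  have h2 : {x : ℚ_[p] | 1 < ‖x‖}ᶜ = Metric.closedBall 0 1 := by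
    ext x
    simp
  have h3 : ∫⁻ x in Metric.closedBall 0 1, (ENNReal.ofReal (max ‖x‖ 1 ^ 2))⁻¹ ∂padicHaar p = 1 := by
    rw [setLIntegral_congr_fun (g := fun _ => 1) Metric.isClosed_closedBall.measurableSet,
      setLIntegral_const, padicHaar_unitBall, one_mul]
    intro x hx
    rw [Metric.mem_closedBall, dist_zero_right] at hx
    simp only [max_eq_right hx, one_pow, ENNReal.ofReal_one, inv_one]
  rw [h2, h1, h3, add_comm, ENNReal.ofReal_add one_pos.le (by positivity), ENNReal.ofReal_one]

end PadicIntegral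

/-! ### The local Tamagawa numbers -/

theorem isQuotientMap_mk {K : Type*} [Field K] [TopologicalSpace K] :
    IsQuotientMap (Points.mk : TorsorPoint K → Points K) :=
  isQuotientMap_quotient_mk'

theorem continuous_chart {K : Type*} [Field K] [TopologicalSpace K] :
    Continuous (chart : (Fin 3 → K) → Points K) := by
  refine isQuotientMap_mk.continuous.comp (Continuous.subtype_mk (continuous_pi fun ρ => ?_) _)
  cases ρ <;> simp only [chartCoord] <;> fun_prop

section Padic

variable {p : ℕ} [Fact p.Prime]

theorem exists_padicInt_mul_eq {u v : ℚ_[p]} (h : ‖u‖ ≤ ‖v‖) (hv : v ≠ 0) :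
    ∃ m : ℤ_[p], u = v * m ∧ ‖m‖ = ‖u‖ / ‖v‖ := by
  have h1 : ‖u / v‖ ≤ 1 := by
    rw [norm_div]
    exact (div_le_one (norm_pos_iff.2 hv)).2 h
  refine ⟨⟨u / v, h1⟩, ?_, ?_⟩
  · change u = v * (u / v)
    field_simp
  · exact norm_div u v

theorem isUnit_or_isUnit_of_isCoprime {m n : ℤ_[p]} (h : IsCoprime m n) :
    IsUnit m ∨ IsUnit n := by
  obtain ⟨u, v, huv⟩ := h
  exact (IsLocalRing.isUnit_or_isUnit_of_add_one huv).imp isUnit_of_mul_isUnit_right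
    isUnit_of_mul_isUnit_right

theorem exists_isCoprime_padicInt {u v : ℚ_[p]} (h : u ≠ 0 ∨ v ≠ 0) : ∃ d : Fin 2 → ℤ_[p],
    IsCoprime (d 0) (d 1) ∧ (∃ s : ℚ_[p], u = s * d 0 ∧ v = s * d 1) ∧
      (‖u‖ ≤ ‖v‖ → IsUnit (d 1)) := by
  by_cases huv : ‖u‖ ≤ ‖v‖
  · have hv : v ≠ 0 := by
      rintro rfl
      rw [norm_zero, norm_le_zero_iff] at huv
      exact h.elim (fun k => k huv) fun k => k rfl
    obtain ⟨m, hm, -⟩ := exists_padicInt_mul_eq huv hv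
    exact ⟨![m, 1], isCoprime_one_right, ⟨v, hm, by simp⟩, fun _ => isUnit_one⟩
  · have hu : u ≠ 0 := by
      rintro rfl
      simp at huv
    obtain ⟨m, hm, -⟩ := exists_padicInt_mul_eq (not_le.1 huv).le hu
    exact ⟨![1, m], isCoprime_one_left, ⟨u, by simp, hm⟩, fun k => absurd k huv⟩

/-- The `p`-adic integral points are those reducing neither to `V(a₀)` nor to one of the
two lines. -/
theorem mk_mem_integralPoints_iff (z : TorsorPoint ℚ_[p]) :
    Points.mk z ∈ integralPoints ℚ_[p] ℤ_[p] ↔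
      ‖z.1 .a1 * z.1 .x * z.1 .y‖ ≤ ‖z.1 .a0‖ ∧
        (‖z.1 .a1 * z.1 .x * z.1 .y‖ = ‖z.1 .a0‖ ∨
          ‖z.1 .b0‖ ≤ ‖z.1 .b1 * z.1 .x‖ ∧ ‖z.1 .c0‖ ≤ ‖z.1 .c1 * z.1 .y‖) := by
  have hne := blowDown_ne_zero z
  have hne2 : ∀ u v : ℚ_[p], (![u, v] : Fin 2 → ℚ_[p]) ≠ 0 → u ≠ 0 ∨ v ≠ 0 := by
    intro u v h
    by_contra! h'
    exact h (by ext i; fin_cases i <;> simp [h'])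
  constructor
  · rintro ⟨a, b, c, h⟩
    rw [isIntegralRep_mk_iff] at h
    obtain ⟨-, -, -, ha, hab, hac, ⟨s, hs0, hs1⟩, ⟨t, ht0, ht1⟩, ⟨u, hu0, hu1⟩⟩ := h
    simp only [PadicInt.algebraMap_apply] at hs0 hs1 ht0 ht1 hu0 hu1
    have ha' : ‖(a 0 : ℚ_[p])‖ = 1 := PadicInt.isUnit_iff.1 ha
    have hle : ∀ m : ℤ_[p], ‖(m : ℚ_[p])‖ ≤ 1 := fun m => m.2
    rw [hs0, hs1, ht0, ht1, hu0, hu1, norm_mul, norm_mul, norm_mul, norm_mul, norm_mul, norm_mul,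
      ha', mul_one]
    refine ⟨mul_le_of_le_one_right (norm_nonneg _) (hle _), ?_⟩
    by_cases h1 : IsUnit (a 1)
    · left
      rw [show ‖(a 1 : ℚ_[p])‖ = 1 from PadicInt.isUnit_iff.1 h1, mul_one]
    · right
      have hb := (isUnit_or_isUnit_of_isCoprime hab).resolve_left h1
      have hc := (isUnit_or_isUnit_of_isCoprime hac).resolve_left h1
      rw [show ‖(b 1 : ℚ_[p])‖ = 1 from PadicInt.isUnit_iff.1 hb,
        show ‖(c 1 : ℚ_[p])‖ = 1 from PadicInt.isUnit_iff.1 hc]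
      exact ⟨by have := hle (b 0); gcongr, by have := hle (c 0); gcongr⟩
  · rintro ⟨h1, h2⟩
    have ha0 : z.1 .a0 ≠ 0 := by
      rcases hne2 _ _ hne.1 with h | h
      · exact h
      · rw [← norm_pos_iff] at h ⊢
        exact h.trans_le h1
    obtain ⟨m, hm, hmn⟩ := exists_padicInt_mul_eq h1 ha0
    obtain ⟨b, hb, hb', hbu⟩ := exists_isCoprime_padicInt (hne2 _ _ hne.2.1)
    obtain ⟨c, hc, hc', hcu⟩ := exists_isCoprime_padicInt (hne2 _ _ hne.2.2)
    have hu : IsUnit m ∨ IsUnit (b 1) ∧ IsUnit (c 1) := by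
      rcases h2 with h | h
      · left
        rw [PadicInt.isUnit_iff, hmn, h, div_self (norm_ne_zero_iff.2 ha0)]
      · exact Or.inr ⟨hbu h.1, hcu h.2⟩
    have hcop : ∀ x y : ℤ_[p], IsUnit x ∨ IsUnit y → IsCoprime x y := by
      rintro x y (⟨u, rfl⟩ | ⟨u, rfl⟩)
      · exact ⟨((u⁻¹ : ℤ_[p]ˣ) : ℤ_[p]), 0, by simp⟩
      · exact ⟨0, ((u⁻¹ : ℤ_[p]ˣ) : ℤ_[p]), by simp⟩
    refine ⟨![1, m], b, c, (isIntegralRep_mk_iff _ _ _ _).2 ⟨isCoprime_one_left, hb, hc,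
      isUnit_one, hcop _ _ (hu.imp_right And.left), hcop _ _ (hu.imp_right And.right),
      ⟨z.1 .a0, by simp, hm⟩, hb', hc'⟩⟩

theorem isClosed_integralPoints : IsClosed (integralPoints ℚ_[p] ℤ_[p]) := by
  rw [← isQuotientMap_mk.isClosed_preimage]
  have h : Points.mk ⁻¹' integralPoints ℚ_[p] ℤ_[p] = {z : TorsorPoint ℚ_[p] |
      ‖z.1 .a1 * z.1 .x * z.1 .y‖ ≤ ‖z.1 .a0‖ ∧
        (‖z.1 .a1 * z.1 .x * z.1 .y‖ = ‖z.1 .a0‖ ∨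
          ‖z.1 .b0‖ ≤ ‖z.1 .b1 * z.1 .x‖ ∧ ‖z.1 .c0‖ ≤ ‖z.1 .c1 * z.1 .y‖)} :=
    Set.ext mk_mem_integralPoints_iff
  rw [h]
  have hc : ∀ ρ : Ray, Continuous fun z : TorsorPoint ℚ_[p] => z.1 ρ := fun ρ =>
    (continuous_apply ρ).comp continuous_subtype_val
  have h1 := ((hc .a1).mul (hc .x)).mul (hc .y)
  exact (isClosed_le h1.norm (hc .a0).norm).inter
    ((isClosed_eq h1.norm (hc .a0).norm).union
      ((isClosed_le (hc .b0).norm ((hc .b1).mul (hc .x)).norm).inter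
        (isClosed_le (hc .c0).norm ((hc .c1).mul (hc .y)).norm)))

theorem chart_mem_integralPoints_iff (t : Fin 3 → ℚ_[p]) :
    chart t ∈ integralPoints ℚ_[p] ℤ_[p] ↔
      1 ≤ ‖t 0‖ ∧ (‖t 0‖ = 1 ∨ ‖t 1‖ ≤ 1 ∧ ‖t 2‖ ≤ 1) := by
  rw [chart, mk_mem_integralPoints_iff]
  simp only [chartCoord, mul_one, norm_one, eq_comm]

/-- On the integral points, the density of the Tamagawa measure is a sum of two products of
functions in one variable; the summands belong to the points with `‖a‖ = 1` and those
with `‖a‖ > 1`. -/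
theorem indicator_density_eq (t : Fin 3 → ℚ_[p]) :
    (chart ⁻¹' integralPoints ℚ_[p] ℤ_[p]).indicator
        (fun t => (ENNReal.ofReal (sectionNorm formExp (chartCoord t)))⁻¹) t =
      ∏ i, (![{x | ‖x‖ = 1}.indicator 1, fun x => (ENNReal.ofReal (max ‖x‖ 1 ^ 2))⁻¹,
        fun x => (ENNReal.ofReal (max ‖x‖ 1 ^ 2))⁻¹] : Fin 3 → ℚ_[p] → ℝ≥0∞) i (t i) +
      ∏ i, (![{x | 1 < ‖x‖}.indicator fun x => (ENNReal.ofReal (‖x‖ ^ 2))⁻¹,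
        (Metric.closedBall 0 1).indicator 1,
        (Metric.closedBall 0 1).indicator 1] : Fin 3 → ℚ_[p] → ℝ≥0∞) i (t i) := by
  simp only [Fin.prod_univ_three, Matrix.cons_val_zero, Matrix.cons_val_one, Matrix.cons_val]
  have hmem := chart_mem_integralPoints_iff t
  have hA : 1 ≤ max ‖t 1‖ 1 := le_max_right _ _
  have hB : 1 ≤ max ‖t 2‖ 1 := le_max_right _ _
  rcases lt_trichotomy ‖t 0‖ 1 with h | h | h
  · rw [Set.indicator_of_notMem, Set.indicator_of_notMem, Set.indicator_of_notMem]
    · simp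
    · exact h.le.not_gt
    · exact h.ne
    · exact fun k => h.not_ge (hmem.1 k).1
  · rw [Set.indicator_of_mem (s := chart ⁻¹' _) (hmem.2 ⟨h.ge, Or.inl h⟩),
      Set.indicator_of_mem (s := {x : ℚ_[p] | ‖x‖ = 1}) h,
      Set.indicator_of_notMem (s := {x : ℚ_[p] | 1 < ‖x‖}) (not_lt.2 h.le),
      sectionNorm_formExp_chartCoord, formNorm, h]
    rw [max_self, div_one, one_mul, one_pow, max_eq_left (by
      calc (1 : ℝ) = 1 ^ 2 * 1 ^ 2 := by norm_num
        _ ≤ _ := by gcongr), ENNReal.ofReal_mul (by positivity), ENNReal.mul_inv]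
    · simp
    · left
      rw [ENNReal.ofReal_ne_zero_iff]
      positivity
    · left
      exact ENNReal.ofReal_ne_top
  · rw [Set.indicator_of_notMem (s := {x : ℚ_[p] | ‖x‖ = 1}) h.ne',
      Set.indicator_of_mem (s := {x : ℚ_[p] | 1 < ‖x‖}) h]
    by_cases h1 : ‖t 1‖ ≤ 1
    · by_cases h2 : ‖t 2‖ ≤ 1
      · rw [Set.indicator_of_mem (s := chart ⁻¹' _) (hmem.2 ⟨h.le, Or.inr ⟨h1, h2⟩⟩),
          Set.indicator_of_mem (by simpa using h1), Set.indicator_of_mem (by simpa using h2),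
          sectionNorm_formExp_chartCoord, formNorm, max_eq_right h1, max_eq_right h2,
          max_eq_left h.le, max_eq_right (by
            calc (1 : ℝ) ^ 2 * 1 ^ 2 = 1 ^ 2 := by norm_num
              _ ≤ _ := by gcongr), mul_div_right_comm, div_self (by linarith)]
        simp
      · rw [Set.indicator_of_notMem (s := chart ⁻¹' _),
          Set.indicator_of_notMem (a := t 2) (by simpa using h2)]
        · simp
        · intro k
          rcases (hmem.1 k).2 with k | k
          · exact h.ne' k
          · exact h2 k.2
    · rw [Set.indicator_of_notMem (s := chart ⁻¹' _),
        Set.indicator_of_notMem (a := t 1) (by simpa using h1)]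
      · simp
      · intro k
        rcases (hmem.1 k).2 with k | k
        · exact h.ne' k
        · exact h1 k.1

theorem tamagawaMeasure_integralPoints : tamagawaMeasure p (integralPoints ℚ_[p] ℤ_[p]) =
    ENNReal.ofReal (1 + 2 / p - 1 / p ^ 2 - 1 / p ^ 3) := by
  have hp0 : (0 : ℝ) < p := by exact_mod_cast (Fact.out : p.Prime).pos
  have hp1 : (1 : ℝ) / p ≤ 1 :=
    (div_le_one hp0).2 (by exact_mod_cast (Fact.out : p.Prime).one_le)
  have hm1 : MeasurableSet {x : ℚ_[p] | ‖x‖ = 1} :=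
    (isClosed_eq continuous_norm continuous_const).measurableSet
  have hm2 : MeasurableSet {x : ℚ_[p] | 1 < ‖x‖} :=
    (isOpen_lt continuous_const continuous_norm).measurableSet
  have hm3 : MeasurableSet (Metric.closedBall (0 : ℚ_[p]) 1) :=
    Metric.isClosed_closedBall.measurableSet
  have hf : Measurable fun x : ℚ_[p] => (ENNReal.ofReal (max ‖x‖ 1 ^ 2))⁻¹ :=
    (ENNReal.measurable_ofReal.comp
      ((continuous_norm.max continuous_const).pow 2).measurable).inv
  have hg : Measurable fun x : ℚ_[p] => (ENNReal.ofReal (‖x‖ ^ 2))⁻¹ :=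
    (ENNReal.measurable_ofReal.comp (continuous_norm.pow 2).measurable).inv
  have hchart : Measurable (chart : (Fin 3 → ℚ_[p]) → Points ℚ_[p]) := continuous_chart.measurable
  have hS := (isClosed_integralPoints (p := p)).measurableSet
  rw [tamagawaMeasure, Measure.map_apply hchart hS, withDensity_apply _ (hchart hS),
    ← lintegral_indicator (hchart hS), lintegral_congr indicator_density_eq, lintegral_add_left,
    lintegral_pi_prod, lintegral_pi_prod]
  · simp only [Fin.prod_univ_three, Matrix.cons_val_zero, Matrix.cons_val_one, Matrix.cons_val]
    rw [lintegral_indicator_one hm1, lintegral_indicator_one hm3, lintegral_indicator hm2,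
      lintegral_inv_max_norm_sq, lintegral_inv_norm_sq, padicHaar_unitSphere, padicHaar_unitBall,
      mul_one, mul_one, ← ENNReal.ofReal_mul (by linarith), ← ENNReal.ofReal_mul (by
        have : 0 ≤ 1 - (1 : ℝ) / p := by linarith
        positivity), ← ENNReal.ofReal_add (by
        have : 0 ≤ 1 - (1 : ℝ) / p := by linarith
        positivity) (by positivity)]
    congr 1
    field_simp
    ring
  · intro i
    fin_cases i
    · exact hg.indicator hm2
    · exact measurable_one.indicator hm3
    · exact measurable_one.indicator hm3
  · intro i
    fin_cases i
    · exact measurable_one.indicator hm1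
    · exact hf
    · exact hf
  · refine Finset.measurable_fun_prod _ fun i _ => ?_
    fin_cases i
    · exact (measurable_one.indicator hm1).comp (measurable_pi_apply 0)
    · exact hf.comp (measurable_pi_apply 1)
    · exact hf.comp (measurable_pi_apply 2)

end Padic

theorem localFactor_eq : localFactor = explicitFactor := by
  ext p
  rw [localFactor, explicitFactor, finrank_pic_boundary, tamagawaMeasure_integralPoints,
    ENNReal.toReal_ofReal]
  have h1 : (1 : ℝ) / ((p : ℕ) : ℝ) ≤ 1 / 2 :=
    one_div_le_one_div_of_le two_pos (by exact_mod_cast p.2.two_le)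
  have h0 : 0 ≤ (1 : ℝ) / ((p : ℕ) : ℝ) := by positivity
  rw [show (2 : ℝ) / ((p : ℕ) : ℝ) = 2 * (1 / ((p : ℕ) : ℝ)) by ring, ← one_div_pow,
    ← one_div_pow]
  nlinarith [mul_nonneg h0 h0]

/-! ### The residue measure -/

theorem mk_mem_stratum_iff {K : Type*} [Field K] (z : TorsorPoint K) (A : Finset Ray) :
    Points.mk z ∈ stratum K A ↔ ∀ ρ ∈ A, z.1 ρ = 0 := by
  constructor
  · rintro ⟨w, hw, h⟩ ρ hρ
    obtain ⟨l, -, hl⟩ := mk_eq_mk_iff.1 hw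
    rw [hl, h ρ hρ, mul_zero]
  · exact fun h => ⟨z, rfl, h⟩

theorem isClosed_stratum (A : Finset Ray) : IsClosed (stratum ℝ A) := by
  rw [← isQuotientMap_mk.isClosed_preimage]
  have h : Points.mk ⁻¹' stratum ℝ A = ⋂ ρ ∈ A, {z : TorsorPoint ℝ | z.1 ρ = 0} := by
    ext z
    simp [mk_mem_stratum_iff]
  rw [h]
  exact isClosed_biInter fun ρ _ =>
    isClosed_eq ((continuous_apply ρ).comp continuous_subtype_val) continuous_const

theorem sectionNorm_residueExp (t : Fin 2 → ℝ) :
    sectionNorm residueExp (chartCoord ![0, t 0, t 1]) = max |t 0| 1 ^ 2 * max |t 1| 1 ^ 2 := by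
  have h : ∏ ρ, chartCoord ![0, t 0, t 1] ρ ^ residueExp ρ = 1 := by
    have h0 : residueExp .a0 = 0 := by decide
    have h1 : residueExp .b0 = 0 := by decide
    have h2 : residueExp .c0 = 0 := by decide
    rw [prod_ray]
    simp [chartCoord, h0, h1, h2]
  rw [sectionNorm, h, norm_sectionsL1_chartCoord, norm_sectionsL2_chartCoord]
  simp only [Matrix.cons_val_zero, Matrix.cons_val_one, Matrix.cons_val, norm_zero, norm_one,
    Real.norm_eq_abs]
  rw [max_eq_left (by rw [zero_pow two_ne_zero]; positivity), max_eq_right zero_le_one, one_mul, div_one]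

theorem integral_inv_max_abs_sq : ∫ x : ℝ, (max |x| 1 ^ 2)⁻¹ = 4 := by
  rw [integral_comp_abs (f := fun x => (max x 1 ^ 2)⁻¹),
    ← Set.Ioc_union_Ioi_eq_Ioi (zero_le_one (α := ℝ))]
  have h1 : Set.EqOn (fun x : ℝ => (max x 1 ^ 2)⁻¹) (fun _ => 1) (Set.Ioc 0 1) := by
    intro x hx
    simp only [max_eq_right hx.2, one_pow, inv_one]
  have h2 : Set.EqOn (fun x : ℝ => (max x 1 ^ 2)⁻¹) (fun x => x ^ (-2 : ℝ)) (Set.Ioi 1) := by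
    intro x (hx : 1 < x)
    simp only [max_eq_left hx.le]
    rw [Real.rpow_neg (by linarith)]
    norm_num
  rw [setIntegral_union Set.Ioc_disjoint_Ioi_same measurableSet_Ioi, setIntegral_congr_fun
    measurableSet_Ioc h1, setIntegral_congr_fun measurableSet_Ioi h2, integral_Ioi_rpow_of_lt]
  · norm_num
  · norm_num
  · norm_num
  · exact (integrableOn_const (by simp)).congr_fun h1.symm measurableSet_Ioc
  · exact (integrableOn_Ioi_rpow_of_lt (by norm_num) one_pos).congr_fun h2.symm measurableSet_Ioi

theorem lintegral_inv_max_abs_sq : ∫⁻ x : ℝ, (ENNReal.ofReal (max |x| 1 ^ 2))⁻¹ = 4 := by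
  have hpos : ∀ x : ℝ, 0 < max |x| 1 := fun x => lt_max_of_lt_right one_pos
  have h1 : ∀ x : ℝ, (ENNReal.ofReal (max |x| 1 ^ 2))⁻¹ = ENNReal.ofReal (max |x| 1 ^ 2)⁻¹ :=
    fun x => (ENNReal.ofReal_inv_of_pos (pow_pos (hpos x) 2)).symm
  have h2 : Integrable fun x : ℝ => (max |x| 1 ^ 2)⁻¹ := by
    refine (integrable_inv_one_add_sq.const_mul 2).mono' ?_ (Eventually.of_forall fun x => ?_)
    · exact (Continuous.inv₀ (by fun_prop) fun x => (pow_pos (hpos x) 2).ne').aestronglyMeasurable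
    · rw [Real.norm_of_nonneg (by positivity), ← div_eq_mul_inv, inv_le_comm₀ (by positivity)
        (by positivity), inv_div, div_le_iff₀ two_pos]
      have h3 : x ^ 2 ≤ max |x| 1 ^ 2 := by
        rw [← sq_abs x]
        gcongr
        exact le_max_left _ _
      have h4 : (1 : ℝ) ≤ max |x| 1 ^ 2 := one_le_pow₀ (le_max_right _ _)
      linarith
  rw [lintegral_congr h1, ← ofReal_integral_eq_lintegral_ofReal h2
    (Eventually.of_forall fun x => by positivity), integral_inv_max_abs_sq]
  simp

theorem residueMeasureM_stratum : residueMeasureM (stratum ℝ faceM) = 32 := by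
  have hchart : Measurable (chartM : (Fin 2 → ℝ) → Points ℝ) := by
    refine (continuous_chart.comp (continuous_pi fun i => ?_)).measurable
    fin_cases i
    · exact continuous_const
    · exact continuous_apply 0
    · exact continuous_apply 1
  have hpre : chartM ⁻¹' stratum ℝ faceM = Set.univ := by
    refine Set.eq_univ_of_forall fun t => ?_
    rw [Set.mem_preimage, chartM, chart, mk_mem_stratum_iff]
    simp [faceM, chartCoord]
  have h1 : ∀ t : Fin 2 → ℝ, (ENNReal.ofReal (sectionNorm residueExp
      (chartCoord ![0, t 0, t 1])))⁻¹ = ∏ i, (ENNReal.ofReal (max |t i| 1 ^ 2))⁻¹ := by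
    intro t
    have h0 : 0 < max |t 0| 1 := lt_max_of_lt_right one_pos
    rw [sectionNorm_residueExp, ENNReal.ofReal_mul (by positivity), ENNReal.mul_inv,
      Fin.prod_univ_two]
    · left
      rw [ENNReal.ofReal_ne_zero_iff]
      positivity
    · left
      exact ENNReal.ofReal_ne_top
  rw [residueMeasureM, Measure.smul_apply, Measure.map_apply hchart (isClosed_stratum _).measurableSet,
    hpre, withDensity_apply _ MeasurableSet.univ, Measure.restrict_univ, lintegral_congr h1,
    volume_pi, lintegral_pi_prod volume fun (_ : Fin 2) x => (ENNReal.ofReal (max |x| 1 ^ 2))⁻¹]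
  · rw [Fin.prod_univ_two, lintegral_inv_max_abs_sq, faceM, Finset.card_singleton]
    norm_num
  · exact fun _ => (ENNReal.measurable_ofReal.comp (by fun_prop)).inv

theorem cInfinity_eq : cInfinity = 4 := by
  rw [cInfinity, alpha_faceM, residueMeasureM_stratum]
  norm_num

theorem cInfinity_mul_cFin : cInfinity * cFin = cExplicit := by
  rw [cInfinity_eq, cFin, localFactor_eq, cExplicit]

/-! ### The asymptotic formula -/

theorem cExplicit_eq : cExplicit = 4 * (coprimeDensity ^ 2 * meanDensity) := by
  rw [cExplicit, hasProd_explicitFactor.tprod_eq]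

/-- The asymptotic formula with an error term of size `B log B`. -/
theorem countingFunction_sub_isBigO :
    (fun B => countingFunction B - cExplicit * B * Real.log B ^ 2) =O[atTop]
      fun B => B * Real.log B := by
  obtain ⟨C, hC, h⟩ := exists_abs_tupleCount_sub_le
  refine IsBigO.of_bound (16 * C) ?_
  filter_upwards [eventually_ge_atTop (Real.exp 1)] with B hB
  have hB1 : 1 ≤ B := (Real.one_le_exp zero_le_one).trans hB
  have hlog : 1 ≤ Real.log B := (Real.le_log_iff_exp_le (by linarith)).2 hB
  rw [countingFunction_eq, cExplicit_eq, Real.norm_eq_abs, Real.norm_of_nonneg (by positivity)]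
  calc |8 * (tupleCount B : ℝ) - 4 * (coprimeDensity ^ 2 * meanDensity) * B * Real.log B ^ 2|
      = 8 * |(tupleCount B : ℝ) - coprimeDensity ^ 2 * meanDensity / 2 * B * Real.log B ^ 2| := by
        rw [← abs_of_pos (by norm_num : (0 : ℝ) < 8), ← abs_mul, abs_of_pos (by norm_num : (0 : ℝ) < 8)]
        congr 1
        ring
    _ ≤ 8 * (C * B * (1 + Real.log B)) := by
        gcongr
        exact h hB1
    _ ≤ 8 * (C * B * (Real.log B + Real.log B)) := by gcongr
    _ = 16 * C * (B * Real.log B) := by ring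

theorem isBigO_log_log : (fun B => B * Real.log B) =O[atTop]
    fun B => B * Real.log B * Real.log (Real.log B) ^ 3 := by
  refine IsBigO.of_bound 1 ?_
  have hev := (Real.tendsto_log_atTop.comp Real.tendsto_log_atTop).eventually_ge_atTop 1
  filter_upwards [hev] with B hB
  rw [one_mul, norm_mul _ (Real.log (Real.log B) ^ 3)]
  refine le_mul_of_one_le_right (norm_nonneg _) ?_
  rw [norm_pow]
  exact one_le_pow₀ (hB.trans (le_abs_self _))

theorem exists_relative_error (hc : cExplicit ≠ 0) :
    ∃ ε : ℝ → ℝ, Tendsto ε atTop (𝓝 0) ∧ ∀ᶠ B in atTop,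
      countingFunction B = cExplicit * B * Real.log B ^ 2 * (1 + ε B) := by
  have hlittle : (fun B => B * Real.log B) =o[atTop]
      fun B => cExplicit * B * Real.log B ^ 2 := by
    have h1 : (fun _ : ℝ => (1 : ℝ)) =o[atTop] Real.log :=
      Real.isLittleO_const_log_atTop
    have h2 := (isBigO_refl (fun B : ℝ => B * Real.log B) atTop).mul_isLittleO h1
    have h3 := h2.const_mul_right hc
    refine (h3.congr_left fun B => by ring).congr_right fun B => by ring
  have h := (countingFunction_sub_isBigO.trans_isLittleO hlittle).tendsto_div_nhds_zero
  refine ⟨_, h, ?_⟩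
  filter_upwards [eventually_gt_atTop 1] with B hB
  have hlog : Real.log B ≠ 0 := (Real.log_pos hB).ne'
  have hB0 : B ≠ 0 := by linarith
  field_simp
  ring

end ToricThreefold

theorem theorem3p1 :
    -- `M` is a maximal, but not maximal-dimensional face of the Clemens complex
    (IsMaximalFace faceM ∧ ∃ A, IsFace A ∧ faceM.card < A.card) ∧
    -- the log anticanonical height of a point of `𝔘(ℤ) ∩ T(ℚ)`
    (∀ P ∈ torus ℚ, ∀ a b c : Fin 2 → ℤ, IsIntegralRep P a b c →
      height P = |(a 1 : ℝ)| * max |(b 0 : ℝ)| |(b 1 : ℝ)| ^ 2 * max |(c 0 : ℝ)| |(c 1 : ℝ)| ^ 2) ∧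
    -- the interpreted asymptotic formula, including the convergence of the product over the primes
    Multipliable localFactor ∧
    (∃ ε : ℝ → ℝ, Tendsto ε atTop (𝓝 0) ∧ ∀ᶠ B in atTop,
      countingFunction B =
        cInfinity * cFin * B * Real.log B ^ (bInv faceM - 1) * (1 + ε B)) ∧
    -- the explicit asymptotic formula
    Multipliable explicitFactor ∧
    (fun B => countingFunction B - cExplicit * B * Real.log B ^ 2) =O[atTop]
      (fun B => B * Real.log B * Real.log (Real.log B) ^ 3) ∧
    -- the two formulas agree
    cInfinity * cFin = cExplicit ∧ bInv faceM = 3 := by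
  have hc : cExplicit ≠ 0 := mul_ne_zero four_ne_zero tprod_explicitFactor_ne_zero
  refine ⟨⟨isMaximalFace_faceM, _, isFace_exceptional, by decide⟩,
    fun P hP a b c h => height_eq hP h, ?_, ?_, hasProd_explicitFactor.multipliable,
    countingFunction_sub_isBigO.trans isBigO_log_log, cInfinity_mul_cFin, bInv_faceM⟩
  · rw [localFactor_eq]
    exact hasProd_explicitFactor.multipliable
  · obtain ⟨ε, hε, h⟩ := exists_relative_error hc
    refine ⟨ε, hε, h.mono fun B hB => ?_⟩
    rw [hB, cInfinity_mul_cFin, bInv_faceM]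
    norm_cast
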